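/- Let $G$ be a torsion-free group (the identity is its only element of finite order) and let $H\le G$ be a subgroup such that $G$ is hyperbolic relative to $H$. Let $\mathbb{Z}[G/H]$ be the permutation $\mathbb{Z}G$-module on the set of left cosets of $H$, let $\epsilon\colon\mathbb{Z}[G/H]\to\mathbb{Z}$ be the $\mathbb{Z}G$-linear map that sends every coset to $1$, and let $\Delta_{G/H}=\ker\epsilon$. Then there are an $n\ge 0$ and an exact sequence of $\mathbb{Z}G$-modules $$0\to F_n\to\cdots\to F_1\to F_0\to\Delta_{G/H}\to 0$$ in which every $F_i$ is free and finitely generated; in particular, $\Delta_{G/H}$ is of type $FP$ over $\mathbb{Z}G$ (it has a finite-length resolution by finitely generated projective $\mathbb{Z}G$-modules). Consequently, the relative cohomological dimension $$\mathrm{cd}_{\mathbb{Z}}(G,H)=\sup\{\,i \mid H^i(G,H;M)\neq 0\text{ for some }\mathbb{Z}G\text{-module }M\,\},\qquad H^i(G,H;M):=\mathrm{Ext}^{i-1}_{\mathbb{Z}G}(\Delta_{G/H},M),$$ is finite, i.e. less than $+\infty$. Here relative hyperbolicity is meant as follows. Let $S$ be a finite generating set of $G$ that contains a generating set of $H$,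 let $\Gamma=\Gamma(G,S)$ be the Cayley graph with word metric $d_S$, and let the coned-off Cayley graph $\hat\Gamma$ be obtained from $\Gamma$ by adding for each left coset $gH$ a cone vertex $v(gH)$ and an edge of length $\tfrac12$ from $v(gH)$ to each element of $gH$; $\hat d$ is its path metric, edges of $\Gamma$ having length $1$. For an edge path $c$ in $\Gamma$, let $\hat c$ be the path in $\hat\Gamma$ obtained by replacing each maximal subpath of $c$ that has at least one edge and all of whose vertices lie in one coset $gH$ by the path of length $1$ with the same endpoints through $v(gH)$; the path $c$ enters (penetrates) $gH$ if there is such a subpath, whose first and last vertices are the entry and exit points. The path $c$ is a $T$-relative quasi-geodesic if $T^{-1}|t-t'|\le\hat d(\hat c(t),\hat c(t'))\le T|t-t'|$ for all vertices $\hat c(t),\hat c(t')$ of $\hat c$, parametrized by arc length; such a path enters each coset at most once. Then $G$ is hyperbolic relative to $H$ if for some such $S$ the graph $\hat\Gamma$ is Gromov hyperbolic and bounded coset penetration holds: for every $T>0$ there is an $r$ such that for all $T$-relative quasi-geodesics $c_1,c_2$ in $\Gamma$ with the same initial and the same terminal vertex, (1) if $c_1$ enters a coset and its entry and exit points there are more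 than $r$ apart in $d_S$, then $c_2$ enters the same coset; and (2) if $c_1$ and $c_2$ enter the same coset, then their entry points are at $d_S$-distance at most $r$, and so are their exit points. -/

import Mathlib

universe u

noncomputable section

namespace RelHyp

/-! ### Coned-off Cayley graphs -/

section ConedOff

variable {G : Type u} [Group G]

/-- The coned-off Cayley graph of `(G, H)` with respect to `S`: the Cayley graph of `G`
(vertices `Sum.inl g`, edges between `g` and `g * s`), together with a cone vertex `Sum.inr q`
for every left coset `q` of `H`, joined to every element of `q`. -/
def conedOffGraph (H : Subgroup G) (S : Set G) : SimpleGraph (G ⊕ (G ⧸ H)) where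
  Adj
    | .inl x, .inl y => (SimpleGraph.mulCayley S).Adj x y
    | .inl x, .inr q => (x : G ⧸ H) = q
    | .inr q, .inl x => (x : G ⧸ H) = q
    | .inr _, .inr _ => False
  symm := ⟨by
    rintro (x | q) (y | q') h
    · exact SimpleGraph.Adj.symm h
    · exact h
    · exact h
    · exact h⟩
  loopless := ⟨by
    rintro (x | q) h
    · exact (SimpleGraph.mulCayley S).irrefl h
    · exact h⟩

/-- Edges of the Cayley graph have length `1`, edges at a cone vertex have length `1/2`. -/
def edgeLength {H : Subgroup G} : G ⊕ (G ⧸ H) → G ⊕ (G ⧸ H) → ℝ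
  | .inl _, .inl _ => 1
  | _, _ => 1 / 2

/-- The length of an edge path in the coned-off graph, given by its list of vertices. -/
def pathLength {H : Subgroup G} : List (G ⊕ (G ⧸ H)) → ℝ
  | [] => 0
  | [_] => 0
  | x :: y :: l => edgeLength x y + pathLength (y :: l)

/-- The path metric `d̂` of the coned-off Cayley graph, on its vertices. -/
def conedOffDist (H : Subgroup G) (S : Set G) (x y : G ⊕ (G ⧸ H)) : ℝ :=
  ⨅ w : (conedOffGraph H S).Walk x y, pathLength w.support

/-- The Gromov product `(x | y)_w` for a distance function `d`. -/
def gromovProduct {X : Type u} (d : X → X → ℝ) (w x y : X) : ℝ :=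
  (d x w + d y w - d x y) / 2

/-- Gromov hyperbolicity of a distance function. -/
def IsGromovHyperbolic {X : Type u} (d : X → X → ℝ) : Prop :=
  ∃ δ : ℝ, 0 ≤ δ ∧ ∀ w x y z : X,
    min (gromovProduct d w x y) (gromovProduct d w y z) - δ ≤ gromovProduct d w x z

/-! ### Relative quasi-geodesics and bounded coset penetration

Edge paths in the Cayley graph are handled through their lists of vertices. -/

open Classical in
/-- The decomposition of a path into its maximal subpaths all of whose vertices lie in one left
coset of `H`. -/
def cosetRuns (H : Subgroup G) (c : List G) : List (List G) :=
  c.splitBy fun x y => decide ((x : G ⧸ H) = (y : G ⧸ H))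

/-- What replaces a maximal subpath in a coset `q`: a single vertex is kept, and a subpath with at
least one edge, from `x` to `y`, becomes the path of length `1` from `x` to `y` through the cone
vertex of `q`. -/
def coneRun (H : Subgroup G) : List G → List (G ⊕ (G ⧸ H))
  | [] => []
  | [x] => [.inl x]
  | x :: y :: l => [.inl x, .inr (x : G ⧸ H), .inl ((y :: l).getLast (List.cons_ne_nil y l))]

/-- The image `ĉ` in the coned-off graph of a path `c` in the Cayley graph. -/
def coneOffPath (H : Subgroup G) (c : List G) : List (G ⊕ (G ⧸ H)) :=
  (cosetRuns H c).flatMap (coneRun H)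

/-- `c` is a `T`-relative quasi-geodesic: `ĉ`, parametrized by arc length, satisfies
`T⁻¹ |t - t'| ≤ d̂ (ĉ t) (ĉ t') ≤ T |t - t'|`. Here `t`, `t'` run over the parameters of the vertices
of `ĉ`; the parameter of the vertex number `i` is the length of the initial segment of `ĉ` that
ends there. -/
def IsRelQuasiGeodesic (H : Subgroup G) (S : Set G) (T : ℝ) (c : List G) : Prop :=
  ∀ i j : Fin (coneOffPath H c).length,
    let t := pathLength ((coneOffPath H c).take ((i : ℕ) + 1))
    let t' := pathLength ((coneOffPath H c).take ((j : ℕ) + 1))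
    T⁻¹ * |t - t'| ≤ conedOffDist H S ((coneOffPath H c).get i) ((coneOffPath H c).get j) ∧
      conedOffDist H S ((coneOffPath H c).get i) ((coneOffPath H c).get j) ≤ T * |t - t'|

/-- The path `c` enters (penetrates) the coset `q` at `x` and exits it at `y`: some maximal subpath
of `c` with vertices in `q` has at least one edge and goes from `x` to `y`. Equivalently, `ĉ`
passes from `x` to `y` through the cone vertex of `q`. For a relative quasi-geodesic there is at
most one such subpath for each `q`. -/
def Penetrates (H : Subgroup G) (c : List G) (q : G ⧸ H) (x y : G) : Prop :=
  ∃ p ∈ cosetRuns H c, 2 ≤ p.length ∧ p.head? = some x ∧ p.getLast? = some y ∧ (x : G ⧸ H) = q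

/-- Bounded coset penetration; distances between elements of `G` are in the word metric of `S`. -/
def BoundedCosetPenetration (H : Subgroup G) (S : Set G) : Prop :=
  ∀ T : ℝ, 0 < T → ∃ r : ℝ, ∀ (a b : G) (c₁ c₂ : (SimpleGraph.mulCayley S).Walk a b),
    IsRelQuasiGeodesic H S T c₁.support → IsRelQuasiGeodesic H S T c₂.support →
    (∀ (q : G ⧸ H) (x y : G), Penetrates H c₁.support q x y →
        r < ((SimpleGraph.mulCayley S).dist x y : ℝ) →
        ∃ x' y' : G, Penetrates H c₂.support q x' y') ∧
    (∀ (q : G ⧸ H) (x y x' y' : G),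
        Penetrates H c₁.support q x y → Penetrates H c₂.support q x' y' →
        ((SimpleGraph.mulCayley S).dist x x' : ℝ) ≤ r ∧
        ((SimpleGraph.mulCayley S).dist y y' : ℝ) ≤ r)

/-- `G` is hyperbolic relative to `H`: for some finite generating set `S` of `G` that contains a
generating set of `H`, the coned-off Cayley graph is Gromov hyperbolic and bounded coset penetration
holds. -/
def IsHyperbolicRelativeTo (G : Type u) [Group G] (H : Subgroup G) : Prop :=
  ∃ S : Set G, S.Finite ∧ Subgroup.closure S = ⊤ ∧ Subgroup.closure (S ∩ (H : Set G)) = H ∧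
    IsGromovHyperbolic (conedOffDist H S) ∧ BoundedCosetPenetration H S

end ConedOff

/-! ### Finite resolutions -/

/-- There is an exact sequence `0 → F n → ⋯ → F 1 → F 0 → M → 0` of `R`-modules in which every
`F i` is finitely generated and free. -/
def HasFiniteFreeResolution (R : Type u) [Ring R] (M : Type u) [AddCommGroup M] [Module R M] :
    Prop :=
  ∃ (n : ℕ) (F : ℕ → ModuleCat.{u} R) (d : ∀ i, F (i + 1) →ₗ[R] F i) (ε : F 0 →ₗ[R] M),
    (∀ i, Module.Free R (F i) ∧ Module.Finite R (F i)) ∧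
    (∀ i, n < i → Subsingleton (F i)) ∧
    Function.Surjective ε ∧ Function.Exact (d 0) ε ∧ ∀ i, Function.Exact (d (i + 1)) (d i)

/-- The `R`-module `M` is of type `FP`: there is an exact sequence
`0 → P n → ⋯ → P 1 → P 0 → M → 0` of `R`-modules in which every `P i` is finitely generated and
projective. -/
def IsTypeFP (R : Type u) [Ring R] (M : Type u) [AddCommGroup M] [Module R M] : Prop :=
  ∃ (n : ℕ) (P : ℕ → ModuleCat.{u} R) (d : ∀ i, P (i + 1) →ₗ[R] P i) (ε : P 0 →ₗ[R] M),
    (∀ i, Module.Projective R (P i) ∧ Module.Finite R (P i)) ∧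
    (∀ i, n < i → Subsingleton (P i)) ∧
    Function.Surjective ε ∧ Function.Exact (d 0) ε ∧ ∀ i, Function.Exact (d (i + 1)) (d i)

/-! ### Relative cohomology of a group pair -/

section Cohomology

variable {G : Type u} [Group G] (H : Subgroup G)

/-- The `ℤG`-module `ℤ[G/H]` on the set of left cosets. -/
abbrev CosetModule : Type u := (Representation.ofMulAction ℤ G (G ⧸ H)).asModule

/-- The sum of the coefficients, as a `ℤ`-linear map on `ℤ[G/H]`. -/
def coeffSum : MonoidAlgebra ℤ (G ⧸ H) →ₗ[ℤ] ℤ :=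
  Finsupp.linearCombination ℤ (fun _ : G ⧸ H => (1 : ℤ)) ∘ₗ
    (MonoidAlgebra.coeffLinearEquiv ℤ).toLinearMap

/-- The augmentation `ℤ[G/H] → ℤ`, which sends every coset to `1`, as a morphism of `ℤG`-modules to
the trivial module `ℤ`. -/
def augmentation :
    CosetModule H →ₗ[MonoidAlgebra ℤ G] (Representation.trivial ℤ G ℤ).asModule :=
  Representation.IntertwiningMap.equivLinearMapAsModule _ _
    { toLinearMap := coeffSum H
      isIntertwining' := fun g => by ext x; simp [coeffSum] }

/-- The `ℤG`-module `Δ_{G/H}`, the kernel of the augmentation `ℤ[G/H] → ℤ`. -/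
abbrev Delta : Submodule (MonoidAlgebra ℤ G) (CosetModule H) := LinearMap.ker (augmentation H)

/-- The relative cohomology `H^i(G, H; M) = Ext_{ℤG}^{i-1}(Δ_{G/H}, M)`, which is zero
for `i = 0`. -/
def RelCohomology (M : ModuleCat.{u} (MonoidAlgebra ℤ G)) : ℕ → Type u
  | 0 => PUnit
  | i + 1 => CategoryTheory.Abelian.Ext (ModuleCat.of (MonoidAlgebra ℤ G) (Delta H)) M i

/-- The cohomological dimension of the pair `(G, H)`, the supremum of all `i` such that
`H^i(G, H; M)` is nonzero for some `ℤG`-module `M`; it is `⊥` if there are none, and `⊤` if these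
`i` are unbounded. -/
def relCohomologicalDimension : WithBot ℕ∞ :=
  sSup {n | ∃ i : ℕ, n = (i : WithBot ℕ∞) ∧
    ∃ M : ModuleCat.{u} (MonoidAlgebra ℤ G), Nontrivial (RelCohomology H M i)}

end Cohomology

end RelHyp

end

/-!
Bounded coset penetration makes the coned-off Cayley graph fine: two elements of a coset that are
joined by a short path avoiding its cone vertex are close in the word metric. As triangles are thin,
it follows that vertices joined by a geodesic which avoids a cone vertex have close projections to
its coset. Gluing a combinatorial horoball onto every coset turns the Cayley graph into the cusped
graph. It is hyperbolic because the lifts of the geodesics of the coned-off graph, in which a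
passage through a cone vertex becomes a path through the horoball, form thin triangles.

The distance in the cusped graph between cosets is therefore hyperbolic; it is `G`-invariant, only
finitely many cosets are close to two distinct given ones, and up to translation there are finitely
many pairs of cosets at bounded distance. In the Rips complex of large scale on `G ⧸ H`, a cycle can
be pushed towards a base point, its farthest vertices first, so the complex is acyclic. As `G` is
torsion-free, it acts freely and with finitely many orbits on the simplices with at least two
vertices. Their chains, realised in the exterior algebra of `ℤ[G/H]` with a contraction as boundary
map, hence form a finite free resolution of the kernel of the augmentation on the chains `ℤ[G/H]` on
one vertex, which is `Δ`. Dimension shifting along it bounds the projective dimension of `Δ`.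
-/

noncomputable section

namespace RelHyp

open SimpleGraph

section WeightedGraph

variable {V : Type*} {Γ : SimpleGraph V} {ω : V → V → ℕ} {u v x : V}

/-- The total weight of the edges of a walk, for a weight function `ω` on ordered pairs of
vertices. -/
def walkWeight (ω : V → V → ℕ) (w : Γ.Walk u v) : ℕ :=
  (w.darts.map fun e => ω e.fst e.snd).sum

@[simp] lemma walkWeight_nil : walkWeight ω (Walk.nil : Γ.Walk u u) = 0 := rfl

@[simp] lemma walkWeight_cons (h : Γ.Adj u v) (w : Γ.Walk v x) :
    walkWeight ω (Walk.cons h w) = ω u v + walkWeight ω w := by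
  simp [walkWeight]

lemma walkWeight_append (w : Γ.Walk u v) (w' : Γ.Walk v x) :
    walkWeight ω (w.append w') = walkWeight ω w + walkWeight ω w' := by
  simp [walkWeight]

lemma walkWeight_reverse (hω : ∀ a b, ω a b = ω b a) (w : Γ.Walk u v) :
    walkWeight ω w.reverse = walkWeight ω w := by
  simp [walkWeight, List.sum_reverse, Function.comp_def, hω]

/-- The distance of a weighted graph: the least weight of a walk, or `0` if there is no walk. -/
def weightedDist (Γ : SimpleGraph V) (ω : V → V → ℕ) (u v : V) : ℕ :=
  ⨅ w : Γ.Walk u v, walkWeight ω w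

lemma weightedDist_le (w : Γ.Walk u v) : weightedDist Γ ω u v ≤ walkWeight ω w :=
  ciInf_le (OrderBot.bddBelow _) w

@[simp] lemma weightedDist_self : weightedDist Γ ω u u = 0 :=
  Nat.le_zero.1 (weightedDist_le (Walk.nil : Γ.Walk u u))

lemma weightedDist_le_of_adj (h : Γ.Adj u v) : weightedDist Γ ω u v ≤ ω u v := by
  simpa using weightedDist_le (ω := ω) h.toWalk

lemma exists_walkWeight_eq_weightedDist (hΓ : Γ.Connected) (ω : V → V → ℕ) (u v : V) :
    ∃ w : Γ.Walk u v, walkWeight ω w = weightedDist Γ ω u v :=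
  have : Nonempty (Γ.Walk u v) := hΓ.preconnected u v
  ciInf_mem fun w : Γ.Walk u v => walkWeight ω w

/-- An integral metric on the vertices of a graph in which any two vertices are joined by a
geodesic made of edges of length at most `2`. -/
structure IsGeodesicMetric (Γ : SimpleGraph V) (d : V → V → ℕ) : Prop where
  eq_of_eq_zero : ∀ {u v}, d u v = 0 → u = v
  self : ∀ u, d u u = 0
  comm : ∀ u v, d u v = d v u
  triangle : ∀ u v x, d u x ≤ d u v + d v x
  exists_step : ∀ {u v}, u ≠ v → ∃ u', Γ.Adj u u' ∧ d u u' ≤ 2 ∧ d u u' + d u' v = d u v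

lemma isGeodesicMetric_weightedDist (hΓ : Γ.Connected) (hω : ∀ a b, ω a b = ω b a)
    (hpos : ∀ a b, 1 ≤ ω a b) (hle : ∀ a b, ω a b ≤ 2) :
    IsGeodesicMetric Γ (weightedDist Γ ω) := by
  have exists_walk := exists_walkWeight_eq_weightedDist hΓ ω
  have triangle (u v x) :
      weightedDist Γ ω u x ≤ weightedDist Γ ω u v + weightedDist Γ ω v x := by
    obtain ⟨w, hw⟩ := exists_walk u v
    obtain ⟨w', hw'⟩ := exists_walk v x
    rw [← hw, ← hw', ← walkWeight_append]
    exact weightedDist_le _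
  refine ⟨fun {u v} h => ?_, fun u => weightedDist_self, fun u v => ?_, triangle,
    fun {u v} huv => ?_⟩
  · obtain ⟨w, hw⟩ := exists_walk u v
    cases w with
    | nil => rfl
    | @cons _ b _ hadj w =>
      rw [walkWeight_cons] at hw
      have := hpos u b
      omega
  · have symm_le (u v) : weightedDist Γ ω u v ≤ weightedDist Γ ω v u := by
      obtain ⟨w, hw⟩ := exists_walk v u
      rw [← hw, ← walkWeight_reverse hω]
      exact weightedDist_le _
    exact le_antisymm (symm_le u v) (symm_le v u)
  · obtain ⟨w, hw⟩ := exists_walk u v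
    cases w with
    | nil => exact absurd rfl huv
    | @cons _ b _ hadj w =>
      rw [walkWeight_cons] at hw
      have hstep := weightedDist_le_of_adj (ω := ω) hadj
      have htail := weightedDist_le (ω := ω) w
      have := triangle u b v
      exact ⟨b, hadj, hstep.trans (hle u b), by omega⟩

end WeightedGraph

section GraphIso

variable {V W : Type*} {Γ : SimpleGraph V} {Γ' : SimpleGraph W}

lemma dist_map_le (f : Γ →g Γ') {u v : V} (h : Γ.Reachable u v) :
    Γ'.dist (f u) (f v) ≤ Γ.dist u v := by
  obtain ⟨w, hw⟩ := h.exists_walk_length_eq_dist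
  rw [← hw, ← Walk.length_map f w]
  exact SimpleGraph.dist_le _

lemma dist_map_iso (e : Γ ≃g Γ') (u v : V) : Γ'.dist (e u) (e v) = Γ.dist u v := by
  by_cases h : Γ.Reachable u v
  · refine le_antisymm (dist_map_le e.toHom h) ?_
    simpa using dist_map_le e.symm.toHom (e.reachable_iff.2 h)
  · rw [dist_eq_zero_of_not_reachable h,
      dist_eq_zero_of_not_reachable (mt e.reachable_iff.1 h)]

end GraphIso

section CayleyGraph

variable {G : Type*} [Group G] {H : Subgroup G} {S : Set G} {x y : G}

lemma exists_walk_of_mk_eq (hH : Subgroup.closure (S ∩ (H : Set G)) = H)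
    (hxy : (x : G ⧸ H) = (y : G ⧸ H)) :
    ∃ w : (mulCayley S).Walk x y, ∀ z ∈ w.support, (z : G ⧸ H) = (x : G ⧸ H) := by
  have extend (a b : G) (hab : a⁻¹ * b ∈ S ∨ b⁻¹ * a ∈ S) (hq : (a : G ⧸ H) = (b : G ⧸ H))
      (hwalk : ∃ w : (mulCayley S).Walk x a, ∀ z ∈ w.support, (z : G ⧸ H) = (x : G ⧸ H)) :
      ∃ w : (mulCayley S).Walk x b, ∀ z ∈ w.support, (z : G ⧸ H) = (x : G ⧸ H) := by
    obtain ⟨w, hw⟩ := hwalk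
    rcases eq_or_ne a b with rfl | hne
    · exact ⟨w, hw⟩
    · refine ⟨w.concat ((mulCayley_adj S a b).2 ⟨hne, hab⟩), fun z hz => ?_⟩
      rw [Walk.support_concat, List.mem_append, List.mem_singleton] at hz
      rcases hz with hz | rfl
      · exact hw z hz
      · exact hq.symm.trans (hw a w.end_mem_support)
  suffices ∀ h ∈ Subgroup.closure (S ∩ (H : Set G)), ∃ w : (mulCayley S).Walk x (x * h),
      ∀ z ∈ w.support, (z : G ⧸ H) = (x : G ⧸ H) by
    have hwalk := this (x⁻¹ * y) (by rw [hH]; exact QuotientGroup.eq.1 hxy)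
    rwa [mul_inv_cancel_left] at hwalk
  intro h hh
  induction hh using Subgroup.closure_induction_right with
  | one => exact ⟨Walk.nil.copy rfl (mul_one x).symm, by simp⟩
  | mul_right a _ s hs ih =>
    refine extend (x * a) _ (Or.inl ?_) (QuotientGroup.eq.2 ?_) ih
    · simpa [mul_assoc] using hs.1
    · simpa [mul_assoc] using hs.2
  | mul_inv_cancel a _ s hs ih =>
    refine extend (x * a) _ (Or.inr ?_) (QuotientGroup.eq.2 ?_) ih
    · simpa [mul_assoc] using hs.1
    · simpa [mul_assoc] using hs.2

lemma mulCayley_connected (hS : Subgroup.closure S = ⊤) : (mulCayley S).Connected := by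
  refine ⟨fun x y => ?_⟩
  obtain ⟨w, -⟩ := exists_walk_of_mk_eq (H := ⊤) (S := S) (x := x) (y := y) (by simpa using hS)
    (QuotientGroup.eq.2 trivial)
  exact ⟨w⟩

/-- Left multiplication as an automorphism of the Cayley graph. -/
def mulCayleyIso (S : Set G) (g : G) : mulCayley S ≃g mulCayley S where
  toEquiv := Equiv.mulLeft g
  map_rel_iff' := by simp

lemma mulCayley_dist_mul_left (S : Set G) (g x y : G) :
    (mulCayley S).dist (g * x) (g * y) = (mulCayley S).dist x y :=
  dist_map_iso (mulCayleyIso S g) x y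

end CayleyGraph

section ConeDist

variable {G : Type u} [Group G] {H : Subgroup G} {S : Set G}

lemma conedOffGraph_connected (H : Subgroup G) (hS : Subgroup.closure S = ⊤) :
    (conedOffGraph H S).Connected := by
  have reachable_inl (x : G) : (conedOffGraph H S).Reachable (.inl 1) (.inl x) :=
    ((mulCayley_connected hS).preconnected 1 x).map
      (⟨Sum.inl, id⟩ : mulCayley S →g conedOffGraph H S)
  have reachable : ∀ u, (conedOffGraph H S).Reachable (.inl 1) u := by
    rintro (x | q)
    · exact reachable_inl x
    · induction q using QuotientGroup.induction_on with
      | H x => exact (reachable_inl x).trans (Adj.reachable (rfl : (x : G ⧸ H) = x))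
  have : Nonempty (G ⊕ (G ⧸ H)) := ⟨.inl 1⟩
  exact ⟨fun u v => (reachable u).symm.trans (reachable v)⟩

/-- Twice the length of an edge of the coned-off graph. -/
def edgeWeight : G ⊕ (G ⧸ H) → G ⊕ (G ⧸ H) → ℕ
  | .inl _, .inl _ => 2
  | _, _ => 1

lemma edgeWeight_comm (u v : G ⊕ (G ⧸ H)) : edgeWeight u v = edgeWeight v u := by
  rcases u with x | q <;> rcases v with y | q' <;> rfl

lemma one_le_edgeWeight (u v : G ⊕ (G ⧸ H)) : 1 ≤ edgeWeight u v := by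
  rcases u with _ | _ <;> rcases v with _ | _ <;> simp [edgeWeight]

lemma edgeWeight_le_two (u v : G ⊕ (G ⧸ H)) : edgeWeight u v ≤ 2 := by
  rcases u with _ | _ <;> rcases v with _ | _ <;> simp [edgeWeight]

lemma edgeLength_eq_edgeWeight_div_two (u v : G ⊕ (G ⧸ H)) :
    edgeLength u v = (edgeWeight u v : ℝ) / 2 := by
  rcases u with x | q <;> rcases v with y | q' <;> simp [edgeWeight, edgeLength]

lemma pathLength_support {u v : G ⊕ (G ⧸ H)} (w : (conedOffGraph H S).Walk u v) :
    pathLength w.support = (walkWeight edgeWeight w : ℝ) / 2 := by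
  induction w with
  | nil => simp [pathLength]
  | cons hadj w ih =>
    rw [Walk.support_cons, ← Walk.cons_tail_support, pathLength, Walk.cons_tail_support, ih,
      walkWeight_cons, edgeLength_eq_edgeWeight_div_two]
    push_cast
    ring

/-- Twice the path metric of the coned-off graph, which makes it integral. -/
def coneDist (H : Subgroup G) (S : Set G) : G ⊕ (G ⧸ H) → G ⊕ (G ⧸ H) → ℕ :=
  weightedDist (conedOffGraph H S) edgeWeight

lemma isGeodesicMetric_coneDist (H : Subgroup G) (hS : Subgroup.closure S = ⊤) :
    IsGeodesicMetric (conedOffGraph H S) (coneDist H S) :=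
  isGeodesicMetric_weightedDist (conedOffGraph_connected H hS) edgeWeight_comm one_le_edgeWeight
    edgeWeight_le_two

lemma coneDist_le_of_adj {u v : G ⊕ (G ⧸ H)} (h : (conedOffGraph H S).Adj u v) :
    coneDist H S u v ≤ edgeWeight u v :=
  weightedDist_le_of_adj h

lemma conedOffDist_eq (hS : Subgroup.closure S = ⊤) (u v : G ⊕ (G ⧸ H)) :
    conedOffDist H S u v = (coneDist H S u v : ℝ) / 2 := by
  obtain ⟨w₀, hw₀⟩ :=
    exists_walkWeight_eq_weightedDist (conedOffGraph_connected H hS) edgeWeight u v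
  have : Nonempty ((conedOffGraph H S).Walk u v) := ⟨w₀⟩
  simp only [conedOffDist, pathLength_support]
  refine le_antisymm ((ciInf_le ⟨0, ?_⟩ w₀).trans_eq (by rw [hw₀, coneDist])) (le_ciInf fun w => ?_)
  · rintro _ ⟨w, rfl⟩
    positivity
  · gcongr
    exact weightedDist_le w

/-- The four-point form of Gromov hyperbolicity for an integral distance function. -/
def FourPoint {X : Type*} (d : X → X → ℕ) (K : ℕ) : Prop :=
  ∀ w x y z : X, d x z + d w y ≤ max (d x y + d w z) (d y z + d w x) + K

lemma exists_fourPoint_of_isGromovHyperbolic {X : Type u} {d : X → X → ℕ}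
    (hcomm : ∀ x y, d x y = d y x)
    (hyp : IsGromovHyperbolic fun x y => (d x y : ℝ) / 2) : ∃ K, FourPoint d K := by
  obtain ⟨δ, -, hδ⟩ := hyp
  obtain ⟨K, hK⟩ := exists_nat_ge (4 * δ)
  refine ⟨K, fun w x y z => ?_⟩
  have hmin := hδ w x y z
  simp only [gromovProduct] at hmin
  rw [hcomm w y, hcomm w z, hcomm w x, ← Nat.cast_le (α := ℝ)]
  push_cast
  have hl := le_max_left (d x y + d z w : ℝ) (d y z + d x w)
  have hr := le_max_right (d x y + d z w : ℝ) (d y z + d x w)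
  rcases min_le_iff.1 (sub_le_iff_le_add.1 hmin) with h | h <;> linarith

lemma exists_fourPoint_coneDist (hS : Subgroup.closure S = ⊤)
    (hyp : IsGromovHyperbolic (conedOffDist H S)) : ∃ K, FourPoint (coneDist H S) K := by
  refine exists_fourPoint_of_isGromovHyperbolic (isGeodesicMetric_coneDist H hS).comm ?_
  rwa [← show conedOffDist H S = _ from funext₂ (conedOffDist_eq hS)]

end ConeDist

/-! ### Fineness of the coned-off graph -/

section BlockChains

variable {G : Type u} [Group G] {H : Subgroup G} {S : Set G}

open Classical in
/-- The path in the coned-off graph described by a block, that is, by a pair of elements of one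
left coset: it crosses the coset through its cone vertex, unless the two elements are equal. -/
def blockPath (H : Subgroup G) (p : G × G) : List (G ⊕ (G ⧸ H)) :=
  if p.1 = p.2 then [.inl p.1] else [.inl p.1, .inr (p.1 : G ⧸ H), .inl p.2]

/-- A chain of blocks: the exit point of each block is adjacent in the Cayley graph to the entry
point of the next one. -/
structure IsBlockChain (H : Subgroup G) (S : Set G) (L : List (G × G)) : Prop where
  mk_eq : ∀ p ∈ L, (p.1 : G ⧸ H) = (p.2 : G ⧸ H)
  isChain : L.IsChain fun p p' => (mulCayley S).Adj p.2 p'.1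

lemma isBlockChain_singleton {p : G × G} :
    IsBlockChain H S [p] ↔ (p.1 : G ⧸ H) = (p.2 : G ⧸ H) :=
  ⟨fun h => h.mk_eq p (by simp), fun h => ⟨by simpa using h, by simp⟩⟩

lemma isBlockChain_cons_cons {p p' : G × G} {L : List (G × G)} :
    IsBlockChain H S (p :: p' :: L) ↔
      (p.1 : G ⧸ H) = (p.2 : G ⧸ H) ∧ (mulCayley S).Adj p.2 p'.1 ∧
        IsBlockChain H S (p' :: L) := by
  constructor
  · rintro ⟨hmk, hchain⟩
    rw [List.forall_mem_cons] at hmk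
    rw [List.isChain_cons_cons] at hchain
    exact ⟨hmk.1, hchain.1, hmk.2, hchain.2⟩
  · rintro ⟨hp, hadj, hmk, hchain⟩
    exact ⟨List.forall_mem_cons.2 ⟨hp, hmk⟩, List.isChain_cons_cons.2 ⟨hadj, hchain⟩⟩

lemma isBlockChain_append_cons {p : G × G} {L L' : List (G × G)} :
    IsBlockChain H S (L ++ p :: L') ↔
      IsBlockChain H S (L ++ [p]) ∧ IsBlockChain H S (p :: L') := by
  constructor
  · rintro ⟨hmk, hchain⟩
    rw [List.isChain_split] at hchain
    exact ⟨⟨fun p hp => hmk p (by simp at hp ⊢; tauto), hchain.1⟩,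
      fun p hp => hmk p (by simp at hp ⊢; tauto), hchain.2⟩
  · rintro ⟨⟨hmk, hchain⟩, hmk', hchain'⟩
    refine ⟨fun p hp => ?_, List.isChain_split.2 ⟨hchain, hchain'⟩⟩
    rcases List.mem_append.1 hp with hp | hp
    · exact hmk p (List.mem_append_left _ hp)
    · exact hmk' p hp

lemma head?_blockPath (p : G × G) : (blockPath H p).head? = some (.inl p.1) := by
  unfold blockPath
  split_ifs <;> rfl

lemma getLast?_blockPath (p : G × G) : (blockPath H p).getLast? = some (.inl p.2) := by
  unfold blockPath
  split_ifs with h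
  · simp [h]
  · rfl

lemma length_blockPath_le (p : G × G) : (blockPath H p).length ≤ 3 := by
  unfold blockPath
  split_ifs <;> simp

lemma length_flatMap_blockPath_le (L : List (G × G)) :
    (L.flatMap (blockPath H)).length ≤ 3 * L.length := by
  induction L with
  | nil => simp
  | cons p L ih =>
    have := length_blockPath_le (H := H) p
    simp only [List.flatMap_cons, List.length_append, List.length_cons]
    omega

lemma nodup_blockPath (p : G × G) : (blockPath H p).Nodup := by
  unfold blockPath
  split_ifs with h <;> simp [h]

lemma sumElim_eq_of_mem_blockPath {p : G × G} (hp : (p.1 : G ⧸ H) = (p.2 : G ⧸ H))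
    {v : G ⊕ (G ⧸ H)} (hv : v ∈ blockPath H p) :
    Sum.elim (fun x : G => (x : G ⧸ H)) id v = p.1 := by
  unfold blockPath at hv
  split_ifs at hv
  · rw [List.mem_singleton] at hv
    rw [hv, Sum.elim_inl]
  · simp only [List.mem_cons, List.not_mem_nil, or_false] at hv
    rcases hv with rfl | rfl | rfl
    · rfl
    · rfl
    · exact hp.symm

lemma disjoint_blockPath {p p' : G × G} (hp : (p.1 : G ⧸ H) = (p.2 : G ⧸ H))
    (hp' : (p'.1 : G ⧸ H) = (p'.2 : G ⧸ H)) (hne : (p.1 : G ⧸ H) ≠ (p'.1 : G ⧸ H)) :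
    (blockPath H p).Disjoint (blockPath H p') := fun _ hv hv' =>
  hne ((sumElim_eq_of_mem_blockPath hp hv).symm.trans (sumElim_eq_of_mem_blockPath hp' hv'))

lemma isChain_blockPath {p : G × G} (hp : (p.1 : G ⧸ H) = (p.2 : G ⧸ H)) :
    (blockPath H p).IsChain (conedOffGraph H S).Adj := by
  unfold blockPath
  split_ifs with h
  · simp
  · simp only [List.isChain_cons_cons, List.IsChain.singleton, and_true]
    exact ⟨rfl, hp.symm⟩

lemma IsBlockChain.isChain_flatMap_blockPath {L : List (G × G)} (hL : IsBlockChain H S L) :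
    (L.flatMap (blockPath H)).IsChain (conedOffGraph H S).Adj := by
  induction L with
  | nil => simp
  | cons p L ih =>
    cases L with
    | nil => simpa using isChain_blockPath (isBlockChain_singleton.1 hL)
    | cons p' L =>
      obtain ⟨hp, hadj, hL⟩ := isBlockChain_cons_cons.1 hL
      rw [List.flatMap_cons, List.isChain_append]
      refine ⟨isChain_blockPath hp, ih hL, fun x hx y hy => ?_⟩
      rw [getLast?_blockPath, Option.mem_some_iff] at hx
      rw [List.flatMap_cons, List.head?_append, head?_blockPath] at hy
      simp only [Option.some_or, Option.mem_some_iff] at hy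
      subst hx hy
      exact hadj

end BlockChains

section BlockWalks

variable {G : Type u} [Group G] {H : Subgroup G} {S : Set G} {x y : G}

lemma coneRun_support (w : (mulCayley S).Walk x y) (hnil : x = y → w.length = 0) :
    coneRun H w.support = blockPath H (x, y) := by
  cases w with
  | nil => simp [coneRun, blockPath]
  | cons hadj w =>
    have hne : x ≠ y := fun h => by simpa using hnil h
    cases w <;> simp [coneRun, blockPath, hne]

lemma two_le_length_support_iff {V : Type*} {Γ : SimpleGraph V} {u v : V} (w : Γ.Walk u v)
    (hnil : u = v → w.length = 0) : 2 ≤ w.support.length ↔ u ≠ v := by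
  rw [Walk.length_support, ne_eq]
  refine ⟨fun h huv => by have := hnil huv; omega, fun huv => ?_⟩
  have := mt (Walk.eq_of_length_eq_zero (p := w)) huv
  omega

open Classical in
lemma cosetRuns_support_append (w : (mulCayley S).Walk x y)
    (hw : ∀ z ∈ w.support, (z : G ⧸ H) = (x : G ⧸ H)) {l : List G}
    (hl : ∀ z ∈ l.head?, (z : G ⧸ H) ≠ (x : G ⧸ H)) :
    cosetRuns H (w.support ++ l) = w.support :: cosetRuns H l := by
  rw [cosetRuns, List.splitBy_append, List.splitBy_of_isChain w.support_ne_nil,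
    List.singleton_append, cosetRuns]
  · refine (List.pairwise_iff_forall_sublist.2 fun {a b} hab => ?_).isChain
    rw [decide_eq_true_iff, hw a (hab.subset (by simp)), hw b (hab.subset (by simp))]
  · intro a ha b hb
    rw [decide_eq_false_iff_not, hw a (List.mem_of_mem_getLast? ha)]
    exact (hl b hb).symm

lemma coneOffPath_support_append (w : (mulCayley S).Walk x y)
    (hw : ∀ z ∈ w.support, (z : G ⧸ H) = (x : G ⧸ H)) (hnil : x = y → w.length = 0) {l : List G}
    (hl : ∀ z ∈ l.head?, (z : G ⧸ H) ≠ (x : G ⧸ H)) :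
    coneOffPath H (w.support ++ l) = blockPath H (x, y) ++ coneOffPath H l := by
  rw [coneOffPath, cosetRuns_support_append w hw hl, List.flatMap_cons, coneRun_support w hnil,
    coneOffPath]

lemma penetrates_support_append (w : (mulCayley S).Walk x y)
    (hw : ∀ z ∈ w.support, (z : G ⧸ H) = (x : G ⧸ H)) (hnil : x = y → w.length = 0) {l : List G}
    (hl : ∀ z ∈ l.head?, (z : G ⧸ H) ≠ (x : G ⧸ H)) {q : G ⧸ H} {a b : G} :
    Penetrates H (w.support ++ l) q a b ↔
      ((a, b) = (x, y) ∧ a ≠ b ∧ (a : G ⧸ H) = q) ∨ Penetrates H l q a b := by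
  have hhead : w.support.head? = some x := by
    rw [List.head?_eq_some_head w.support_ne_nil, w.head_support]
  have hlast : w.support.getLast? = some y := by
    rw [List.getLast?_eq_getLast_of_ne_nil w.support_ne_nil, w.getLast_support]
  simp only [Penetrates, cosetRuns_support_append w hw hl, List.mem_cons, or_and_right, exists_or,
    exists_eq_left, two_le_length_support_iff w hnil, hhead, hlast, Option.some_inj,
    Prod.mk.injEq]
  refine or_congr_left ⟨?_, ?_⟩
  · rintro ⟨hne, rfl, rfl, hq⟩
    exact ⟨⟨rfl, rfl⟩, hne, hq⟩
  · rintro ⟨⟨rfl, rfl⟩, hne, hq⟩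
    exact ⟨hne, rfl, rfl, hq⟩

lemma exists_walk_of_block (hH : Subgroup.closure (S ∩ (H : Set G)) = H)
    (hxy : (x : G ⧸ H) = (y : G ⧸ H)) :
    ∃ w : (mulCayley S).Walk x y,
      (∀ z ∈ w.support, (z : G ⧸ H) = (x : G ⧸ H)) ∧ (x = y → w.length = 0) := by
  by_cases h : x = y
  · subst h
    exact ⟨Walk.nil, by simp⟩
  · obtain ⟨w, hw⟩ := exists_walk_of_mk_eq hH hxy
    exact ⟨w, hw, fun h' => absurd h' h⟩

lemma IsBlockChain.exists_walk (hH : Subgroup.closure (S ∩ (H : Set G)) = H) {p : G × G}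
    {L : List (G × G)} (hL : IsBlockChain H S (p :: L))
    (hne : (p :: L).IsChain fun p p' => (p.1 : G ⧸ H) ≠ (p'.1 : G ⧸ H)) {b : G}
    (hb : ((p :: L).getLast (List.cons_ne_nil p L)).2 = b) :
    ∃ c : (mulCayley S).Walk p.1 b, coneOffPath H c.support = (p :: L).flatMap (blockPath H) ∧
      ∀ (q : G ⧸ H) (x y : G), Penetrates H c.support q x y ↔
        (x, y) ∈ p :: L ∧ x ≠ y ∧ (x : G ⧸ H) = q := by
  induction L generalizing p with
  | nil =>
    obtain rfl : p.2 = b := hb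
    obtain ⟨w, hw, hnil⟩ := exists_walk_of_block hH (isBlockChain_singleton.1 hL)
    have hcone := coneOffPath_support_append w hw hnil (l := []) (by simp)
    have hpen (q x y) := penetrates_support_append w hw hnil (l := []) (by simp)
      (q := q) (a := x) (b := y)
    rw [List.append_nil] at hcone hpen
    refine ⟨w, by simpa [coneOffPath, cosetRuns] using hcone, fun q x y => (hpen q x y).trans ?_⟩
    simp [Penetrates, cosetRuns]
  | cons p' L ih =>
    obtain ⟨hp, hadj, hL'⟩ := isBlockChain_cons_cons.1 hL
    obtain ⟨hne₀, hne'⟩ := List.isChain_cons_cons.1 hne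
    obtain ⟨c, hcone, hpen⟩ := ih hL' hne' (by simpa using hb)
    obtain ⟨w, hw, hnil⟩ := exists_walk_of_block hH hp
    have hhead : ∀ z ∈ c.support.head?, (z : G ⧸ H) ≠ (p.1 : G ⧸ H) := by
      rw [List.head?_eq_some_head c.support_ne_nil, c.head_support]
      rintro _ ⟨rfl⟩
      exact hne₀.symm
    have hsupport : (w.append (Walk.cons hadj c)).support = w.support ++ c.support := by
      rw [Walk.support_append, Walk.support_cons, List.tail_cons]
    refine ⟨w.append (Walk.cons hadj c), ?_, fun q x y => ?_⟩
    · rw [hsupport, coneOffPath_support_append w hw hnil hhead, hcone, List.flatMap_cons (x := p)]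
    · rw [hsupport, penetrates_support_append w hw hnil hhead, hpen, List.mem_cons (b := p),
        or_and_right]

end BlockWalks

section QuasiGeodesics

variable {G : Type u} [Group G] {H : Subgroup G} {S : Set G}

lemma pathLength_take_succ (l : List (G ⊕ (G ⧸ H))) (k : ℕ) (hk : k + 1 < l.length) :
    pathLength (l.take (k + 2)) = pathLength (l.take (k + 1)) + edgeLength l[k] l[k + 1] := by
  induction l generalizing k with
  | nil => simp at hk
  | cons x l ih =>
    cases l with
    | nil => simp at hk
    | cons y l =>
      cases k with
      | zero => simp [pathLength]
      | succ k =>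
        have := ih k (by simpa using hk)
        simp only [List.take_succ_cons, pathLength, List.getElem_cons_succ] at this ⊢
        rw [this]
        ring

lemma pathLength_take_sub_bounds {l : List (G ⊕ (G ⧸ H))} {i j : ℕ} (hij : i ≤ j)
    (hj : j < l.length) :
    ((j : ℝ) - i) / 2 ≤ pathLength (l.take (j + 1)) - pathLength (l.take (i + 1)) ∧
      pathLength (l.take (j + 1)) - pathLength (l.take (i + 1)) ≤ (j : ℝ) - i := by
  induction j, hij using Nat.le_induction with
  | base => simp
  | succ j _ ih =>
    obtain ⟨hlower, hupper⟩ := ih (by omega)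
    rw [pathLength_take_succ l j hj, edgeLength_eq_edgeWeight_div_two]
    have hone : (1 : ℝ) ≤ edgeWeight l[j] l[j + 1] := by exact_mod_cast one_le_edgeWeight _ _
    have htwo : (edgeWeight l[j] l[j + 1] : ℝ) ≤ 2 := by exact_mod_cast edgeWeight_le_two _ _
    push_cast
    constructor <;> linarith

lemma conedOffDist_le_of_isChain (hS : Subgroup.closure S = ⊤) {l : List (G ⊕ (G ⧸ H))}
    (hl : l.IsChain (conedOffGraph H S).Adj) {i j : ℕ} (hij : i ≤ j) (hj : j < l.length) :
    conedOffDist H S l[i] l[j] ≤ pathLength (l.take (j + 1)) - pathLength (l.take (i + 1)) := by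
  have metric := isGeodesicMetric_coneDist H hS
  induction j, hij using Nat.le_induction with
  | base => simp [conedOffDist_eq hS, metric.self]
  | succ j hij ih =>
    have hdist := ih (by omega)
    rw [pathLength_take_succ l j hj, edgeLength_eq_edgeWeight_div_two]
    have htriangle : (coneDist H S l[i] l[j + 1] : ℝ) ≤
        coneDist H S l[i] l[j] + coneDist H S l[j] l[j + 1] := by
      exact_mod_cast metric.triangle _ _ _
    have hedge : (coneDist H S l[j] l[j + 1] : ℝ) ≤ edgeWeight l[j] l[j + 1] := by
      exact_mod_cast coneDist_le_of_adj (List.isChain_iff_getElem.1 hl j hj)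
    rw [conedOffDist_eq hS] at hdist ⊢
    linarith

lemma pathLength_le_conedOffDist_of_nodup (hS : Subgroup.closure S = ⊤) {l : List (G ⊕ (G ⧸ H))}
    (hl : l.Nodup) {n : ℕ} (hlen : l.length ≤ n) {i j : ℕ} (hij : i ≤ j) (hj : j < l.length) :
    pathLength (l.take (j + 1)) - pathLength (l.take (i + 1)) ≤
      2 * n * conedOffDist H S l[i] l[j] := by
  obtain ⟨-, hupper⟩ := pathLength_take_sub_bounds hij hj
  rw [conedOffDist_eq hS]
  rcases hij.eq_or_lt with rfl | hlt
  · simp only [sub_self]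
    positivity
  · have hdist : 1 ≤ coneDist H S l[i] l[j] := by
      refine Nat.one_le_iff_ne_zero.2 fun h => ?_
      have := hl.getElem_inj_iff.1 ((isGeodesicMetric_coneDist H hS).eq_of_eq_zero h)
      omega
    have hdist' : (1 : ℝ) ≤ coneDist H S l[i] l[j] := by exact_mod_cast hdist
    have hjn : (j : ℝ) ≤ n := by exact_mod_cast hj.le.trans hlen
    have : (0 : ℝ) ≤ i := Nat.cast_nonneg i
    nlinarith

lemma isRelQuasiGeodesic_of_nodup (hS : Subgroup.closure S = ⊤) {c : List G}
    (hc : (coneOffPath H c).IsChain (conedOffGraph H S).Adj) (hn : (coneOffPath H c).Nodup)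
    {n : ℕ} (hlen : (coneOffPath H c).length ≤ n) (hpos : 0 < n) :
    IsRelQuasiGeodesic H S (2 * n) c := by
  have hn1 : (1 : ℝ) ≤ n := by exact_mod_cast hpos
  intro i j
  dsimp only
  wlog hij : (i : ℕ) ≤ j generalizing i j
  · have := this j i (by omega)
    rwa [abs_sub_comm, conedOffDist_eq hS, (isGeodesicMetric_coneDist H hS).comm,
      ← conedOffDist_eq hS] at this
  obtain ⟨hlower, -⟩ := pathLength_take_sub_bounds hij j.2
  have hij' : (i : ℝ) ≤ j := by exact_mod_cast hij
  have habs := abs_sub_comm (pathLength ((coneOffPath H c).take (i + 1)))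
    (pathLength ((coneOffPath H c).take (j + 1)))
  rw [abs_of_nonneg (a := _ - pathLength ((coneOffPath H c).take (i + 1))) (by linarith)] at habs
  rw [habs, List.get_eq_getElem, List.get_eq_getElem, inv_mul_le_iff₀ (by positivity)]
  exact ⟨pathLength_le_conedOffDist_of_nodup hS hn hlen hij j.2,
    (conedOffDist_le_of_isChain hS hc hij j.2).trans
      (le_mul_of_one_le_left (by linarith) (by linarith))⟩

lemma IsBlockChain.exists_isRelQuasiGeodesic (hS : Subgroup.closure S = ⊤)
    (hH : Subgroup.closure (S ∩ (H : Set G)) = H) {p : G × G} {L : List (G × G)}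
    (hL : IsBlockChain H S (p :: L))
    (hne : (p :: L).IsChain fun p p' => (p.1 : G ⧸ H) ≠ (p'.1 : G ⧸ H))
    (hdisj : (p :: L).Pairwise fun p p' => (blockPath H p).Disjoint (blockPath H p')) {n : ℕ}
    (hlen : L.length < n) {b : G} (hb : ((p :: L).getLast (List.cons_ne_nil p L)).2 = b) :
    ∃ c : (mulCayley S).Walk p.1 b, IsRelQuasiGeodesic H S (2 * (3 * n : ℕ)) c.support ∧
      ∀ (q : G ⧸ H) (x y : G), Penetrates H c.support q x y ↔
        (x, y) ∈ p :: L ∧ x ≠ y ∧ (x : G ⧸ H) = q := by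
  obtain ⟨c, hcone, hpen⟩ := hL.exists_walk hH hne hb
  refine ⟨c, isRelQuasiGeodesic_of_nodup hS ?_ ?_ ?_ (by omega), hpen⟩ <;> rw [hcone]
  · exact hL.isChain_flatMap_blockPath
  · exact List.nodup_flatMap.2 ⟨fun p _ => nodup_blockPath p, hdisj⟩
  · exact (length_flatMap_blockPath_le _).trans (by simp only [List.length_cons]; omega)

end QuasiGeodesics

section Excursions

variable {G : Type u} [Group G] {H : Subgroup G} {S : Set G} {q : G ⧸ H} {a b : G}
  {L : List (G × G)}

/-- A path in the coned-off graph between two elements `a`, `b` of the coset `q` that avoids the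
cone vertex of `q`, given by the chain `L` of its blocks strictly between `a` and `b`. -/
structure IsExcursion (S : Set G) (q : G ⧸ H) (a b : G) (L : List (G × G)) : Prop where
  left_mem : (a : G ⧸ H) = q
  right_mem : (b : G ⧸ H) = q
  isBlockChain : IsBlockChain H S ((a, a) :: (L ++ [(b, b)]))
  not_cross : ∀ p ∈ L, (p.1 : G ⧸ H) = q → p.1 = p.2

lemma IsExcursion.mk_eq (h : IsExcursion S q a b L) {p : G × G} (hp : p ∈ L) :
    (p.1 : G ⧸ H) = (p.2 : G ⧸ H) :=
  h.isBlockChain.mk_eq p (by simp [hp])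

lemma IsExcursion.split {x y : G} {L₁ L₂ : List (G × G)}
    (h : IsExcursion S q a b (L₁ ++ (x, y) :: L₂)) (hx : (x : G ⧸ H) = q) :
    IsExcursion S q a x L₁ ∧ IsExcursion S q x b L₂ := by
  obtain rfl : x = y := h.not_cross (x, y) (by simp) hx
  have hchain : IsBlockChain H S ((a, a) :: L₁ ++ (x, x) :: (L₂ ++ [(b, b)])) := by
    simpa using h.isBlockChain
  obtain ⟨hchain₁, hchain₂⟩ := isBlockChain_append_cons.1 hchain
  exact ⟨⟨h.left_mem, hx, hchain₁, fun p hp => h.not_cross p (by simp [hp])⟩,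
    ⟨hx, h.right_mem, hchain₂, fun p hp => h.not_cross p (by simp [hp])⟩⟩

lemma IsExcursion.shortcut {p p' : G × G} {L₁ L₂ L₃ : List (G × G)}
    (h : IsExcursion S q a b (L₁ ++ p :: (L₂ ++ p' :: L₃)))
    (hpp' : (p.1 : G ⧸ H) = (p'.1 : G ⧸ H)) (hp : (p.1 : G ⧸ H) ≠ q) :
    IsExcursion S q a b (L₁ ++ (p.1, p'.2) :: L₃) := by
  have hchain : IsBlockChain H S ((a, a) :: L₁ ++ p :: (L₂ ++ p' :: (L₃ ++ [(b, b)]))) := by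
    simpa using h.isBlockChain
  refine ⟨h.left_mem, h.right_mem, ⟨fun x hx => ?_, ?_⟩, fun x hx hxq => ?_⟩
  · simp only [List.mem_cons, List.mem_append, List.not_mem_nil, or_false] at hx
    rcases hx with rfl | (hx | rfl | hx) | rfl
    · rfl
    · exact h.mk_eq (by simp [hx])
    · exact hpp'.trans (h.mk_eq (by simp))
    · exact h.mk_eq (by simp [hx])
    · rfl
  · obtain ⟨hchain₁, hchain⟩ := isBlockChain_append_cons.1 hchain
    have hchain₃ := (isBlockChain_append_cons (L := p :: L₂).1 hchain).2.isChain
    have hchain' : ((a, a) :: L₁ ++ (p.1, p'.2) :: (L₃ ++ [(b, b)])).IsChain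
        fun p p' => (mulCayley S).Adj p.2 p'.1 := by
      refine List.isChain_split.2 ⟨?_, List.isChain_cons.2 (List.isChain_cons.1 hchain₃)⟩
      have := List.isChain_append.1 hchain₁.isChain
      exact List.isChain_append.2 ⟨this.1, by simp, by simpa using this.2.2⟩
    simpa using hchain'
  · simp only [List.mem_append, List.mem_cons] at hx
    rcases hx with hx | rfl | hx
    · exact h.not_cross x (by simp [hx]) hxq
    · exact absurd hxq hp
    · exact h.not_cross x (by simp [hx]) hxq

/-- An excursion that does not return to its coset and visits every other coset at most once. -/
structure IsReducedExcursion (S : Set G) (q : G ⧸ H) (a b : G) (L : List (G × G)) : Prop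
    extends IsExcursion S q a b L where
  not_mem : ∀ p ∈ L, (p.1 : G ⧸ H) ≠ q
  pairwise : L.Pairwise fun p p' => (p.1 : G ⧸ H) ≠ (p'.1 : G ⧸ H)

lemma IsReducedExcursion.isChain_ne (h : IsReducedExcursion S q a b L) (hL : L ≠ []) :
    ((a, a) :: (L ++ [(b, b)])).IsChain fun p p' => (p.1 : G ⧸ H) ≠ (p'.1 : G ⧸ H) := by
  refine List.isChain_cons.2 ⟨fun y hy hay => ?_, List.isChain_append.2
    ⟨h.pairwise.isChain, by simp, fun x hx y hy hxy => ?_⟩⟩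
  · rw [List.head?_append_of_ne_nil _ hL] at hy
    exact h.not_mem y (List.mem_of_mem_head? hy) (hay.symm.trans h.left_mem)
  · obtain rfl : (b, b) = y := by simpa using hy
    exact h.not_mem x (List.mem_of_mem_getLast? hx) (hxy.trans h.right_mem)

lemma IsReducedExcursion.pairwise_disjoint (h : IsReducedExcursion S q a b L) (hab : a ≠ b) :
    ((a, a) :: (L ++ [(b, b)])).Pairwise
      fun p p' => (blockPath H p).Disjoint (blockPath H p') := by
  refine List.pairwise_cons.2 ⟨fun p hp => ?_, List.pairwise_append.2
    ⟨h.pairwise.imp_of_mem fun hp hp' hne => disjoint_blockPath (h.mk_eq hp) (h.mk_eq hp') hne,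
      by simp, fun p hp p' hp' => ?_⟩⟩
  · rcases List.mem_append.1 hp with hp | hp
    · exact disjoint_blockPath rfl (h.mk_eq hp)
        fun hap => h.not_mem p hp (hap.symm.trans h.left_mem)
    · obtain rfl := List.mem_singleton.1 hp
      simp [blockPath, hab.symm]
  · obtain rfl := List.mem_singleton.1 hp'
    exact disjoint_blockPath (h.mk_eq hp) rfl
      fun hpb => h.not_mem p hp (hpb.trans h.right_mem)

/-- The quasi-geodesic of a reduced excursion does not penetrate the coset `q` of its ends `a`, `b`,
while a geodesic in the coset does; so bounded coset penetration makes `a` and `b` close. -/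
lemma IsReducedExcursion.dist_le (hS : Subgroup.closure S = ⊤)
    (hH : Subgroup.closure (S ∩ (H : Set G)) = H) {n : ℕ} {r : ℝ}
    (penetrates : ∀ (a b : G) (c₁ c₂ : (mulCayley S).Walk a b),
      IsRelQuasiGeodesic H S (2 * (3 * (n + 2) : ℕ)) c₁.support →
      IsRelQuasiGeodesic H S (2 * (3 * (n + 2) : ℕ)) c₂.support →
      ∀ (q : G ⧸ H) (x y : G), Penetrates H c₁.support q x y →
        r < ((mulCayley S).dist x y : ℝ) → ∃ x' y' : G, Penetrates H c₂.support q x' y')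
    {ρ : ℕ} (hρ : r ≤ ρ) (h : IsReducedExcursion S q a b L) (hn : L.length ≤ n) :
    (mulCayley S).dist a b ≤ ρ + 1 := by
  by_cases hab : a = b
  · simp [hab]
  rcases eq_or_ne L [] with rfl | hL
  · have hadj : (mulCayley S).Adj a b := (isBlockChain_cons_cons.1 h.isBlockChain).2.1
    simp [dist_eq_one_iff_adj.2 hadj]
  have hmk : (a : G ⧸ H) = (b : G ⧸ H) := h.left_mem.trans h.right_mem.symm
  obtain ⟨c₁, hqg₁, hpen₁⟩ := (isBlockChain_singleton (p := (a, b)).2 hmk).exists_isRelQuasiGeodesic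
    (S := S) (n := n + 2) hS hH (by simp) (by simp) (by simp) rfl
  obtain ⟨c₂, hqg₂, hpen₂⟩ := h.isBlockChain.exists_isRelQuasiGeodesic (n := n + 2) (b := b) hS hH
    (h.isChain_ne hL) (h.pairwise_disjoint hab) (by simpa using hn) (by simp)
  by_contra! hlt
  have hlt' : r < (mulCayley S).dist a b := hρ.trans_lt (by exact_mod_cast (by omega))
  obtain ⟨x, y, hxy⟩ := penetrates a b c₁ c₂ hqg₁ hqg₂ q a b
    ((hpen₁ q a b).2 ⟨by simp, hab, h.left_mem⟩) hlt'
  obtain ⟨hmem, hne, hxq⟩ := (hpen₂ q x y).1 hxy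
  simp only [List.mem_cons, List.mem_append, Prod.mk.injEq, List.not_mem_nil, or_false] at hmem
  rcases hmem with ⟨rfl, rfl⟩ | hmem | ⟨rfl, rfl⟩
  · exact hne rfl
  · exact h.not_mem _ hmem hxq
  · exact hne rfl

lemma exists_eq_append_of_not_pairwise {α : Type*} {R : α → α → Prop} {l : List α}
    (h : ¬ l.Pairwise R) : ∃ l₁ a l₂ b l₃, l = l₁ ++ a :: (l₂ ++ b :: l₃) ∧ ¬ R a b := by
  induction l with
  | nil => simp at h
  | cons x l ih =>
    rw [List.pairwise_cons, not_and_or] at h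
    rcases h with h | h
    · push Not at h
      obtain ⟨y, hy, hxy⟩ := h
      obtain ⟨l₂, l₃, rfl⟩ := List.append_of_mem hy
      exact ⟨[], x, l₂, y, l₃, rfl, hxy⟩
    · obtain ⟨l₁, a, l₂, b, l₃, rfl, hab⟩ := ih h
      exact ⟨x :: l₁, a, l₂, b, l₃, rfl, hab⟩

lemma exists_dist_le_of_isExcursion (hS : Subgroup.closure S = ⊤)
    (hH : Subgroup.closure (S ∩ (H : Set G)) = H) (bcp : BoundedCosetPenetration H S) (n : ℕ) :
    ∃ ρ : ℕ, ∀ (q : G ⧸ H) (L : List (G × G)) (a b : G), L.length ≤ n → IsExcursion S q a b L →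
      (mulCayley S).dist a b ≤ (L.length + 1) * ρ := by
  obtain ⟨r, hr⟩ := bcp (2 * (3 * (n + 2) : ℕ)) (by positivity)
  obtain ⟨ρ, hρ⟩ := exists_nat_ge r
  refine ⟨ρ + 1, fun q L => ?_⟩
  induction hm : L.length using Nat.strong_induction_on generalizing L with
  | _ m ih =>
  subst hm
  intro a b hn h
  by_cases hmem : ∃ p ∈ L, (p.1 : G ⧸ H) = q
  · obtain ⟨⟨x, y⟩, hp, hxq⟩ := hmem
    obtain ⟨L₁, L₂, rfl⟩ := List.append_of_mem hp
    obtain ⟨h₁, h₂⟩ := h.split hxq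
    simp only [List.length_append, List.length_cons] at hn ⊢
    have hdist₁ := ih L₁.length (by simp) L₁ rfl a x (by omega) h₁
    have hdist₂ := ih L₂.length (by simp; omega) L₂ rfl x b (by omega) h₂
    have := (mulCayley_connected hS).dist_triangle (u := a) (v := x) (w := b)
    linarith
  push Not at hmem
  by_cases hpw : L.Pairwise fun p p' => (p.1 : G ⧸ H) ≠ (p'.1 : G ⧸ H)
  · have := IsReducedExcursion.dist_le hS hH (fun a b c₁ c₂ h₁ h₂ => (hr a b c₁ c₂ h₁ h₂).1) hρ
      ⟨h, hmem, hpw⟩ hn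
    exact this.trans (Nat.le_mul_of_pos_left _ (Nat.succ_pos _))
  · obtain ⟨L₁, p, L₂, p', L₃, rfl, hpp'⟩ := exists_eq_append_of_not_pairwise hpw
    have hshort := h.shortcut (not_not.1 hpp') (hmem p (by simp))
    simp only [List.length_append, List.length_cons] at hn
    refine (ih (L₁ ++ (p.1, p'.2) :: L₃).length (by simp) _ rfl a b ?_ hshort).trans
      (Nat.mul_le_mul_right _ ?_)
    all_goals
      simp only [List.length_append, List.length_cons]
      omega

end Excursions

section Fineness

variable {G : Type u} [Group G] {H : Subgroup G} {S : Set G}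

lemma exists_isBlockChain_of_walk (q : G ⧸ H) {a b : G}
    (w : (conedOffGraph H S).Walk (.inl a) (.inl b)) (hq : .inr q ∉ w.support) :
    ∃ (c : G) (L : List (G × G)), L.length ≤ w.length ∧ IsBlockChain H S ((a, c) :: L) ∧
      (∀ p ∈ (a, c) :: L, (p.1 : G ⧸ H) = q → p.1 = p.2) ∧
      (((a, c) :: L).getLast (List.cons_ne_nil _ _)).2 = b := by
  induction hn : w.length using Nat.strong_induction_on generalizing a with
  | _ n ih =>
  subst hn
  match w, hq, ih with
  | .nil, _, _ => exact ⟨a, [], by simp, isBlockChain_singleton.2 rfl, by simp, rfl⟩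
  | .cons (v := .inl y) hadj w, hq, ih =>
    obtain ⟨c, L, hlen, hchain, hcross, hlast⟩ := ih w.length (by simp) w
      (fun hmem => hq (by simp [hmem])) rfl
    refine ⟨a, (y, c) :: L, by simpa using hlen, isBlockChain_cons_cons.2 ⟨rfl, hadj, hchain⟩,
      List.forall_mem_cons.2 ⟨fun _ => rfl, hcross⟩, by simpa using hlast⟩
  | .cons (v := .inr q') _ (.cons (v := .inr q'') hadj _), _, _ => exact hadj.elim
  | .cons (v := .inr q') hadj (.cons (v := .inl y) hadj' w), hq, ih =>
    have ha : (a : G ⧸ H) = q' := hadj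
    have hy : (y : G ⧸ H) = q' := hadj'
    obtain ⟨c, L, hlen, hchain, hcross, hlast⟩ := ih w.length (by simp) w
      (fun hmem => hq (by simp [hmem])) rfl
    have hne : q' ≠ q := by
      rintro rfl
      exact hq (by simp)
    have hyc : (y : G ⧸ H) = (c : G ⧸ H) := hchain.mk_eq (y, c) (by simp)
    refine ⟨c, L, by simp only [Walk.length_cons]; omega,
      ⟨List.forall_mem_cons.2
          ⟨(ha.trans hy.symm).trans hyc, (List.forall_mem_cons.1 hchain.mk_eq).2⟩,
        List.isChain_cons.2 (List.isChain_cons.1 hchain.isChain)⟩,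
      List.forall_mem_cons.2 ⟨fun h => absurd (ha.symm.trans h) hne,
        (List.forall_mem_cons.1 hcross).2⟩, ?_⟩
    cases L <;> simpa using hlast

theorem exists_fineness_bound (hS : Subgroup.closure S = ⊤)
    (hH : Subgroup.closure (S ∩ (H : Set G)) = H) (bcp : BoundedCosetPenetration H S) (n : ℕ) :
    ∃ κ : ℕ, ∀ (q : G ⧸ H) (a b : G) (w : (conedOffGraph H S).Walk (.inl a) (.inl b)),
      (a : G ⧸ H) = q → (b : G ⧸ H) = q → .inr q ∉ w.support → w.length ≤ n →
      (mulCayley S).dist a b ≤ κ := by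
  obtain ⟨ρ, hρ⟩ := exists_dist_le_of_isExcursion hS hH bcp n
  refine ⟨(n + 1) * ρ, fun q a b w ha hb hq hw => ?_⟩
  obtain ⟨c, L, hlen, hchain, hcross, hlast⟩ := exists_isBlockChain_of_walk q w hq
  obtain rfl : a = c := hcross (a, c) (by simp) ha
  rcases L.eq_nil_or_concat with rfl | ⟨L, ⟨x, y⟩, rfl⟩
  · obtain rfl : a = b := hlast
    simp
  · obtain rfl : y = b := by simpa using hlast
    have hxy : (x : G ⧸ H) = (y : G ⧸ H) := hchain.mk_eq (x, y) (by simp)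
    obtain rfl : x = y := hcross (x, y) (by simp) (hxy.trans hb)
    rw [List.concat_eq_append] at hchain hcross hlen
    simp only [List.length_append, List.length_singleton] at hlen
    refine (hρ q L a x (by omega) ⟨ha, hb, hchain, fun p hp => hcross p (by simp [hp])⟩).trans
      (Nat.mul_le_mul_right _ (by omega))

end Fineness

/-! ### Projections to cosets -/

section Geodesics

variable {V : Type*} {Γ : SimpleGraph V} {d : V → V → ℕ} {K : ℕ} {q : V}

/-- The point `p` lies on a geodesic from `u` to `w` for the distance function `d`. -/
abbrev Between (d : V → V → ℕ) (u p w : V) : Prop :=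
  d u p + d p w = d u w

/-- There is a path with at most `n` edges from `u` to `v` avoiding the vertex `q`. -/
def ReachableAvoiding (Γ : SimpleGraph V) (q : V) (n : ℕ) (u v : V) : Prop :=
  ∃ w : Γ.Walk u v, q ∉ w.support ∧ w.length ≤ n

namespace ReachableAvoiding

variable {n m : ℕ} {u v z : V}

lemma symm (h : ReachableAvoiding Γ q n u v) : ReachableAvoiding Γ q n v u := by
  obtain ⟨w, hq, hlen⟩ := h
  exact ⟨w.reverse, by simpa using hq, by simpa using hlen⟩

lemma trans (h : ReachableAvoiding Γ q n u v) (h' : ReachableAvoiding Γ q m v z) :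
    ReachableAvoiding Γ q (n + m) u z := by
  obtain ⟨w, hq, hlen⟩ := h
  obtain ⟨w', hq', hlen'⟩ := h'
  refine ⟨w.append w', ?_, by rw [Walk.length_append]; omega⟩
  rw [Walk.mem_support_append_iff]
  tauto

lemma mono (h : ReachableAvoiding Γ q n u v) (hnm : n ≤ m) : ReachableAvoiding Γ q m u v := by
  obtain ⟨w, hq, hlen⟩ := h
  exact ⟨w, hq, hlen.trans hnm⟩

end ReachableAvoiding

namespace IsGeodesicMetric

lemma eq_zero_iff (hd : IsGeodesicMetric Γ d) {u v : V} : d u v = 0 ↔ u = v :=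
  ⟨hd.eq_of_eq_zero, by rintro rfl; exact hd.self u⟩

lemma exists_geodesic_walk (hd : IsGeodesicMetric Γ d) (u v : V) :
    ∃ w : Γ.Walk u v, w.length ≤ d u v ∧ ∀ z ∈ w.support, Between d u z v := by
  induction hn : d u v using Nat.strong_induction_on generalizing u with
  | _ n ih =>
  by_cases huv : u = v
  · subst huv
    exact ⟨Walk.nil, by simp, by simp [Between, hd.self]⟩
  obtain ⟨u', hadj, -, hsplit⟩ := hd.exists_step huv
  have := hd.eq_zero_iff.not.2 hadj.ne
  obtain ⟨w, hlen, hbetween⟩ := ih (d u' v) (by omega) u' rfl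
  refine ⟨Walk.cons hadj w, by rw [Walk.length_cons]; omega, fun z hz => ?_⟩
  rw [Walk.support_cons, List.mem_cons] at hz
  rcases hz with rfl | hz
  · simp [Between, hd.self]
  · have := hbetween z hz
    have := hd.triangle u u' z
    have := hd.triangle u z v
    omega

lemma reachableAvoiding (hd : IsGeodesicMetric Γ d) {u v : V} (h : ¬ Between d u q v) {n : ℕ}
    (hn : d u v ≤ n) : ReachableAvoiding Γ q n u v := by
  obtain ⟨w, hlen, hbetween⟩ := hd.exists_geodesic_walk u v
  exact ⟨w, fun hmem => h (hbetween _ hmem), hlen.trans hn⟩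

lemma exists_between_at (hd : IsGeodesicMetric Γ d) (u v : V) {s : ℕ} (hs : s ≤ d u v) :
    ∃ p, Between d u p v ∧ s ≤ d u p ∧ d u p ≤ s + 1 := by
  induction s with
  | zero => exact ⟨u, by simp [Between, hd.self], by simp, by simp [hd.self]⟩
  | succ s ih =>
    obtain ⟨p, hp, hge, hle⟩ := ih (by omega)
    by_cases h : s + 1 ≤ d u p
    · exact ⟨p, hp, h, by omega⟩
    have hpv : p ≠ v := by
      rintro rfl
      omega
    obtain ⟨p', hadj, hstep, hsplit⟩ := hd.exists_step hpv
    have := hd.eq_zero_iff.not.2 hadj.ne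
    have := hd.triangle u p p'
    have := hd.triangle u p' v
    exact ⟨p', by omega, by omega, by omega⟩

lemma ne_of_not_between (hd : IsGeodesicMetric Γ d) {u v : V} (h : ¬ Between d u q v) :
    u ≠ q ∧ v ≠ q := by
  constructor <;> rintro rfl <;> exact h (by simp [Between, hd.self])

end IsGeodesicMetric

lemma FourPoint.fellow_travel (hd : IsGeodesicMetric Γ d) (hK : FourPoint d K)
    {u v w p p' : V} {c : ℕ} (hp : Between d w p u) (hp' : Between d w p' v)
    (hle : d w p ≤ d w p' + 1) (hle' : d w p' ≤ d w p + 1)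
    (hgromov : 2 * d w p + d u v ≤ d w u + d w v + c) :
    d p p' ≤ 2 * K + c + 1 := by
  have := hK w p u v
  have := hK w p v p'
  have := hd.comm v p'
  omega

lemma FourPoint.slim (hd : IsGeodesicMetric Γ d) (hK : FourPoint d K) {u w p : V}
    (hp : Between d u p w) (z : V) :
    ∃ p', (Between d u p' z ∨ Between d z p' w) ∧ d p p' ≤ 2 * K + 1 := by
  have := hd.triangle u w z
  have := hd.triangle w u z
  have := hd.triangle u z w
  have := hd.comm u w
  have := hd.comm z w
  have := hd.comm p w
  have := hd.comm p u
  have := hd.comm u z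
  by_cases h : 2 * d u p + d w z ≤ d u w + d u z
  · obtain ⟨p', hp', hge, hle⟩ := hd.exists_between_at u z (s := d u p) (by omega)
    exact ⟨p', .inl hp', hK.fellow_travel hd hp hp' (by omega) hle (c := 0) (by omega)⟩
  · obtain ⟨p', hp', hge, hle⟩ := hd.exists_between_at w z (s := d w p) (by omega)
    have := hd.comm p' w
    have := hd.comm z p'
    exact ⟨p', .inr (by omega),
      hK.fellow_travel hd (w := w) (u := u) (by omega) hp' (by omega) hle (c := 0) (by omega)⟩

/-- The point `a` at distance one from `q` lies on a geodesic from `u` to `q`: it is the point where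
this geodesic arrives at `q`. -/
structure IsGate (d : V → V → ℕ) (q u a : V) : Prop where
  dist_eq_one : d a q = 1
  dist_add_one : d u a + 1 = d u q

namespace IsGate

variable {u w m a b : V}

lemma exists_toward (hd : IsGeodesicMetric Γ d) (ha : IsGate d q u a) {L : ℕ} (hL : L ≤ d a u) :
    ∃ p, Between d q p u ∧ L + 1 ≤ d q p ∧ d q p ≤ L + 2 ∧ ReachableAvoiding Γ q (L + 1) a p := by
  obtain ⟨p, hp, hge, hle⟩ := hd.exists_between_at a u hL
  have := ha.dist_eq_one
  have := ha.dist_add_one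
  have := hd.comm u a
  have := hd.comm u q
  have := hd.comm a q
  have := hd.triangle q a p
  have := hd.triangle q p u
  exact ⟨p, by omega, by omega, by omega, hd.reachableAvoiding (by omega) hle⟩

lemma reachableAvoiding_of_near (hd : IsGeodesicMetric Γ d) (ha : IsGate d q u a) {L : ℕ}
    (hL : d a u ≤ L) : ReachableAvoiding Γ q L a u := by
  have := ha.dist_eq_one
  have := ha.dist_add_one
  have := hd.comm u a
  have := hd.comm u q
  have := hd.comm a q
  exact hd.reachableAvoiding (by omega) hL

/-- The path first follows the geodesic from `q` to `u`, then jumps to the geodesic from `u` to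
`w` before reaching the centre `m` of the triangle `q`, `u`, `w`. -/
lemma reachableAvoiding_center (hd : IsGeodesicMetric Γ d) (hK : FourPoint d K)
    (ha : IsGate d q u a) (hq : ¬ Between d u q w) (hm : Between d u m w)
    (hle : 2 * d u m + d w q ≤ d u q + d u w + 3) (hge : d u q + d u w ≤ 2 * d u m + d w q + 3)
    (hnear : d u q + d w q < d u w + 4 * K + 20) :
    ReachableAvoiding Γ q (8 * K + 60) a m := by
  have hmid {p' : V} (hp' : Between d u p' m) : ¬ Between d p' q m := by
    intro hb
    have := hd.triangle u p' q
    have := hd.triangle q m w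
    have := hd.triangle u q w
    omega
  have := ha.dist_add_one
  have := hd.comm u a
  have := hd.comm w q
  have := hd.comm u q
  have := hd.comm w u
  have := hd.triangle u w q
  have := hd.triangle u q w
  by_cases hL : 2 * K + 12 ≤ d a u
  · obtain ⟨p, hp, hpge, hple, hap⟩ := ha.exists_toward hd hL
    have := hd.comm u p
    have := hd.comm p q
    obtain ⟨p', hp', hge', hle'⟩ := hd.exists_between_at u m (s := d u p) (by omega)
    have := hd.triangle u p' w
    have := hd.triangle p' m w
    have hpp' := hK.fellow_travel hd (w := u) (u := q) (v := w) (p := p) (p' := p') (c := 0)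
      (by omega) (by omega) (by omega) (by omega) (by omega)
    have hjump : ReachableAvoiding Γ q (2 * K + 1) p p' := hd.reachableAvoiding (by omega) hpp'
    have hpm : ReachableAvoiding Γ q (2 * K + 20) p' m :=
      hd.reachableAvoiding (hmid hp') (by omega)
    exact ((hap.trans hjump).trans hpm).mono (by omega)
  · have hum : ReachableAvoiding Γ q (2 * K + 20) u m :=
      hd.reachableAvoiding (hmid (by simp [Between, hd.self])) (by omega)
    exact ((ha.reachableAvoiding_of_near hd (not_le.1 hL).le).trans hum).mono (by omega)

lemma reachableAvoiding (hd : IsGeodesicMetric Γ d) (hK : FourPoint d K) (ha : IsGate d q u a)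
    (hb : IsGate d q w b) (hq : ¬ Between d u q w) :
    ReachableAvoiding Γ q (16 * K + 120) a b := by
  have := ha.dist_add_one
  have := hb.dist_add_one
  have := hd.comm u a
  have := hd.comm w b
  have := hd.comm w q
  have := hd.comm u q
  have := hd.comm w u
  have := hd.triangle u w q
  have := hd.triangle w u q
  by_cases h : d u q + d w q < d u w + 4 * K + 20
  · obtain ⟨m, hm, hge, hle⟩ := hd.exists_between_at u w
      (s := (d u q + d u w - d w q) / 2) (by omega)
    have := hd.comm u m
    have := hd.comm m w
    have ham := ha.reachableAvoiding_center hd hK hq hm (by omega) (by omega) h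
    have hbm := hb.reachableAvoiding_center hd hK (w := u) (m := m) (by omega) (by omega) (by omega)
      (by omega) (by omega)
    exact (ham.trans hbm.symm).mono (by omega)
  · obtain ⟨p, hp, hge, hle, hap⟩ := ha.exists_toward hd (L := 2 * K + 5) (by omega)
    obtain ⟨p', hp', hge', hle', hbp'⟩ := hb.exists_toward hd (L := 2 * K + 5) (by omega)
    have hpp' := hK.fellow_travel hd (c := 2) hp hp' (by omega) (by omega) (by omega)
    have := hd.comm p q
    have hjump : ReachableAvoiding Γ q (2 * K + 3) p p' := hd.reachableAvoiding (by omega) hpp'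
    exact ((hap.trans hjump).trans hbp'.symm).mono (by omega)

end IsGate

end Geodesics

section CosetProjections

variable {G : Type u} [Group G] {H : Subgroup G} {S : Set G} {q : G ⧸ H} {u w : G ⊕ (G ⧸ H)}

/-- The element `a` of the coset `q` is a projection of `u` to `q`: it is the last vertex before the
cone vertex of `q` on a geodesic from `u`. -/
def IsProj (S : Set G) (q : G ⧸ H) (u : G ⊕ (G ⧸ H)) (a : G) : Prop :=
  (a : G ⧸ H) = q ∧ coneDist H S u (.inl a) + 1 = coneDist H S u (.inr q)

lemma coneDist_inl_inr (hS : Subgroup.closure S = ⊤) {a : G} (h : (a : G ⧸ H) = q) :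
    coneDist H S (.inl a) (.inr q) = 1 := by
  have hle : coneDist H S (.inl a) (.inr q) ≤ 1 :=
    coneDist_le_of_adj (show (conedOffGraph H S).Adj (.inl a) (.inr q) from h)
  have := (isGeodesicMetric_coneDist H hS).eq_zero_iff.not.2 (Sum.inl_ne_inr (a := a) (b := q))
  omega

lemma exists_isProj (hS : Subgroup.closure S = ⊤) (hu : u ≠ .inr q) : ∃ a, IsProj S q u a := by
  have hd := isGeodesicMetric_coneDist H hS
  obtain ⟨a | q', hadj, -, hsplit⟩ := hd.exists_step hu.symm
  · refine ⟨a, hadj, ?_⟩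
    have := coneDist_inl_inr hS (H := H) (q := q) (a := a) hadj
    have := hd.comm u (.inl a)
    have := hd.comm u (.inr q)
    have := hd.comm (.inl a) (.inr q)
    omega
  · exact hadj.elim

namespace IsProj

variable {a b : G}

lemma isGate (hS : Subgroup.closure S = ⊤) (h : IsProj S q u a) :
    IsGate (coneDist H S) (.inr q) u (.inl a) :=
  ⟨coneDist_inl_inr hS h.1, h.2⟩

lemma ne (hS : Subgroup.closure S = ⊤) (h : IsProj S q u a) : u ≠ .inr q := by
  rintro rfl
  have := h.2
  rw [(isGeodesicMetric_coneDist H hS).self] at this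
  omega

end IsProj

theorem exists_proj_bound (hS : Subgroup.closure S = ⊤)
    (hH : Subgroup.closure (S ∩ (H : Set G)) = H) (bcp : BoundedCosetPenetration H S)
    {K : ℕ} (hK : FourPoint (coneDist H S) K) :
    ∃ κ : ℕ, ∀ (q : G ⧸ H) (u w : G ⊕ (G ⧸ H)) (a b : G), IsProj S q u a → IsProj S q w b →
      ¬ Between (coneDist H S) u (.inr q) w → (mulCayley S).dist a b ≤ κ := by
  obtain ⟨κ, hκ⟩ := exists_fineness_bound hS hH bcp (16 * K + 120)
  refine ⟨κ, fun q u w a b ha hb hq => ?_⟩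
  obtain ⟨w', havoid, hlen⟩ :=
    (ha.isGate hS).reachableAvoiding (isGeodesicMetric_coneDist H hS) hK (hb.isGate hS) hq
  exact hκ q a b w' ha.1 hb.1 havoid hlen

end CosetProjections

/-! ### Guessing geodesics -/

section Guessing

lemma mul_add_two_le_two_pow {c m : ℕ} (hm : 2 * c + 4 ≤ m) : c * (m + 2) ≤ 2 ^ m := by
  have hc : c < 2 ^ c := Nat.lt_two_pow_self
  induction m, hm using Nat.le_induction with
  | base =>
    have : 2 ^ (2 * c + 4) = 16 * (2 ^ c * 2 ^ c) := by ring
    rw [this]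
    nlinarith
  | succ m hm ih =>
    have : 2 ^ c ≤ 2 ^ m := Nat.pow_le_pow_right (by norm_num) (by omega)
    rw [pow_succ]
    nlinarith

/-- If `t ≤ h * (c + 3)` for the logarithm `c` of `4 * t + 4 * h + 2`, then `2 ^ (c - 1)` is at most
linear in `c`, so `c`, and hence `t`, is bounded. -/
lemma exists_logarithmic_bound (h : ℕ) :
    ∃ R : ℕ, ∀ t, R < t → h * (Nat.clog 2 (4 * t + 4 * h + 2) + 3) < t := by
  set K := 16 * h + 1 with hK
  refine ⟨h * (2 * K + 8), fun t ht => ?_⟩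
  by_contra! hle
  set c := Nat.clog 2 (4 * t + 4 * h + 2) with hc
  have hKc : 2 * K + 5 ≤ c := by
    by_contra! hlt
    have : h * (c + 3) ≤ h * (2 * K + 8) := Nat.mul_le_mul_left h (by omega)
    omega
  obtain ⟨m, hm⟩ : ∃ m, c = m + 1 := ⟨c - 1, by omega⟩
  have hpow_lt : 2 ^ m < 4 * t + 4 * h + 2 := by
    have := Nat.pow_pred_clog_lt_self (b := 2) (by norm_num) (x := 4 * t + 4 * h + 2) (by omega)
    rwa [← hc, hm] at this
  have hle_pow : K * (m + 2) ≤ 2 ^ m := mul_add_two_le_two_pow (by omega)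
  rw [hm] at hle
  rw [hK] at hle_pow
  nlinarith

variable {X : Type*} {Γ : SimpleGraph X}

/-- The vertices `α 0, …, α n` form a geodesic. -/
def IsGeodesicSeq (Γ : SimpleGraph X) (α : ℕ → X) (n : ℕ) : Prop :=
  ∀ i j, i ≤ j → j ≤ n → Γ.dist (α i) (α j) + i = j

lemma exists_isGeodesicSeq (hΓ : Γ.Connected) (x y : X) :
    ∃ α : ℕ → X, IsGeodesicSeq Γ α (Γ.dist x y) ∧ α 0 = x ∧ α (Γ.dist x y) = y := by
  obtain ⟨w, hw⟩ := hΓ.exists_walk_length_eq_dist x y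
  have hle (i j : ℕ) (hij : i ≤ j) (hj : j ≤ w.length) :
      Γ.dist (w.getVert i) (w.getVert j) + i ≤ j := by
    induction j, hij using Nat.le_induction with
    | base => simp
    | succ j _ ih =>
      have := ih (by omega)
      have := dist_eq_one_iff_adj.2 (w.adj_getVert_succ (i := j) (by omega))
      have := hΓ.dist_triangle (u := w.getVert i) (v := w.getVert j) (w := w.getVert (j + 1))
      omega
  refine ⟨w.getVert, fun i j hij hj => ?_, by simp, by rw [← hw]; simp⟩
  rw [← hw] at hj
  have hstart := hle 0 i (by omega) (by omega)
  have hend := hle j w.length hj le_rfl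
  rw [Walk.getVert_zero] at hstart
  rw [Walk.getVert_length] at hend
  have := hle i j hij hj
  have := hΓ.dist_triangle (u := x) (v := w.getVert i) (w := y)
  have := hΓ.dist_triangle (u := w.getVert i) (v := w.getVert j) (w := y)
  omega

/-- One step along the set `A`, of length at most `r` in the graph `Γ`. -/
abbrev ShortStep (Γ : SimpleGraph X) (A : Set X) (r : ℕ) (a b : X) : Prop :=
  b ∈ A ∧ Γ.dist a b ≤ r

/-- The sets `A x y`, thought of as guesses for geodesics from `x` to `y`, are coarsely connected,
small when `x` and `y` are adjacent, and form thin triangles. -/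
structure IsGuess (Γ : SimpleGraph X) (A : X → X → Set X) (h : ℕ) : Prop where
  left_mem : ∀ x y, x ∈ A x y
  right_mem : ∀ x y, y ∈ A x y
  chain : ∀ x y, Relation.ReflTransGen (ShortStep Γ (A x y) h) x y
  dist_le : ∀ x y, Γ.dist x y ≤ 1 → ∀ p ∈ A x y, Γ.dist p x ≤ h
  thin : ∀ x y z, ∀ p ∈ A x y, ∃ p', (p' ∈ A x z ∨ p' ∈ A z y) ∧ Γ.dist p p' ≤ h

/-- The points of a guess between the endpoints of a geodesic of length at most `n` are at distance
at most `t` from the geodesic. -/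
def GuessNearGeodesics (Γ : SimpleGraph X) (A : X → X → Set X) (n t : ℕ) : Prop :=
  ∀ (α : ℕ → X) (m : ℕ), m ≤ n → IsGeodesicSeq Γ α m →
    ∀ p ∈ A (α 0) (α m), ∃ i ≤ m, Γ.dist p (α i) ≤ t

variable {A : X → X → Set X} {h : ℕ} {α : ℕ → X} {m n t : ℕ} {p p' : X}

lemma IsGuess.exists_dist_le_of_le_two_pow (hΓ : Γ.Connected) (hA : IsGuess Γ A h)
    (hα : IsGeodesicSeq Γ α n) (k : ℕ) {i j : ℕ} (hij : i ≤ j) (hj : j ≤ n) (hk : j ≤ i + 2 ^ k)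
    (hp : p ∈ A (α i) (α j)) : ∃ m, i ≤ m ∧ m ≤ j ∧ Γ.dist p (α m) ≤ h * (k + 1) := by
  induction k generalizing i j p with
  | zero =>
    have := hα i j hij hj
    rw [pow_zero] at hk
    exact ⟨i, le_rfl, hij, by simpa using hA.dist_le _ _ (by omega) p hp⟩
  | succ k ih =>
    obtain ⟨p', hp', hpp'⟩ := hA.thin _ _ (α ((i + j) / 2)) p hp
    have near {m : ℕ} (hm : Γ.dist p' (α m) ≤ h * (k + 1)) :
        Γ.dist p (α m) ≤ h * (k + 1 + 1) := by
      have := hΓ.dist_triangle (u := p) (v := p') (w := α m)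
      rw [mul_add_one]
      omega
    rw [pow_succ] at hk
    rcases hp' with hp' | hp'
    · obtain ⟨m, him, hmj, hm⟩ := ih (j := (i + j) / 2) (by omega) (by omega) (by omega) hp'
      exact ⟨m, him, by omega, near hm⟩
    · obtain ⟨m, him, hmj, hm⟩ := ih (i := (i + j) / 2) (by omega) (by omega) (by omega) hp'
      exact ⟨m, by omega, hmj, near hm⟩

lemma IsGuess.guessNearGeodesics_log (hΓ : Γ.Connected) (hA : IsGuess Γ A h) (n : ℕ) :
    GuessNearGeodesics Γ A n (h * (Nat.clog 2 n + 1)) := by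
  intro α m hm hα p hp
  have := Nat.le_pow_clog (b := 2) (by norm_num) n
  obtain ⟨i, -, hi, hpi⟩ := hA.exists_dist_le_of_le_two_pow hΓ hα (Nat.clog 2 n) (Nat.zero_le m)
    le_rfl (by omega) hp
  exact ⟨i, hi, hpi⟩

lemma IsGuess.exists_dist_lt_of_mem_initial (hΓ : Γ.Connected) (hA : IsGuess Γ A h)
    (hnear : GuessNearGeodesics Γ A n t) (hm : m ≤ n) (hα : IsGeodesicSeq Γ α m) (ht : 3 * h < t)
    {k : ℕ} (hk : k ≤ m) (hpk : Γ.dist p (α k) ≤ t) (hpp' : Γ.dist p p' ≤ h)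
    (hp' : p' ∈ A (α 0) (α (k - (2 * t + 2 * h + 1)))) : ∃ i ≤ m, Γ.dist p (α i) < t := by
  by_cases hshort : k ≤ 2 * t + 2 * h + 1
  · rw [Nat.sub_eq_zero_of_le hshort] at hp'
    have := hA.dist_le _ _ (by simp) p' hp'
    have := hΓ.dist_triangle (u := p) (v := p') (w := α 0)
    exact ⟨0, by omega, by omega⟩
  · obtain ⟨i, hi, hp'i⟩ := hnear α (k - (2 * t + 2 * h + 1)) (by omega)
      (fun i j hij hj => hα i j hij (by omega)) p' hp'
    have := hΓ.dist_triangle (u := p) (v := p') (w := α i)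
    have := hΓ.dist_triangle (u := α i) (v := p) (w := α k)
    have := hα i k (by omega) hk
    have := Γ.dist_comm (u := α i) (v := p)
    omega

lemma IsGuess.exists_dist_lt_of_mem_final (hΓ : Γ.Connected) (hA : IsGuess Γ A h)
    (hnear : GuessNearGeodesics Γ A n t) (hm : m ≤ n) (hα : IsGeodesicSeq Γ α m) (ht : 3 * h < t)
    {k : ℕ} (hk : k ≤ m) (hpk : Γ.dist p (α k) ≤ t) (hpp' : Γ.dist p p' ≤ 2 * h)
    (hp' : p' ∈ A (α (min m (k + (2 * t + 2 * h + 1)))) (α m)) :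
    ∃ i ≤ m, Γ.dist p (α i) < t := by
  by_cases hshort : m ≤ k + (2 * t + 2 * h + 1)
  · rw [min_eq_left hshort] at hp'
    have := hA.dist_le _ _ (by simp) p' hp'
    have := hΓ.dist_triangle (u := p) (v := p') (w := α m)
    exact ⟨m, le_rfl, by omega⟩
  · obtain ⟨l, rfl⟩ := Nat.exists_eq_add_of_le (not_le.1 hshort).le
    rw [min_eq_right (by omega)] at hp'
    obtain ⟨i, hi, hp'i⟩ := hnear (fun j => α (k + (2 * t + 2 * h + 1) + j)) l (by omega)
      (fun i j hij hj => by
        have := hα (k + (2 * t + 2 * h + 1) + i) (k + (2 * t + 2 * h + 1) + j) (by omega) (by omega)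
        dsimp only
        omega) p' hp'
    have := hΓ.dist_triangle (u := p) (v := p') (w := α (k + (2 * t + 2 * h + 1) + i))
    have := hΓ.dist_triangle (u := α k) (v := p) (w := α (k + (2 * t + 2 * h + 1) + i))
    have := hα k (k + (2 * t + 2 * h + 1) + i) (by omega) (by omega)
    have := Γ.dist_comm (u := α k) (v := p)
    omega

/-- A point of the guess at distance at most `t` from `α k` is close to a guess for one of three
subsegments. The outer two are too far from `α k`, and the middle one is short, so that the
logarithmic bound applies to it. -/
lemma IsGuess.guessNearGeodesics_pred (hΓ : Γ.Connected) (hA : IsGuess Γ A h)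
    (ht : h * (Nat.clog 2 (4 * t + 4 * h + 2) + 3) < t) (hnear : GuessNearGeodesics Γ A n t) :
    GuessNearGeodesics Γ A n (t - 1) := by
  intro α m hm hα p hp
  suffices ∃ i ≤ m, Γ.dist p (α i) < t by
    obtain ⟨i, hi, hpi⟩ := this
    exact ⟨i, hi, by omega⟩
  obtain ⟨k, hk, hpk⟩ := hnear α m hm hα p hp
  have : 3 * h < t := by nlinarith
  obtain ⟨p₁, hp₁, hpp₁⟩ := hA.thin _ _ (α (k - (2 * t + 2 * h + 1))) p hp
  rcases hp₁ with hp₁ | hp₁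
  · exact hA.exists_dist_lt_of_mem_initial hΓ hnear hm hα this hk hpk hpp₁ hp₁
  obtain ⟨p₂, hp₂, hp₁p₂⟩ := hA.thin _ _ (α (min m (k + (2 * t + 2 * h + 1)))) p₁ hp₁
  have := hΓ.dist_triangle (u := p) (v := p₁) (w := p₂)
  rcases hp₂ with hp₂ | hp₂
  · have := Nat.le_pow_clog (b := 2) (by norm_num) (4 * t + 4 * h + 2)
    obtain ⟨i, -, hi, hp₂i⟩ := hA.exists_dist_le_of_le_two_pow hΓ hα
      (Nat.clog 2 (4 * t + 4 * h + 2)) (by omega) (by omega) (by omega) hp₂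
    have := hΓ.dist_triangle (u := p) (v := p₂) (w := α i)
    exact ⟨i, by omega, by nlinarith⟩
  · exact hA.exists_dist_lt_of_mem_final hΓ hnear hm hα (by omega) hk hpk (by omega) hp₂

lemma IsGuess.exists_guessNearGeodesics (hΓ : Γ.Connected) (hA : IsGuess Γ A h) :
    ∃ R, ∀ n, GuessNearGeodesics Γ A n R := by
  obtain ⟨R, hR⟩ := exists_logarithmic_bound h
  refine ⟨R, fun n => ?_⟩
  have descend (c : ℕ) (hc : GuessNearGeodesics Γ A n (R + c)) : GuessNearGeodesics Γ A n R := by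
    induction c with
    | zero => exact hc
    | succ c ih => exact ih (hA.guessNearGeodesics_pred hΓ (hR _ (by omega)) hc)
  refine descend (h * (Nat.clog 2 n + 1)) fun α m hm hα p hp => ?_
  obtain ⟨i, hi, hpi⟩ := hA.guessNearGeodesics_log hΓ n α m hm hα p hp
  exact ⟨i, hi, by omega⟩

/-- Following the chain from `x` to `z`, consider the last point which is close to the guess from
`x` to `y`. -/
lemma IsGuess.exists_center (hΓ : Γ.Connected) (hA : IsGuess Γ A h) (x y z : X) :
    ∃ p ∈ A x z, (∃ p₁ ∈ A x y, Γ.dist p p₁ ≤ 2 * h) ∧ ∃ p₂ ∈ A y z, Γ.dist p p₂ ≤ 2 * h := by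
  by_contra! hcon
  have near_left (p : X)
      (hp : Relation.ReflTransGen (fun a b => b ∈ A x z ∧ Γ.dist a b ≤ h) x p) :
      p ∈ A x z ∧ ∃ p₁ ∈ A x y, Γ.dist p p₁ ≤ h := by
    induction hp with
    | refl => exact ⟨hA.left_mem x z, x, hA.left_mem x y, by simp⟩
    | @tail a b _ hab ih =>
      obtain ⟨ha, p₁, hp₁, hap₁⟩ := ih
      obtain ⟨p', hp' | hp', hbp'⟩ := hA.thin x z y b hab.1
      · exact ⟨hab.1, p', hp', hbp'⟩
      · have := hcon a ha ⟨p₁, hp₁, by omega⟩ p' hp'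
        have := hΓ.dist_triangle (u := a) (v := b) (w := p')
        omega
  obtain ⟨hz, p₁, hp₁, hzp₁⟩ := near_left z (hA.chain x z)
  simpa using hcon z hz ⟨p₁, hp₁, by omega⟩ z (hA.right_mem y z)

variable {R : ℕ}

lemma dist_add_dist_le_of_mem_guess (hΓ : Γ.Connected) (hR : ∀ n, GuessNearGeodesics Γ A n R)
    {x y : X} (hp : p ∈ A x y) (c : X) :
    Γ.dist x c + Γ.dist c y ≤ Γ.dist x y + 2 * (Γ.dist p c + R) := by
  obtain ⟨β, hβ, rfl, hy⟩ := exists_isGeodesicSeq hΓ x y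
  obtain ⟨i, hi, hpi⟩ := hR _ β _ le_rfl hβ p (by rwa [hy])
  have hleft := hβ 0 i (by omega) hi
  have hright := hβ i _ hi le_rfl
  rw [hy] at hright
  have := hΓ.dist_triangle (u := β 0) (v := β i) (w := c)
  have := hΓ.dist_triangle (u := c) (v := β i) (w := y)
  have := hΓ.dist_triangle (u := β i) (v := p) (w := c)
  have := Γ.dist_comm (u := β i) (v := p)
  have := Γ.dist_comm (u := β i) (v := c)
  omega

lemma IsGuess.exists_center_on_geodesic (hΓ : Γ.Connected) (hA : IsGuess Γ A h)
    (hR : ∀ n, GuessNearGeodesics Γ A n R) (hα : IsGeodesicSeq Γ α n) (y : X) :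
    ∃ i ≤ n,
      Γ.dist (α 0) (α i) + Γ.dist (α i) y ≤ Γ.dist (α 0) y + (4 * R + 4 * h) ∧
      Γ.dist y (α i) + Γ.dist (α i) (α n) ≤ Γ.dist y (α n) + (4 * R + 4 * h) := by
  obtain ⟨p, hp, ⟨p₁, hp₁, hpp₁⟩, p₂, hp₂, hpp₂⟩ := hA.exists_center hΓ (α 0) y (α n)
  obtain ⟨i, hi, hpi⟩ := hR n α n le_rfl hα p hp
  have := dist_add_dist_le_of_mem_guess hΓ hR hp₁ (α i)
  have := dist_add_dist_le_of_mem_guess hΓ hR hp₂ (α i)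
  have := hΓ.dist_triangle (u := p₁) (v := p) (w := α i)
  have := hΓ.dist_triangle (u := p₂) (v := p) (w := α i)
  have := Γ.dist_comm (u := p₁) (v := p)
  have := Γ.dist_comm (u := p₂) (v := p)
  exact ⟨i, hi, by omega, by omega⟩

theorem IsGuess.exists_fourPoint (hΓ : Γ.Connected) (hA : IsGuess Γ A h) :
    ∃ K, FourPoint Γ.dist K := by
  obtain ⟨R, hR⟩ := hA.exists_guessNearGeodesics hΓ
  refine ⟨8 * R + 8 * h, fun w x y z => ?_⟩
  obtain ⟨α, hα, rfl, hz⟩ := exists_isGeodesicSeq hΓ x z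
  obtain ⟨i, hi, hyi, hyi'⟩ := hA.exists_center_on_geodesic hΓ hR hα y
  obtain ⟨j, hj, hwj, hwj'⟩ := hA.exists_center_on_geodesic hΓ hR hα w
  have := hα 0 i (by omega) hi
  have := hα i _ hi le_rfl
  have := hα 0 j (by omega) hj
  have := hα j _ hj le_rfl
  have := Γ.dist_comm (u := α i) (v := y)
  have := Γ.dist_comm (u := α j) (v := w)
  have := Γ.dist_comm (u := α 0) (v := w)
  have := hΓ.dist_triangle (u := w) (v := α j) (w := y)
  have := hΓ.dist_triangle (u := α j) (v := α i) (w := y)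
  have := Γ.dist_comm (u := α i) (v := α j)
  rw [hz] at *
  rcases le_total i j with hij | hij
  · have := hα i j hij hj
    omega
  · have := hα j i hij hi
    omega

end Guessing

section FineHyperbolic

namespace IsGeodesicMetric

variable {V : Type*} {Γ : SimpleGraph V} {d : V → V → ℕ}

lemma between_comm (hd : IsGeodesicMetric Γ d) {u p w : V} :
    Between d u p w ↔ Between d w p u := by
  have := hd.comm u p
  have := hd.comm p w
  have := hd.comm u w
  constructor <;> intro h <;> omega

lemma one_le (hd : IsGeodesicMetric Γ d) {u v : V} (h : u ≠ v) : 1 ≤ d u v :=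
  Nat.one_le_iff_ne_zero.2 (hd.eq_zero_iff.not.2 h)

lemma not_between_of_between (hd : IsGeodesicMetric Γ d) {u q p w : V} (hqp : q ≠ p)
    (huqp : Between d u q p) (hupw : Between d u p w) : ¬ Between d p q w := by
  intro hb
  have := hd.triangle u q w
  have := hd.one_le hqp
  have := hd.comm p q
  omega

end IsGeodesicMetric

variable {G : Type u} [Group G] {H : Subgroup G} {S : Set G}

/-- The geometry of the coned-off graph of a relatively hyperbolic group: its metric is hyperbolic,
and vertices joined by a geodesic that avoids a cone vertex have close projections. -/
structure IsFineHyperbolic (H : Subgroup G) (S : Set G) (K κ : ℕ) : Prop where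
  closure_eq : Subgroup.closure S = ⊤
  fourPoint : FourPoint (coneDist H S) K
  proj : ∀ (q : G ⧸ H) (u w : G ⊕ (G ⧸ H)) (a b : G), IsProj S q u a → IsProj S q w b →
      ¬ Between (coneDist H S) u (.inr q) w → (mulCayley S).dist a b ≤ κ

open Classical in
/-- A chosen projection of the vertex `u` to the coset `q`, with junk value `1` if `u` is the cone
vertex of `q`. -/
def coneProj (S : Set G) (q : G ⧸ H) (u : G ⊕ (G ⧸ H)) : G :=
  if h : ∃ a, IsProj S q u a then h.choose else 1

lemma isProj_coneProj (hS : Subgroup.closure S = ⊤) {q : G ⧸ H} {u : G ⊕ (G ⧸ H)}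
    (hu : u ≠ .inr q) : IsProj S q u (coneProj S q u) := by
  have h := exists_isProj hS hu
  rw [coneProj, dif_pos h]
  exact h.choose_spec

namespace IsFineHyperbolic

variable {K κ : ℕ} {q : G ⧸ H} {u w z p' : G ⊕ (G ⧸ H)} {g : G}

lemma isGeodesicMetric (hF : IsFineHyperbolic H S K κ) :
    IsGeodesicMetric (conedOffGraph H S) (coneDist H S) :=
  isGeodesicMetric_coneDist H hF.closure_eq

lemma dist_triangle (hF : IsFineHyperbolic H S K κ) (x y z : G) :
    (mulCayley S).dist x z ≤ (mulCayley S).dist x y + (mulCayley S).dist y z :=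
  (mulCayley_connected hF.closure_eq).dist_triangle

lemma dist_coneProj_le (hF : IsFineHyperbolic H S K κ)
    (h : ¬ Between (coneDist H S) u (.inr q) w) :
    (mulCayley S).dist (coneProj S q u) (coneProj S q w) ≤ κ := by
  obtain ⟨hu, hw⟩ := hF.isGeodesicMetric.ne_of_not_between h
  exact hF.proj q u w _ _ (isProj_coneProj hF.closure_eq hu) (isProj_coneProj hF.closure_eq hw) h

lemma dist_isProj_le (hF : IsFineHyperbolic H S K κ) (h : IsProj S q u g) :
    (mulCayley S).dist g (coneProj S q u) ≤ κ := by
  have hu := h.ne hF.closure_eq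
  refine hF.proj q u u _ _ h (isProj_coneProj hF.closure_eq hu) fun hb => ?_
  have := hF.isGeodesicMetric.one_le hu
  have := hF.isGeodesicMetric.self u
  omega

lemma dist_coneProj_le_of_between (hF : IsFineHyperbolic H S K κ)
    (hg : Between (coneDist H S) u (.inl g) w) (hp' : Between (coneDist H S) u p' z)
    (huz : ¬ Between (coneDist H S) u (.inr q) z) (hzw : ¬ Between (coneDist H S) z (.inr q) w) :
    (mulCayley S).dist (coneProj S q (.inl g)) (coneProj S q p') ≤ 3 * κ := by
  have hd := hF.isGeodesicMetric
  have := hd.triangle u (.inr q) z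
  by_cases hug : Between (coneDist H S) u (.inr q) (.inl g)
  · have hpz : ¬ Between (coneDist H S) p' (.inr q) z := fun hb => by
      have := hd.triangle u p' (.inr q)
      omega
    have hgw := hd.not_between_of_between Sum.inr_ne_inl hug hg
    have := hF.dist_coneProj_le hgw
    have := hF.dist_coneProj_le hzw
    have := hF.dist_coneProj_le hpz
    have := hF.dist_triangle (coneProj S q (.inl g)) (coneProj S q w) (coneProj S q z)
    have := hF.dist_triangle (coneProj S q (.inl g)) (coneProj S q z) (coneProj S q p')
    have := (mulCayley S).dist_comm (u := coneProj S q w) (v := coneProj S q z)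
    have := (mulCayley S).dist_comm (u := coneProj S q p') (v := coneProj S q z)
    omega
  · have hup : ¬ Between (coneDist H S) u (.inr q) p' := fun hb => by
      have := hd.triangle (.inr q) p' z
      omega
    have := hF.dist_coneProj_le hug
    have := hF.dist_coneProj_le hup
    have := hF.dist_triangle (coneProj S q (.inl g)) (coneProj S q u) (coneProj S q p')
    have := (mulCayley S).dist_comm (u := coneProj S q (.inl g)) (v := coneProj S q u)
    omega

lemma dist_coneProj_side_le (hF : IsFineHyperbolic H S K κ)
    (hg : Between (coneDist H S) u (.inl g) w)
    (hp' : Between (coneDist H S) u p' z ∨ Between (coneDist H S) z p' w)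
    (huz : ¬ Between (coneDist H S) u (.inr q) z) (hzw : ¬ Between (coneDist H S) z (.inr q) w) :
    (mulCayley S).dist (coneProj S q (.inl g)) (coneProj S q p') ≤ 3 * κ := by
  have hd := hF.isGeodesicMetric
  rcases hp' with hp' | hp'
  · exact hF.dist_coneProj_le_of_between hg hp' huz hzw
  · exact hF.dist_coneProj_le_of_between (hd.between_comm.1 hg) (hd.between_comm.1 hp')
      (fun h => hzw (hd.between_comm.1 h)) (fun h => huz (hd.between_comm.1 h))

lemma dist_coneProj_vertex_le (hF : IsFineHyperbolic H S K κ)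
    (hg : Between (coneDist H S) u (.inl g) w) (z : G ⊕ (G ⧸ H)) :
    (u ≠ .inr q ∧ (mulCayley S).dist (coneProj S q (.inl g)) (coneProj S q u) ≤ 2 * κ) ∨
    (z ≠ .inr q ∧ (mulCayley S).dist (coneProj S q (.inl g)) (coneProj S q z) ≤ 2 * κ) ∨
    (Between (coneDist H S) z (.inr q) w ∧ w ≠ .inr q ∧
      (mulCayley S).dist (coneProj S q (.inl g)) (coneProj S q w) ≤ 2 * κ) := by
  have hd := hF.isGeodesicMetric
  by_cases hug : Between (coneDist H S) u (.inr q) (.inl g)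
  swap
  · have := hF.dist_coneProj_le hug
    have := (mulCayley S).dist_comm (u := coneProj S q (.inl g)) (v := coneProj S q u)
    exact .inl ⟨(hd.ne_of_not_between hug).1, by omega⟩
  have hgw := hd.not_between_of_between Sum.inr_ne_inl hug hg
  have := hF.dist_coneProj_le hgw
  by_cases hzw : Between (coneDist H S) z (.inr q) w
  · exact .inr (.inr ⟨hzw, (hd.ne_of_not_between hgw).2, by omega⟩)
  · have := hF.dist_coneProj_le hzw
    have := hF.dist_triangle (coneProj S q (.inl g)) (coneProj S q w) (coneProj S q z)
    have := (mulCayley S).dist_comm (u := coneProj S q w) (v := coneProj S q z)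
    exact .inr (.inl ⟨(hd.ne_of_not_between hzw).1, by omega⟩)

end IsFineHyperbolic

end FineHyperbolic

/-! ### The cusped graph -/

section Cusped

variable {G : Type u} [Group G] {H : Subgroup G} {S : Set G}

/-- The cusped graph of Groves and Manning: the Cayley graph of `G` at level `0`, with a
combinatorial horoball attached to each left coset of `H`. A step up in a horoball halves the
distances, so elements of a coset at distance at most `2 ^ i` are adjacent at level `i`. -/
def cuspedGraph (H : Subgroup G) (S : Set G) : SimpleGraph (G × ℕ) where
  Adj ξ η := (ξ.2 = 0 ∧ η.2 = 0 ∧ (mulCayley S).Adj ξ.1 η.1) ∨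
    (ξ.1 = η.1 ∧ (ξ.2 + 1 = η.2 ∨ η.2 + 1 = ξ.2)) ∨
    (ξ.2 = η.2 ∧ ξ.1 ≠ η.1 ∧ (ξ.1 : G ⧸ H) = (η.1 : G ⧸ H) ∧
      (mulCayley S).dist ξ.1 η.1 ≤ 2 ^ ξ.2)
  symm := ⟨by
    rintro ⟨x, i⟩ ⟨y, j⟩ (⟨hi, hj, hxy⟩ | ⟨hxy, hij⟩ | ⟨rfl, hne, hxy, hdist⟩)
    · exact .inl ⟨hj, hi, hxy.symm⟩
    · exact .inr (.inl ⟨hxy.symm, hij.symm⟩)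
    · exact .inr (.inr ⟨rfl, hne.symm, hxy.symm, by rwa [SimpleGraph.dist_comm]⟩)⟩
  loopless := ⟨by
    rintro ⟨x, i⟩ (⟨-, -, hxx⟩ | ⟨-, hii⟩ | ⟨-, hne, -⟩)
    · exact hxx.ne rfl
    · rcases hii with hii | hii <;> simp at hii
    · exact hne rfl⟩

lemma cuspedGraph_adj_vertical (x : G) (i : ℕ) : (cuspedGraph H S).Adj (x, i) (x, i + 1) :=
  .inr (.inl ⟨rfl, .inl rfl⟩)

lemma cuspedGraph_connected (H : Subgroup G) (hS : Subgroup.closure S = ⊤) :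
    (cuspedGraph H S).Connected := by
  have level_zero (x y : G) : (cuspedGraph H S).Reachable (x, 0) (y, 0) :=
    ((mulCayley_connected hS).preconnected x y).map
      (⟨fun g => (g, 0), fun h => .inl ⟨rfl, rfl, h⟩⟩ : mulCayley S →g cuspedGraph H S)
  have vertical (x : G) (i : ℕ) : (cuspedGraph H S).Reachable (x, 0) (x, i) := by
    induction i with
    | zero => rfl
    | succ i ih => exact ih.trans (cuspedGraph_adj_vertical x i).reachable
  have : Nonempty (G × ℕ) := ⟨(1, 0)⟩
  refine ⟨?_⟩
  rintro ⟨x, i⟩ ⟨y, j⟩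
  exact ((vertical x i).symm.trans (level_zero x y)).trans (vertical y j)

lemma cusped_dist_vertical (hS : Subgroup.closure S = ⊤) (x : G) (i k : ℕ) :
    (cuspedGraph H S).dist (x, i) (x, i + k) ≤ k := by
  induction k with
  | zero => simp
  | succ k ih =>
    have := (cuspedGraph_connected H hS).dist_triangle (u := (x, i)) (v := (x, i + k))
      (w := (x, i + (k + 1)))
    have := dist_eq_one_iff_adj.2 (cuspedGraph_adj_vertical (H := H) (S := S) x (i + k))
    rw [add_assoc] at this
    omega

lemma cusped_dist_horizontal {x y : G} (hxy : (x : G ⧸ H) = (y : G ⧸ H)) {i : ℕ}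
    (h : (mulCayley S).dist x y ≤ 2 ^ i) : (cuspedGraph H S).dist (x, i) (y, i) ≤ 1 := by
  by_cases hne : x = y
  · subst hne
    simp
  · exact (dist_eq_one_iff_adj.2 (Or.inr (Or.inr ⟨rfl, hne, hxy, h⟩))).le

lemma cusped_dist_coset (hS : Subgroup.closure S = ⊤) {x y : G}
    (hxy : (x : G ⧸ H) = (y : G ⧸ H)) {r : ℕ} (h : (mulCayley S).dist x y ≤ r) :
    (cuspedGraph H S).dist (x, 0) (y, 0) ≤ 2 * r + 1 := by
  have hup := cusped_dist_vertical (H := H) hS x 0 r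
  have hdown := cusped_dist_vertical (H := H) hS y 0 r
  have := cusped_dist_horizontal (S := S) hxy (i := r) (h.trans Nat.lt_two_pow_self.le)
  rw [zero_add] at hup hdown
  have := (cuspedGraph_connected H hS).dist_triangle (u := (x, 0)) (v := (x, r)) (w := (y, 0))
  have := (cuspedGraph_connected H hS).dist_triangle (u := (x, r)) (v := (y, r)) (w := (y, 0))
  have := (cuspedGraph H S).dist_comm (u := (y, r)) (v := (y, 0))
  omega

/-- The top level of the standard path between two points of a horoball. -/
def hatHeight (S : Set G) (ξ η : G × ℕ) : ℕ :=
  max (max ξ.2 η.2) (Nat.clog 2 ((mulCayley S).dist ξ.1 η.1))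

/-- The vertices of the standard path between two points of a horoball: up, across, and down. -/
def horoPath (S : Set G) (ξ η : G × ℕ) : Set (G × ℕ) :=
  {p | (p.1 = ξ.1 ∧ ξ.2 ≤ p.2 ∧ p.2 ≤ hatHeight S ξ η) ∨
    (p.1 = η.1 ∧ η.2 ≤ p.2 ∧ p.2 ≤ hatHeight S ξ η)}

lemma hatHeight_comm (ξ η : G × ℕ) : hatHeight S ξ η = hatHeight S η ξ := by
  rw [hatHeight, hatHeight, max_comm ξ.2, SimpleGraph.dist_comm]

lemma left_le_hatHeight (ξ η : G × ℕ) : ξ.2 ≤ hatHeight S ξ η :=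
  (le_max_left _ _).trans (le_max_left _ _)

lemma right_le_hatHeight (ξ η : G × ℕ) : η.2 ≤ hatHeight S ξ η :=
  (le_max_right _ _).trans (le_max_left _ _)

lemma horoPath_comm (ξ η : G × ℕ) : horoPath S ξ η = horoPath S η ξ := by
  ext p
  simp only [horoPath, Set.mem_ofPred_eq, hatHeight_comm ξ η]
  exact or_comm

lemma left_mem_horoPath (ξ η : G × ℕ) : ξ ∈ horoPath S ξ η :=
  .inl ⟨rfl, le_rfl, left_le_hatHeight ξ η⟩

lemma right_mem_horoPath (ξ η : G × ℕ) : η ∈ horoPath S ξ η :=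
  .inr ⟨rfl, le_rfl, right_le_hatHeight ξ η⟩

lemma dist_le_two_pow_of_hatHeight_le {ξ η : G × ℕ} {i : ℕ} (h : hatHeight S ξ η ≤ i) :
    (mulCayley S).dist ξ.1 η.1 ≤ 2 ^ i :=
  (Nat.le_pow_clog (by norm_num) _).trans
    (Nat.pow_le_pow_right (by norm_num) ((le_max_right _ _).trans h))

lemma hatHeight_le (hS : Subgroup.closure S = ⊤) (ξ η ζ : G × ℕ) :
    hatHeight S ξ η ≤ max (hatHeight S ξ ζ) (hatHeight S ζ η) + 1 := by
  set M := max (hatHeight S ξ ζ) (hatHeight S ζ η)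
  have hξ : ξ.2 ≤ M := (left_le_hatHeight ξ ζ).trans (le_max_left _ _)
  have hη : η.2 ≤ M := (right_le_hatHeight ζ η).trans (le_max_right _ _)
  have : (mulCayley S).dist ξ.1 ζ.1 ≤ 2 ^ M := dist_le_two_pow_of_hatHeight_le (le_max_left _ _)
  have : (mulCayley S).dist ζ.1 η.1 ≤ 2 ^ M := dist_le_two_pow_of_hatHeight_le (le_max_right _ _)
  have := (mulCayley_connected hS).dist_triangle (u := ξ.1) (v := ζ.1) (w := η.1)
  have hlog : Nat.clog 2 ((mulCayley S).dist ξ.1 η.1) ≤ M + 1 :=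
    Nat.clog_le_of_le_pow (by rw [pow_succ]; omega)
  exact max_le (max_le (by omega) (by omega)) hlog

lemma cusped_dist_pred (hS : Subgroup.closure S = ⊤) (x : G) {k : ℕ} (hk : 0 < k) :
    (cuspedGraph H S).dist (x, k) (x, k - 1) ≤ 1 := by
  rw [SimpleGraph.dist_comm]
  simpa only [Nat.sub_add_cancel hk] using cusped_dist_vertical (H := H) hS x (k - 1) 1

lemma horoPath_thin_left (hS : Subgroup.closure S = ⊤) {ξ η ζ : G × ℕ}
    (hξζ : (ξ.1 : G ⧸ H) = (ζ.1 : G ⧸ H)) {k : ℕ} (hk : ξ.2 ≤ k) (hk' : k ≤ hatHeight S ξ η) :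
    ∃ p', (p' ∈ horoPath S ξ ζ ∨ p' ∈ horoPath S ζ η) ∧
      (cuspedGraph H S).dist (ξ.1, k) p' ≤ 2 := by
  by_cases hlow : k ≤ hatHeight S ξ ζ
  · exact ⟨(ξ.1, k), .inl (.inl ⟨rfl, hk, hlow⟩), by simp⟩
  have := hatHeight_le hS ξ η ζ
  have := left_le_hatHeight (S := S) ζ η
  have := right_le_hatHeight (S := S) ξ ζ
  have hacross : (cuspedGraph H S).dist (ξ.1, k) (ζ.1, k) ≤ 1 :=
    cusped_dist_horizontal hξζ (dist_le_two_pow_of_hatHeight_le (by omega))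
  by_cases hlow' : k ≤ hatHeight S ζ η
  · exact ⟨(ζ.1, k), .inr (.inl ⟨rfl, by simp only; omega, hlow'⟩), by omega⟩
  by_cases hmax : hatHeight S ζ η ≤ hatHeight S ξ ζ
  · have := left_le_hatHeight (S := S) ξ ζ
    have := cusped_dist_pred (H := H) hS ξ.1 (k := k) (by omega)
    exact ⟨(ξ.1, k - 1), .inl (.inl ⟨rfl, by simp only; omega, by simp only; omega⟩), by omega⟩
  · have := cusped_dist_pred (H := H) hS ζ.1 (k := k) (by omega)
    have := (cuspedGraph_connected H hS).dist_triangle (u := (ξ.1, k)) (v := (ζ.1, k))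
      (w := (ζ.1, k - 1))
    exact ⟨(ζ.1, k - 1), .inr (.inl ⟨rfl, by simp only; omega, by simp only; omega⟩), by omega⟩

lemma horoPath_thin (hS : Subgroup.closure S = ⊤) {ξ η ζ : G × ℕ}
    (hξζ : (ξ.1 : G ⧸ H) = (ζ.1 : G ⧸ H)) (hζη : (ζ.1 : G ⧸ H) = (η.1 : G ⧸ H)) {p : G × ℕ}
    (hp : p ∈ horoPath S ξ η) :
    ∃ p', (p' ∈ horoPath S ξ ζ ∨ p' ∈ horoPath S ζ η) ∧ (cuspedGraph H S).dist p p' ≤ 2 := by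
  obtain ⟨x, k⟩ := p
  rcases hp with ⟨rfl, hk, hk'⟩ | ⟨rfl, hk, hk'⟩
  · exact horoPath_thin_left hS hξζ hk hk'
  · rw [hatHeight_comm] at hk'
    obtain ⟨p', hp', hpp'⟩ := horoPath_thin_left hS hζη.symm hk hk'
    rw [horoPath_comm η ζ, horoPath_comm ζ ξ] at hp'
    exact ⟨p', hp'.symm, hpp'⟩

lemma cusped_dist_le_of_le_hatHeight (hS : Subgroup.closure S = ⊤) {x y : G}
    (hxy : (x : G ⧸ H) = (y : G ⧸ H)) {r k : ℕ} (h : (mulCayley S).dist x y ≤ r)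
    (hk : k ≤ hatHeight S (x, 0) (y, 0)) :
    (cuspedGraph H S).dist (x, k) (x, 0) ≤ r ∧
      (cuspedGraph H S).dist (x, k) (y, 0) ≤ 3 * r + 1 := by
  have hkr : k ≤ r := by
    simp only [hatHeight, max_self, zero_le, max_eq_right] at hk
    exact hk.trans (Nat.clog_le_of_le_pow (h.trans Nat.lt_two_pow_self.le))
  have hdown := cusped_dist_vertical (H := H) hS x 0 k
  rw [zero_add, SimpleGraph.dist_comm] at hdown
  have := cusped_dist_coset hS hxy h
  have := (cuspedGraph_connected H hS).dist_triangle (u := (x, k)) (v := (x, 0)) (w := (y, 0))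
  omega

lemma horoPath_small (hS : Subgroup.closure S = ⊤) {x y : G} (hxy : (x : G ⧸ H) = (y : G ⧸ H))
    {r : ℕ} (h : (mulCayley S).dist x y ≤ r) {p : G × ℕ} (hp : p ∈ horoPath S (x, 0) (y, 0)) :
    (cuspedGraph H S).dist p (x, 0) ≤ 3 * r + 1 ∧ (cuspedGraph H S).dist p (y, 0) ≤ 3 * r + 1 := by
  obtain ⟨g, k⟩ := p
  rcases hp with ⟨hg, -, hk⟩ | ⟨hg, -, hk⟩ <;> simp only at hg hk <;> subst hg
  · have := cusped_dist_le_of_le_hatHeight hS hxy h hk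
    omega
  · rw [hatHeight_comm] at hk
    have := cusped_dist_le_of_le_hatHeight hS hxy.symm (r := r) (by rwa [SimpleGraph.dist_comm]) hk
    omega

lemma horoPath_chain (hS : Subgroup.closure S = ⊤) {ξ η : G × ℕ}
    (h : (ξ.1 : G ⧸ H) = (η.1 : G ⧸ H)) :
    Relation.ReflTransGen (ShortStep (cuspedGraph H S) (horoPath S ξ η) 1) ξ η := by
  have up (k : ℕ) (hk : ξ.2 + k ≤ hatHeight S ξ η) : Relation.ReflTransGen
      (ShortStep (cuspedGraph H S) (horoPath S ξ η) 1) ξ (ξ.1, ξ.2 + k) := by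
    induction k with
    | zero => exact .refl
    | succ k ih =>
      exact (ih (by omega)).tail ⟨.inl ⟨rfl, by simp, hk⟩, cusped_dist_vertical hS ξ.1 (ξ.2 + k) 1⟩
  have down (k : ℕ) (hk : η.2 + k ≤ hatHeight S ξ η) : Relation.ReflTransGen
      (ShortStep (cuspedGraph H S) (horoPath S ξ η) 1) (η.1, η.2 + k) η := by
    induction k with
    | zero => exact .refl
    | succ k ih =>
      exact .head (b := (η.1, η.2 + k)) ⟨.inr ⟨rfl, by simp, by simp only; omega⟩,
        cusped_dist_pred hS η.1 (k := η.2 + (k + 1)) (by omega)⟩ (ih (by omega))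
  have hξ := left_le_hatHeight (S := S) ξ η
  have hη := right_le_hatHeight (S := S) ξ η
  have hup := up (hatHeight S ξ η - ξ.2) (by omega)
  have hdown := down (hatHeight S ξ η - η.2) (by omega)
  rw [Nat.add_sub_cancel' hξ] at hup
  rw [Nat.add_sub_cancel' hη] at hdown
  exact (hup.tail (c := (η.1, hatHeight S ξ η)) ⟨.inr ⟨rfl, hη, le_rfl⟩,
    cusped_dist_horizontal h (dist_le_two_pow_of_hatHeight_le le_rfl)⟩).trans hdown

end Cusped

section ThinTriangles

variable {G : Type u} [Group G] {H : Subgroup G} {S : Set G}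

/-- The cone vertex of the coset whose horoball contains the vertex `ξ` of the cusped graph. -/
abbrev coneOf (H : Subgroup G) (ξ : G × ℕ) : G ⊕ (G ⧸ H) :=
  .inr (ξ.1 : G ⧸ H)

open Classical in
/-- The projection of a vertex of the cusped graph to the horoball of the coset `q`. -/
def horoProj (S : Set G) (q : G ⧸ H) (ξ : G × ℕ) : G × ℕ :=
  if (ξ.1 : G ⧸ H) = q then ξ else (coneProj S q (coneOf H ξ), 0)

/-- The vertices of all lifts to the cusped graph of the geodesics between two cone vertices, where
a passage through a cone vertex is lifted to a standard path of the horoball. -/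
def guess (H : Subgroup G) (S : Set G) (ξ η : G × ℕ) : Set (G × ℕ) :=
  {p | (p.2 = 0 ∧ Between (coneDist H S) (coneOf H ξ) (.inl p.1) (coneOf H η)) ∨
    ∃ q : G ⧸ H, Between (coneDist H S) (coneOf H ξ) (.inr q) (coneOf H η) ∧
      p ∈ horoPath S (horoProj S q ξ) (horoProj S q η)}

lemma guess_comm (hS : Subgroup.closure S = ⊤) (ξ η : G × ℕ) : guess H S ξ η = guess H S η ξ := by
  ext p
  simp only [guess, Set.mem_ofPred_eq, horoPath_comm (horoProj S _ ξ),
    (isGeodesicMetric_coneDist H hS).between_comm (u := coneOf H ξ)]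

lemma horoProj_self (ξ : G × ℕ) : horoProj S (ξ.1 : G ⧸ H) ξ = ξ := by simp [horoProj]

lemma horoProj_of_ne {q : G ⧸ H} {ξ : G × ℕ} (h : coneOf H ξ ≠ .inr q) :
    horoProj S q ξ = (coneProj S q (coneOf H ξ), 0) := by
  rw [horoProj, if_neg fun hq => h (congrArg _ hq)]

lemma mk_horoProj (hS : Subgroup.closure S = ⊤) (q : G ⧸ H) (ξ : G × ℕ) :
    ((horoProj S q ξ).1 : G ⧸ H) = q := by
  rw [horoProj]
  split_ifs with h
  · exact h
  · exact (isProj_coneProj hS fun hq => h (Sum.inr_injective hq)).1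

lemma left_mem_guess (hS : Subgroup.closure S = ⊤) (ξ η : G × ℕ) : ξ ∈ guess H S ξ η := by
  have hself := (isGeodesicMetric_coneDist H hS).self (coneOf H ξ)
  have hmem := left_mem_horoPath (S := S) (horoProj S (ξ.1 : G ⧸ H) ξ) (horoProj S (ξ.1 : G ⧸ H) η)
  rw [horoProj_self] at hmem
  exact .inr ⟨ξ.1, by rw [Between, hself, zero_add], by rwa [horoProj_self]⟩

lemma right_mem_guess (hS : Subgroup.closure S = ⊤) (ξ η : G × ℕ) : η ∈ guess H S ξ η :=
  guess_comm (H := H) hS ξ η ▸ left_mem_guess hS η ξ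

lemma cusped_dist_isProj_coneProj_le {K κ : ℕ} (hF : IsFineHyperbolic H S K κ) {q : G ⧸ H}
    {u : G ⊕ (G ⧸ H)} {a : G} (ha : IsProj S q u a) :
    (cuspedGraph H S).dist (a, 0) (coneProj S q u, 0) ≤ 2 * κ + 1 :=
  cusped_dist_coset hF.closure_eq
    (ha.1.trans (isProj_coneProj hF.closure_eq (ha.ne hF.closure_eq)).1.symm)
    (hF.dist_isProj_le ha)

namespace IsFineHyperbolic

variable {K κ : ℕ} {ξ η ζ p : G × ℕ} {q : G ⧸ H} {g : G}

lemma cusped_dist_triangle (hF : IsFineHyperbolic H S K κ) (ξ ζ η : G × ℕ) :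
    (cuspedGraph H S).dist ξ η ≤ (cuspedGraph H S).dist ξ ζ + (cuspedGraph H S).dist ζ η :=
  (cuspedGraph_connected H hF.closure_eq).dist_triangle

lemma exists_cusped_dist_step_le (hF : IsFineHyperbolic H S K κ) {R : ℕ} {e z : G}
    (hR : ∀ q : G ⧸ H, Between (coneDist H S) (.inl g) (.inr q) (.inl e) →
      (mulCayley S).dist (coneProj S q (.inl g)) (coneProj S q (.inl e)) ≤ R)
    (hz : Between (coneDist H S) (.inl g) (.inl z) (.inl e)) (hze : z ≠ e) :
    ∃ z', Between (coneDist H S) (.inl g) (.inl z') (.inl e) ∧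
      coneDist H S (.inl z') (.inl e) < coneDist H S (.inl z) (.inl e) ∧
      (cuspedGraph H S).dist (z, 0) (z', 0) ≤ 2 * (R + 2 * κ) + 1 := by
  have hS := hF.closure_eq
  have hd := hF.isGeodesicMetric
  obtain ⟨v, hadj, -, hsplit⟩ := hd.exists_step (Sum.inl_injective.ne hze)
  have := hd.one_le hadj.ne
  have := hd.triangle (.inl g) (.inl z) v
  have := hd.triangle (.inl g) v (.inl e)
  rcases v with z' | q
  · have : (cuspedGraph H S).dist (z, 0) (z', 0) = 1 :=
      dist_eq_one_iff_adj.2 (.inl ⟨rfl, rfl, hadj⟩)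
    exact ⟨z', by omega, by omega, by omega⟩
  · obtain ⟨v, hadj', -, hsplit'⟩ := hd.exists_step (Sum.inr_ne_inl (a := e) (b := q))
    rcases v with b | q'
    swap
    · exact hadj'.elim
    have hzq : (z : G ⧸ H) = q := hadj
    have hbq : (b : G ⧸ H) = q := hadj'
    have := coneDist_inl_inr hS (S := S) hzq
    have := coneDist_inl_inr hS (S := S) hbq
    have := hd.triangle (.inl g) (.inr q) (.inl b)
    have := hd.triangle (.inl g) (.inl b) (.inl e)
    have := hd.comm (.inl e) (.inl b)
    have := hd.comm (.inl e) (.inr q)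
    have := hd.comm (.inl b) (.inr q)
    have hentry : IsProj S q (.inl g) z := ⟨hzq, by omega⟩
    have hexit : IsProj S q (.inl e) b := ⟨hbq, by omega⟩
    have := hF.dist_isProj_le hentry
    have := hF.dist_isProj_le hexit
    have := hR q (by omega)
    have := hF.dist_triangle z (coneProj S q (.inl g)) b
    have := hF.dist_triangle (coneProj S q (.inl g)) (coneProj S q (.inl e)) b
    have := (mulCayley S).dist_comm (u := b) (v := coneProj S q (.inl e))
    exact ⟨b, by omega, by omega, cusped_dist_coset hS (hzq.trans hbq.symm) (by omega)⟩

lemma cusped_dist_le (hF : IsFineHyperbolic H S K κ) {R : ℕ} {e : G}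
    (hR : ∀ q : G ⧸ H, Between (coneDist H S) (.inl g) (.inr q) (.inl e) →
      (mulCayley S).dist (coneProj S q (.inl g)) (coneProj S q (.inl e)) ≤ R) :
    (cuspedGraph H S).dist (g, 0) (e, 0) ≤
      coneDist H S (.inl g) (.inl e) * (2 * (R + 2 * κ) + 1) := by
  suffices h : ∀ n (z : G), coneDist H S (.inl z) (.inl e) = n →
      Between (coneDist H S) (.inl g) (.inl z) (.inl e) →
      (cuspedGraph H S).dist (z, 0) (e, 0) ≤ n * (2 * (R + 2 * κ) + 1) from
    h _ g rfl (by rw [Between, hF.isGeodesicMetric.self, zero_add])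
  intro n
  induction n using Nat.strong_induction_on with
  | _ n ih =>
  rintro z rfl hz
  by_cases hze : z = e
  · subst hze
    simp
  obtain ⟨z', hz', hlt, hstep⟩ := hF.exists_cusped_dist_step_le hR hz hze
  have := hF.cusped_dist_triangle (z, 0) (z', 0) (e, 0)
  have := ih _ hlt z' rfl hz'
  calc (cuspedGraph H S).dist (z, 0) (e, 0)
      ≤ (coneDist H S (.inl z') (.inl e) + 1) * (2 * (R + 2 * κ) + 1) := by
        rw [add_one_mul]
        omega
    _ ≤ _ := Nat.mul_le_mul_right _ hlt

/-- For a vertex of the other two sides closest to `g`, the cosets strictly closer to `g` are not on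
these sides, so that they see the vertex in the direction of `g`. -/
lemma exists_close_vertex (hF : IsFineHyperbolic H S K κ) {u w : G ⊕ (G ⧸ H)}
    (hg : Between (coneDist H S) u (.inl g) w) (z : G ⊕ (G ⧸ H)) :
    ∃ p', (Between (coneDist H S) u p' z ∨ Between (coneDist H S) z p' w) ∧
      coneDist H S (.inl g) p' ≤ 2 * K + 1 ∧
      ∀ q : G ⧸ H, coneDist H S (.inl g) (.inr q) < coneDist H S (.inl g) p' →
        (mulCayley S).dist (coneProj S q (.inl g)) (coneProj S q p') ≤ 3 * κ := by
  obtain ⟨p₀, hp₀, hdist⟩ := hF.fourPoint.slim hF.isGeodesicMetric hg z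
  obtain ⟨p', hp', hmin⟩ := WellFounded.has_min
    (InvImage.wf (fun p => coneDist H S (.inl g) p) wellFounded_lt)
    {p | Between (coneDist H S) u p z ∨ Between (coneDist H S) z p w} ⟨p₀, hp₀⟩
  exact ⟨p', hp', (not_lt.1 (hmin p₀ hp₀)).trans hdist, fun q hq =>
    hF.dist_coneProj_side_le hg hp' (fun h => hmin _ (.inl h) hq) (fun h => hmin _ (.inr h) hq)⟩

/-- The distance in the cusped graph from an element of a side of a triangle to the guessed paths
of the other two sides. -/
def vertexBound (K κ : ℕ) : ℕ := (2 * K + 1) * (12 * κ + 1) + 4 * κ + 1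

lemma cusped_dist_coneProj_le (hF : IsFineHyperbolic H S K κ)
    (hdist : coneDist H S (.inl g) (.inr q) ≤ 2 * K + 1)
    (hproj : ∀ q' : G ⧸ H, coneDist H S (.inl g) (.inr q') < coneDist H S (.inl g) (.inr q) →
      (mulCayley S).dist (coneProj S q' (.inl g)) (coneProj S q' (.inr q)) ≤ 3 * κ) :
    (cuspedGraph H S).dist (g, 0) (coneProj S q (.inl g), 0) ≤ (2 * K + 1) * (12 * κ + 1) := by
  have hS := hF.closure_eq
  have hd := hF.isGeodesicMetric
  obtain ⟨hmk, hlen⟩ := isProj_coneProj (S := S) hS (Sum.inl_ne_inr (a := g) (b := q))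
  set e := coneProj S q (.inl g)
  refine (hF.cusped_dist_le (R := 4 * κ) fun q' hq' => ?_).trans ?_
  · have := hd.one_le (Sum.inr_ne_inl (a := e) (b := q'))
    have := hd.comm (.inr q') (.inl e)
    have := hproj q' (by omega)
    have hnear := coneDist_inl_inr (S := S) hS hmk
    have hnot : ¬ Between (coneDist H S) (.inl e) (.inr q') (.inr q) := by
      intro hb
      have : (.inr q' : G ⊕ (G ⧸ H)) = .inr q := hd.eq_of_eq_zero (by omega)
      rw [this] at hq'
      omega
    have := hF.dist_coneProj_le hnot
    have := hF.dist_triangle (coneProj S q' (.inl g)) (coneProj S q' (.inr q))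
      (coneProj S q' (.inl e))
    have := (mulCayley S).dist_comm (u := coneProj S q' (.inl e)) (v := coneProj S q' (.inr q))
    omega
  · exact Nat.mul_le_mul (by omega) (by omega)

lemma exists_mem_guess_near_horoball (hF : IsFineHyperbolic H S K κ)
    (hg : Between (coneDist H S) (coneOf H ξ) (.inl g) (coneOf H η))
    (hq : Between (coneDist H S) (coneOf H ξ) (.inr q) (coneOf H ζ))
    (hdist : (cuspedGraph H S).dist (g, 0) (coneProj S q (.inl g), 0) ≤
      (2 * K + 1) * (12 * κ + 1)) :
    ∃ p', (p' ∈ guess H S ξ ζ ∨ p' ∈ guess H S ζ η) ∧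
      (cuspedGraph H S).dist (g, 0) p' ≤ vertexBound K κ := by
  have hmk := (isProj_coneProj (S := S) hF.closure_eq (Sum.inl_ne_inr (a := g) (b := q))).1
  have near (v : G × ℕ) (hv : coneOf H v ≠ .inr q)
      (hle : (mulCayley S).dist (coneProj S q (.inl g)) (coneProj S q (coneOf H v)) ≤ 2 * κ) :
      (cuspedGraph H S).dist (g, 0) (horoProj S q v) ≤ vertexBound K κ := by
    rw [horoProj_of_ne hv, vertexBound]
    have := cusped_dist_coset hF.closure_eq
      (hmk.trans (isProj_coneProj (S := S) hF.closure_eq hv).1.symm) hle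
    have := hF.cusped_dist_triangle (g, 0) (coneProj S q (.inl g), 0)
      (coneProj S q (coneOf H v), 0)
    omega
  rcases hF.dist_coneProj_vertex_le (q := q) hg (coneOf H ζ) with
    ⟨hne, hle⟩ | ⟨hne, hle⟩ | ⟨hq', hne, hle⟩
  · exact ⟨_, .inl (.inr ⟨q, hq, left_mem_horoPath _ _⟩), near ξ hne hle⟩
  · exact ⟨_, .inl (.inr ⟨q, hq, right_mem_horoPath _ _⟩), near ζ hne hle⟩
  · exact ⟨_, .inr (.inr ⟨q, hq', right_mem_horoPath _ _⟩), near η hne hle⟩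

lemma exists_mem_guess_near (hF : IsFineHyperbolic H S K κ) (ζ : G × ℕ)
    (hg : Between (coneDist H S) (coneOf H ξ) (.inl g) (coneOf H η)) :
    ∃ p', (p' ∈ guess H S ξ ζ ∨ p' ∈ guess H S ζ η) ∧
      (cuspedGraph H S).dist (g, 0) p' ≤ vertexBound K κ := by
  have hS := hF.closure_eq
  have hd := hF.isGeodesicMetric
  obtain ⟨g' | q, hside, hdist, hproj⟩ := hF.exists_close_vertex hg (coneOf H ζ)
  · refine ⟨(g', 0), hside.imp (fun h => .inl ⟨rfl, h⟩) (fun h => .inl ⟨rfl, h⟩), ?_⟩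
    refine (hF.cusped_dist_le (R := 3 * κ) fun q hq => hproj q ?_).trans ?_
    · have := hd.one_le (Sum.inr_ne_inl (a := g') (b := q))
      omega
    · have := Nat.mul_le_mul hdist (show 2 * (3 * κ + 2 * κ) + 1 ≤ 12 * κ + 1 by omega)
      unfold vertexBound
      omega
  · have hclose := hF.cusped_dist_coneProj_le hdist hproj
    rcases hside with hq | hq
    · exact hF.exists_mem_guess_near_horoball hg hq hclose
    · obtain ⟨p', hp', hdist'⟩ := hF.exists_mem_guess_near_horoball (hd.between_comm.1 hg)
        (hd.between_comm.1 hq) hclose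
      rw [guess_comm hS η ζ, guess_comm hS ζ ξ] at hp'
      exact ⟨p', hp'.symm, hdist'⟩

/-- The constant with which the paths in `guess` satisfy `IsGuess`. -/
def thinBound (K κ : ℕ) : ℕ := vertexBound K κ + 10 * κ + 10

lemma horoPath_near_horoProj (hF : IsFineHyperbolic H S K κ)
    (h : ¬ Between (coneDist H S) (coneOf H ξ) (.inr q) (coneOf H η))
    (hp : p ∈ horoPath S (horoProj S q ξ) (horoProj S q η)) :
    (cuspedGraph H S).dist p (horoProj S q ξ) ≤ 3 * κ + 1 ∧
      (cuspedGraph H S).dist p (horoProj S q η) ≤ 3 * κ + 1 := by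
  have hS := hF.closure_eq
  obtain ⟨hξ, hη⟩ := hF.isGeodesicMetric.ne_of_not_between h
  have hmk := (mk_horoProj (S := S) hS q ξ).trans (mk_horoProj hS q η).symm
  rw [horoProj_of_ne hξ] at hp hmk ⊢
  rw [horoProj_of_ne hη] at hp hmk ⊢
  exact horoPath_small hS hmk (hF.dist_coneProj_le h) hp

lemma between_coneProj (hF : IsFineHyperbolic H S K κ)
    (hξ : coneOf H ξ ≠ .inr q)
    (hq : Between (coneDist H S) (coneOf H ξ) (.inr q) (coneOf H η)) :
    Between (coneDist H S) (coneOf H ξ) (.inl (coneProj S q (coneOf H ξ))) (coneOf H η) := by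
  have hd := hF.isGeodesicMetric
  obtain ⟨hmk, hlen⟩ := isProj_coneProj (S := S) hF.closure_eq hξ
  have := hd.triangle (coneOf H ξ) (.inl (coneProj S q (coneOf H ξ))) (coneOf H η)
  have := hd.triangle (.inl (coneProj S q (coneOf H ξ))) (.inr q) (coneOf H η)
  have := coneDist_inl_inr (S := S) hF.closure_eq hmk
  omega

lemma guess_thin_of_not_between (hF : IsFineHyperbolic H S K κ)
    (hq : Between (coneDist H S) (coneOf H ξ) (.inr q) (coneOf H η))
    (hξζ : ¬ Between (coneDist H S) (coneOf H ξ) (.inr q) (coneOf H ζ))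
    (hζη : ¬ Between (coneDist H S) (coneOf H ζ) (.inr q) (coneOf H η)) {p' : G × ℕ}
    (hp' : p' ∈ horoPath S (horoProj S q ξ) (horoProj S q ζ) ∨
      p' ∈ horoPath S (horoProj S q ζ) (horoProj S q η))
    (hpp' : (cuspedGraph H S).dist p p' ≤ 2) :
    ∃ p'', (p'' ∈ guess H S ξ ζ ∨ p'' ∈ guess H S ζ η) ∧
      (cuspedGraph H S).dist p p'' ≤ thinBound K κ := by
  have hξ := (hF.isGeodesicMetric.ne_of_not_between hξζ).1
  obtain ⟨p'', hp'', hnear⟩ := hF.exists_mem_guess_near ζ (hF.between_coneProj hξ hq)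
  refine ⟨p'', hp'', ?_⟩
  rw [← horoProj_of_ne hξ] at hnear
  have := hF.cusped_dist_triangle p (horoProj S q ξ) p''
  have := hF.cusped_dist_triangle p p' (horoProj S q ξ)
  unfold thinBound
  rcases hp' with hp' | hp'
  · have := (hF.horoPath_near_horoProj hξζ hp').1
    omega
  · have := (hF.horoPath_near_horoProj hζη hp').1
    have := (hF.horoPath_near_horoProj hξζ (right_mem_horoPath _ _)).1
    have := hF.cusped_dist_triangle p' (horoProj S q ζ) (horoProj S q ξ)
    omega

lemma guess_thin (hF : IsFineHyperbolic H S K κ) (ξ η ζ : G × ℕ) (hp : p ∈ guess H S ξ η) :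
    ∃ p', (p' ∈ guess H S ξ ζ ∨ p' ∈ guess H S ζ η) ∧
      (cuspedGraph H S).dist p p' ≤ thinBound K κ := by
  have hS := hF.closure_eq
  rcases hp with ⟨hlevel, hp⟩ | ⟨q, hq, hp⟩
  · obtain ⟨x, i⟩ := p
    obtain rfl : i = 0 := hlevel
    obtain ⟨p', hp', hdist⟩ := hF.exists_mem_guess_near ζ hp
    exact ⟨p', hp', hdist.trans (by unfold thinBound; omega)⟩
  obtain ⟨p', hp', hpp'⟩ := horoPath_thin (H := H) (ζ := horoProj S q ζ) hS
    (by rw [mk_horoProj hS, mk_horoProj hS]) (by rw [mk_horoProj hS, mk_horoProj hS]) hp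
  have := hF.cusped_dist_triangle p p' (horoProj S q ζ)
  by_cases hξζ : Between (coneDist H S) (coneOf H ξ) (.inr q) (coneOf H ζ)
  · rcases hp' with hp' | hp'
    · exact ⟨p', .inl (.inr ⟨q, hξζ, hp'⟩), by unfold thinBound; omega⟩
    by_cases hζη : Between (coneDist H S) (coneOf H ζ) (.inr q) (coneOf H η)
    · exact ⟨p', .inr (.inr ⟨q, hζη, hp'⟩), by unfold thinBound; omega⟩
    · have := (hF.horoPath_near_horoProj hζη hp').1
      exact ⟨horoProj S q ζ, .inl (.inr ⟨q, hξζ, right_mem_horoPath _ _⟩),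
        by unfold thinBound; omega⟩
  · by_cases hζη : Between (coneDist H S) (coneOf H ζ) (.inr q) (coneOf H η)
    swap
    · exact hF.guess_thin_of_not_between hq hξζ hζη hp' hpp'
    rcases hp' with hp' | hp'
    · have := (hF.horoPath_near_horoProj hξζ hp').2
      exact ⟨horoProj S q ζ, .inr (.inr ⟨q, hζη, left_mem_horoPath _ _⟩),
        by unfold thinBound; omega⟩
    · exact ⟨p', .inr (.inr ⟨q, hζη, hp'⟩), by unfold thinBound; omega⟩

end IsFineHyperbolic

end ThinTriangles

section GuessChains

variable {G : Type u} [Group G] {H : Subgroup G} {S : Set G}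

lemma three_le_coneDist (hS : Subgroup.closure S = ⊤) {a : G} {q : G ⧸ H}
    (h : (a : G ⧸ H) ≠ q) : 3 ≤ coneDist H S (.inl a) (.inr q) := by
  have hd := isGeodesicMetric_coneDist H hS
  have one_le (b : G) (w : (conedOffGraph H S).Walk (.inl b) (.inr q)) :
      1 ≤ walkWeight edgeWeight w :=
    (hd.one_le Sum.inl_ne_inr).trans (weightedDist_le w)
  obtain ⟨w, hw⟩ := exists_walkWeight_eq_weightedDist (conedOffGraph_connected H hS) edgeWeight
    (.inl a) (.inr q)
  rw [coneDist, ← hw]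
  rcases w with _ | @⟨_, b | q', _, hadj, w⟩
  · rw [walkWeight_cons]
    exact Nat.add_le_add_left (one_le b w) 2
  · rcases w with _ | @⟨_, b | q'', _, hadj', w⟩
    · exact absurd hadj h
    · rw [walkWeight_cons, walkWeight_cons]
      exact Nat.add_le_add_left (Nat.add_le_add_left (one_le b w) 1) 1
    · exact hadj'.elim

lemma four_le_coneDist (hS : Subgroup.closure S = ⊤) {q q' : G ⧸ H} (h : q ≠ q') :
    4 ≤ coneDist H S (.inr q) (.inr q') := by
  obtain ⟨a, hmk, hlen⟩ := exists_isProj (S := S) hS (Sum.inr_injective.ne h)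
  have := three_le_coneDist (S := S) hS (a := a) (q := q) (by rw [hmk]; exact h.symm)
  have := (isGeodesicMetric_coneDist H hS).comm (.inr q) (.inl a)
  omega

/-- The point where the lift to the cusped graph of a geodesic starting at `ξ` arrives at the vertex
`v` of the coned-off graph. -/
def arrivalPoint (S : Set G) (ξ : G × ℕ) : G ⊕ (G ⧸ H) → G × ℕ :=
  Sum.elim (fun g => (g, 0)) (fun q => horoProj S q ξ)

namespace IsFineHyperbolic

variable {K κ : ℕ} {ξ η p : G × ℕ} {q : G ⧸ H}

lemma guess_chain_horoPath (hF : IsFineHyperbolic H S K κ)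
    (hq : Between (coneDist H S) (coneOf H ξ) (.inr q) (coneOf H η)) :
    Relation.ReflTransGen (ShortStep (cuspedGraph H S) (guess H S ξ η) (thinBound K κ))
      (horoProj S q ξ) (horoProj S q η) := by
  have hmk := (mk_horoProj (S := S) hF.closure_eq q ξ).trans (mk_horoProj hF.closure_eq q η).symm
  refine Relation.ReflTransGen.mono ?_ _ _ (horoPath_chain hF.closure_eq hmk)
  rintro a b ⟨hmem, hle⟩
  exact ⟨.inr ⟨q, hq, hmem⟩, hle.trans (by unfold thinBound; omega)⟩

lemma guess_chain_step (hF : IsFineHyperbolic H S K κ) {v v' : G ⊕ (G ⧸ H)}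
    (hadj : (conedOffGraph H S).Adj v v') (hv : Between (coneDist H S) (coneOf H ξ) v (coneOf H η))
    (hv' : Between (coneDist H S) (coneOf H ξ) v' v) :
    Relation.ReflTransGen (ShortStep (cuspedGraph H S) (guess H S ξ η) (thinBound K κ))
      (arrivalPoint S ξ v') (arrivalPoint S ξ v) := by
  have hS := hF.closure_eq
  have hd := hF.isGeodesicMetric
  have := hd.triangle v' v (coneOf H η)
  have := hd.triangle (coneOf H ξ) v' (coneOf H η)
  rcases v with g | q <;> rcases v' with g' | q'
  · have := dist_eq_one_iff_adj.2 (show (cuspedGraph H S).Adj (g', 0) (g, 0) from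
      .inl ⟨rfl, rfl, (show (mulCayley S).Adj g g' from hadj).symm⟩)
    exact .single ⟨.inl ⟨rfl, hv⟩, this.le.trans (by unfold thinBound; omega)⟩
  · have := coneDist_inl_inr (S := S) hS hadj
    have := hd.comm (.inl g) (.inr q')
    have := hd.comm (.inl g) (coneOf H η)
    have := hd.comm (.inr q') (coneOf H η)
    have hproj : IsProj S q' (coneOf H η) g := ⟨hadj, by omega⟩
    refine (hF.guess_chain_horoPath (q := q') (by omega)).tail ⟨.inl ⟨rfl, hv⟩, ?_⟩
    rw [horoProj_of_ne (hproj.ne hS), SimpleGraph.dist_comm]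
    exact (cusped_dist_isProj_coneProj_le hF hproj).trans (by unfold thinBound; omega)
  · have := coneDist_inl_inr (S := S) hS hadj
    have hproj : IsProj S q (coneOf H ξ) g' := ⟨hadj, by omega⟩
    refine .single ⟨.inr ⟨q, hv, left_mem_horoPath _ _⟩, ?_⟩
    rw [arrivalPoint, Sum.elim_inl, Sum.elim_inr, horoProj_of_ne (hproj.ne hS)]
    exact (cusped_dist_isProj_coneProj_le hF hproj).trans (by unfold thinBound; omega)
  · exact hadj.elim

lemma guess_chain_arrivalPoint (hF : IsFineHyperbolic H S K κ) {v : G ⊕ (G ⧸ H)}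
    (hv : Between (coneDist H S) (coneOf H ξ) v (coneOf H η)) :
    Relation.ReflTransGen (ShortStep (cuspedGraph H S) (guess H S ξ η) (thinBound K κ))
      ξ (arrivalPoint S ξ v) := by
  have hd := hF.isGeodesicMetric
  induction hn : coneDist H S (coneOf H ξ) v using Nat.strong_induction_on generalizing v with
  | _ n ih =>
  by_cases hvξ : v = coneOf H ξ
  · rw [hvξ, arrivalPoint, Sum.elim_inr, horoProj_self]
  obtain ⟨v', hadj, -, hsplit⟩ := hd.exists_step hvξ
  have := hd.comm v (coneOf H ξ)
  have := hd.comm v' (coneOf H ξ)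
  have := hd.comm v v'
  have := hd.one_le hadj.ne
  have := hd.triangle v' v (coneOf H η)
  have := hd.triangle (coneOf H ξ) v' (coneOf H η)
  exact (ih _ (by omega) (v := v') (by omega) rfl).trans (hF.guess_chain_step hadj hv (by omega))

lemma guess_chain (hF : IsFineHyperbolic H S K κ) (ξ η : G × ℕ) :
    Relation.ReflTransGen (ShortStep (cuspedGraph H S) (guess H S ξ η) (thinBound K κ)) ξ η := by
  have hη : Between (coneDist H S) (coneOf H ξ) (coneOf H η) (coneOf H η) := by
    rw [Between, hF.isGeodesicMetric.self, add_zero]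
  have h := (hF.guess_chain_arrivalPoint hη).trans (hF.guess_chain_horoPath hη)
  rwa [horoProj_self] at h

lemma dist_coneProj_of_adj (hF : IsFineHyperbolic H S K κ) {x y : G}
    (hadj : (mulCayley S).Adj x y) (hxy : (x : G ⧸ H) ≠ (y : G ⧸ H)) :
    (mulCayley S).dist x (coneProj S (x : G ⧸ H) (.inr (y : G ⧸ H))) ≤ 3 * κ := by
  have hS := hF.closure_eq
  have hd := hF.isGeodesicMetric
  have hedge : coneDist H S (.inl x) (.inl y) ≤ 2 :=
    coneDist_le_of_adj (show (conedOffGraph H S).Adj (.inl x) (.inl y) from hadj)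
  have hx := coneDist_inl_inr (S := S) hS (rfl : (x : G ⧸ H) = x)
  have hy := coneDist_inl_inr (S := S) hS (rfl : (y : G ⧸ H) = y)
  have hyx := three_le_coneDist (S := S) hS hxy.symm
  have := hd.comm (.inl y) (.inr (x : G ⧸ H))
  have := hd.self (.inl x)
  have := hF.dist_isProj_le (q := (x : G ⧸ H)) (u := .inl x) (g := x) ⟨rfl, by omega⟩
  have := hF.dist_coneProj_le (q := (x : G ⧸ H)) (u := .inl x) (w := .inl y) (by omega)
  have := hF.dist_coneProj_le (q := (x : G ⧸ H)) (u := .inl y) (w := .inr (y : G ⧸ H)) (by omega)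
  have := hF.dist_triangle x (coneProj S (x : G ⧸ H) (.inl x))
    (coneProj S (x : G ⧸ H) (.inr (y : G ⧸ H)))
  have := hF.dist_triangle (coneProj S (x : G ⧸ H) (.inl x))
    (coneProj S (x : G ⧸ H) (.inl y)) (coneProj S (x : G ⧸ H) (.inr (y : G ⧸ H)))
  omega

end IsFineHyperbolic

end GuessChains

section GuessesOfAdjacentVertices

variable {G : Type u} [Group G] {H : Subgroup G} {S : Set G}

lemma hatHeight_le_of_dist_le_one (hS : Subgroup.closure S = ⊤) {ξ η : G × ℕ}
    (h : (cuspedGraph H S).dist ξ η ≤ 1) :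
    hatHeight S ξ η ≤ ξ.2 + 1 ∧ hatHeight S ξ η ≤ η.2 + 1 := by
  rcases Nat.le_one_iff_eq_zero_or_eq_one.1 h with h | h
  · obtain rfl := ((cuspedGraph_connected H hS).dist_eq_zero_iff).1 h
    simp [hatHeight]
  rcases dist_eq_one_iff_adj.1 h with ⟨hξ, hη, hadj⟩ | ⟨hcol, hlevel⟩ | ⟨hlevel, -, -, hdist⟩
  · simp [hatHeight, hξ, hη, dist_eq_one_iff_adj.2 hadj]
  · simp only [hatHeight, hcol, SimpleGraph.dist_self, Nat.clog_zero_right]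
    omega
  · have := Nat.clog_le_of_le_pow hdist
    simp only [hatHeight]
    omega

lemma horoPath_near_of_dist_le_one (hS : Subgroup.closure S = ⊤) {ξ η p : G × ℕ}
    (h : (cuspedGraph H S).dist ξ η ≤ 1) (hp : p ∈ horoPath S ξ η) :
    (cuspedGraph H S).dist p ξ ≤ 2 := by
  obtain ⟨hξ, hη⟩ := hatHeight_le_of_dist_le_one hS h
  have column (ζ : G × ℕ) (hζ : hatHeight S ξ η ≤ ζ.2 + 1) (k : ℕ) (hk : ζ.2 ≤ k)
      (hk' : k ≤ hatHeight S ξ η) : (cuspedGraph H S).dist (ζ.1, k) ζ ≤ 1 := by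
    obtain ⟨j, rfl⟩ := Nat.exists_eq_add_of_le hk
    have := cusped_dist_vertical (H := H) hS ζ.1 ζ.2 j
    rw [SimpleGraph.dist_comm] at this
    exact this.trans (by omega)
  obtain ⟨g, k⟩ := p
  rcases hp with ⟨hg, hk, hk'⟩ | ⟨hg, hk, hk'⟩ <;> simp only at hg hk hk' <;> subst hg
  · exact (column ξ hξ k hk hk').trans one_le_two
  · have := column η hη k hk hk'
    have := (cuspedGraph_connected H hS).dist_triangle (u := (η.1, k)) (v := η) (w := ξ)
    have := (cuspedGraph H S).dist_comm (u := η) (v := ξ)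
    omega

lemma guess_eq_horoPath (hS : Subgroup.closure S = ⊤) {ξ η : G × ℕ}
    (h : (ξ.1 : G ⧸ H) = (η.1 : G ⧸ H)) : guess H S ξ η = horoPath S ξ η := by
  have hd := isGeodesicMetric_coneDist H hS
  have between_iff (v : G ⊕ (G ⧸ H)) :
      Between (coneDist H S) (coneOf H ξ) v (coneOf H η) ↔ v = coneOf H ξ := by
    have := hd.self (.inr (ξ.1 : G ⧸ H))
    rw [Between, coneOf, coneOf, ← h]
    refine ⟨fun hv => (hd.eq_of_eq_zero (by omega)).symm, ?_⟩
    rintro rfl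
    omega
  have hη : horoProj S (ξ.1 : G ⧸ H) η = η := by rw [h, horoProj_self]
  ext p
  simp only [guess, Set.mem_ofPred_eq, between_iff, Sum.inl_ne_inr, and_false, false_or,
    Sum.inr.injEq, exists_eq_left, horoProj_self, hη]

namespace IsFineHyperbolic

variable {K κ : ℕ} {x y : G} {p : G × ℕ}

lemma cusped_dist_le_of_between_adj (hF : IsFineHyperbolic H S K κ)
    (hadj : (mulCayley S).Adj x y) (hxy : (x : G ⧸ H) ≠ (y : G ⧸ H)) {g : G}
    (hg : Between (coneDist H S) (.inr (x : G ⧸ H)) (.inl g) (.inr (y : G ⧸ H)))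
    (hgx : (g : G ⧸ H) = x) : (cuspedGraph H S).dist (g, 0) (x, 0) ≤ 9 * κ + 1 := by
  have hS := hF.closure_eq
  have hd := hF.isGeodesicMetric
  have := coneDist_inl_inr (S := S) hS hgx
  have := hd.comm (.inl g) (.inr (x : G ⧸ H))
  have := hd.comm (.inl g) (.inr (y : G ⧸ H))
  have := hd.comm (.inr (x : G ⧸ H)) (.inr (y : G ⧸ H))
  have hproj : IsProj S (x : G ⧸ H) (.inr (y : G ⧸ H)) g := ⟨hgx, by omega⟩
  have := hF.dist_coneProj_of_adj hadj hxy
  have := hF.dist_isProj_le hproj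
  have := hF.dist_triangle g (coneProj S (x : G ⧸ H) (.inr (y : G ⧸ H))) x
  have := (mulCayley S).dist_comm (u := x) (v := coneProj S (x : G ⧸ H) (.inr (y : G ⧸ H)))
  have := cusped_dist_coset hS hgx (S := S) (r := 4 * κ) (by omega)
  omega

lemma cusped_dist_le_of_mem_horoPath_adj (hF : IsFineHyperbolic H S K κ)
    (hadj : (mulCayley S).Adj x y) (hxy : (x : G ⧸ H) ≠ (y : G ⧸ H))
    (hp : p ∈ horoPath S (horoProj S (x : G ⧸ H) (x, 0)) (horoProj S (x : G ⧸ H) (y, 0))) :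
    (cuspedGraph H S).dist p (x, 0) ≤ 9 * κ + 1 := by
  have hne : coneOf H (y, 0) ≠ .inr (x : G ⧸ H) := Sum.inr_injective.ne hxy.symm
  rw [horoProj_self (x, 0), horoProj_of_ne hne] at hp
  have := (horoPath_small hF.closure_eq (isProj_coneProj hF.closure_eq hne).1.symm
    (hF.dist_coneProj_of_adj hadj hxy) hp).1
  omega

lemma guess_near_of_adj (hF : IsFineHyperbolic H S K κ)
    (hadj : (mulCayley S).Adj x y) (hxy : (x : G ⧸ H) ≠ (y : G ⧸ H))
    (hp : p ∈ guess H S (x, 0) (y, 0)) :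
    (cuspedGraph H S).dist p (x, 0) ≤ 9 * κ + 1 ∨ (cuspedGraph H S).dist p (y, 0) ≤ 9 * κ + 1 := by
  have hS := hF.closure_eq
  have hd := hF.isGeodesicMetric
  have hclose : coneDist H S (.inr (x : G ⧸ H)) (.inr (y : G ⧸ H)) ≤ 4 := by
    have hedge : coneDist H S (.inl x) (.inl y) ≤ 2 :=
      coneDist_le_of_adj (show (conedOffGraph H S).Adj (.inl x) (.inl y) from hadj)
    have := coneDist_inl_inr (S := S) hS (rfl : (x : G ⧸ H) = x)
    have := coneDist_inl_inr (S := S) hS (rfl : (y : G ⧸ H) = y)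
    have := hd.triangle (.inr (x : G ⧸ H)) (.inl x) (.inr (y : G ⧸ H))
    have := hd.triangle (.inl x) (.inl y) (.inr (y : G ⧸ H))
    have := hd.comm (.inl x) (.inr (x : G ⧸ H))
    omega
  rcases hp with ⟨hlevel, hp⟩ | ⟨q, hq, hp⟩
  · obtain ⟨g, k⟩ := p
    obtain rfl : k = 0 := hlevel
    change Between (coneDist H S) (.inr (x : G ⧸ H)) (.inl g) (.inr (y : G ⧸ H)) at hp
    by_cases hgx : (g : G ⧸ H) = x
    · exact .inl (hF.cusped_dist_le_of_between_adj hadj hxy hp hgx)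
    by_cases hgy : (g : G ⧸ H) = y
    · exact .inr (hF.cusped_dist_le_of_between_adj hadj.symm hxy.symm (hd.between_comm.1 hp) hgy)
    have := three_le_coneDist (S := S) hS hgx
    have := three_le_coneDist (S := S) hS hgy
    have := hd.comm (.inl g) (.inr (x : G ⧸ H))
    omega
  · change Between (coneDist H S) (.inr (x : G ⧸ H)) (.inr q) (.inr (y : G ⧸ H)) at hq
    by_cases hqx : (x : G ⧸ H) = q
    · subst hqx
      exact .inl (hF.cusped_dist_le_of_mem_horoPath_adj hadj hxy hp)
    by_cases hqy : q = (y : G ⧸ H)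
    · subst hqy
      rw [horoPath_comm] at hp
      exact .inr (hF.cusped_dist_le_of_mem_horoPath_adj hadj.symm hxy.symm hp)
    have := four_le_coneDist (S := S) hS hqx
    have := four_le_coneDist (S := S) hS hqy
    omega

lemma guess_dist_le (hF : IsFineHyperbolic H S K κ) (ξ η : G × ℕ)
    (h : (cuspedGraph H S).dist ξ η ≤ 1) (hp : p ∈ guess H S ξ η) :
    (cuspedGraph H S).dist p ξ ≤ thinBound K κ := by
  have hS := hF.closure_eq
  unfold thinBound
  by_cases hcoset : (ξ.1 : G ⧸ H) = (η.1 : G ⧸ H)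
  · rw [guess_eq_horoPath hS hcoset] at hp
    exact (horoPath_near_of_dist_le_one hS h hp).trans (by omega)
  have hadj : (cuspedGraph H S).Adj ξ η := by
    refine dist_eq_one_iff_adj.1 (h.antisymm (Nat.one_le_iff_ne_zero.2 fun hzero => hcoset ?_))
    rw [((cuspedGraph_connected H hS).dist_eq_zero_iff).1 hzero]
  obtain ⟨x, i⟩ := ξ
  obtain ⟨y, j⟩ := η
  rcases hadj with ⟨rfl, rfl, hadj⟩ | ⟨hcol, -⟩ | ⟨-, -, hmk, -⟩
  · have := hF.cusped_dist_triangle p (y, 0) (x, 0)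
    have := (cuspedGraph H S).dist_comm (u := (y, 0)) (v := (x, 0))
    rcases hF.guess_near_of_adj hadj hcoset hp with hx | hy <;> simp only at * <;> omega
  · exact absurd (congrArg _ hcol) hcoset
  · exact absurd hmk hcoset

lemma isGuess (hF : IsFineHyperbolic H S K κ) :
    IsGuess (cuspedGraph H S) (guess H S) (thinBound K κ) where
  left_mem := left_mem_guess hF.closure_eq
  right_mem := right_mem_guess hF.closure_eq
  chain := hF.guess_chain
  dist_le ξ η h _ hp := hF.guess_dist_le ξ η h hp
  thin ξ η ζ _ hp := hF.guess_thin ξ η ζ hp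

theorem exists_cusped_fourPoint (hF : IsFineHyperbolic H S K κ) :
    ∃ δ, FourPoint (cuspedGraph H S).dist δ :=
  hF.isGuess.exists_fourPoint (cuspedGraph_connected H hF.closure_eq)

end IsFineHyperbolic

end GuessesOfAdjacentVertices

/-! ### The distance of cosets -/

section CosetDistance

/-- A `G`-invariant distance function on a `G`-set `V` that is hyperbolic and coarsely geodesic, and
such that the action on pairs of distinct points of bounded distance is proper and cofinite. -/
structure IsProperHyperbolic (G : Type*) [Group G] {V : Type*} [MulAction G V]
    (D : V → V → ℕ) (c : ℕ) : Prop where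
  self : ∀ v, D v v = 0
  comm : ∀ v w, D v w = D w v
  smul : ∀ (g : G) (v w : V), D (g • v) (g • w) = D v w
  fourPoint : ∀ w x y z, x ≠ z → w ≠ y →
    D x z + D w y ≤ max (D x y + D w z) (D y z + D w x) + c
  exists_between : ∀ v w m, 1 ≤ m → m < D v w → ∃ p, p ≠ v ∧ p ≠ w ∧ D v p ≤ m ∧ D p w + m ≤ D v w
  finite_inter : ∀ v w n, v ≠ w → {p | D v p ≤ n ∧ D w p ≤ n}.Finite
  finite_stabilizer : ∀ v w : V, v ≠ w → {g : G | g • v = v ∧ g • w = w}.Finite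
  cofinite : ∀ n, ∃ T : Set (V × V), T.Finite ∧ ∀ v w, D v w ≤ n → ∃ g : G, (g • v, g • w) ∈ T

variable {G : Type u} [Group G] {H : Subgroup G} {S : Set G}

/-- Left translation by `g` as an automorphism of the cusped graph. -/
def cuspedIso (H : Subgroup G) (S : Set G) (g : G) : cuspedGraph H S ≃g cuspedGraph H S where
  toEquiv := (Equiv.mulLeft g).prodCongr (.refl ℕ)
  map_rel_iff' {ξ η} := by
    have hcoset : ((g * ξ.1 : G) : G ⧸ H) = ((g * η.1 : G) : G ⧸ H) ↔
        (ξ.1 : G ⧸ H) = (η.1 : G ⧸ H) := by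
      simp only [QuotientGroup.eq, mul_inv_rev, mul_assoc, inv_mul_cancel_left]
    have hadj : (mulCayley S).Adj (g * ξ.1) (g * η.1) ↔ (mulCayley S).Adj ξ.1 η.1 :=
      (mulCayleyIso S g).map_adj_iff
    simp only [cuspedGraph, Equiv.prodCongr_apply, Prod.map, Equiv.coe_mulLeft, Equiv.refl_apply,
      hcoset, hadj, mul_right_inj, ne_eq, mulCayley_dist_mul_left]

lemma cusped_dist_mul_left (g x y : G) : (cuspedGraph H S).dist (g * x, 0) (g * y, 0) =
    (cuspedGraph H S).dist (x, 0) (y, 0) :=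
  dist_map_iso (cuspedIso H S g) (x, 0) (y, 0)

lemma level_le_of_adj {ξ η : G × ℕ} (h : (cuspedGraph H S).Adj ξ η) : η.2 ≤ ξ.2 + 1 := by
  rcases h with ⟨hξ, hη, -⟩ | ⟨-, hlevel⟩ | ⟨hlevel, -⟩ <;> omega

lemma level_le_add_dist (hS : Subgroup.closure S = ⊤) (ξ η : G × ℕ) :
    η.2 ≤ ξ.2 + (cuspedGraph H S).dist ξ η := by
  obtain ⟨p, hp⟩ := (cuspedGraph_connected H hS).exists_walk_length_eq_dist ξ η
  rw [← hp]
  clear hp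
  induction p with
  | nil => simp
  | cons h p ih =>
    have := level_le_of_adj h
    rw [Walk.length_cons]
    omega

lemma cayley_dist_le_of_adj {ξ η : G × ℕ} (h : (cuspedGraph H S).Adj ξ η) :
    (mulCayley S).dist ξ.1 η.1 ≤ 2 ^ ξ.2 := by
  rcases h with ⟨-, -, hadj⟩ | ⟨hcol, -⟩ | ⟨-, -, -, hdist⟩
  · rw [dist_eq_one_iff_adj.2 hadj]
    exact Nat.one_le_two_pow
  · simp [hcol]
  · exact hdist

lemma cayley_dist_le (hS : Subgroup.closure S = ⊤) (ξ η : G × ℕ) :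
    (mulCayley S).dist ξ.1 η.1 ≤
      (cuspedGraph H S).dist ξ η * 2 ^ (ξ.2 + (cuspedGraph H S).dist ξ η) := by
  obtain ⟨p, hp⟩ := (cuspedGraph_connected H hS).exists_walk_length_eq_dist ξ η
  rw [← hp]
  clear hp
  induction p with
  | nil => simp
  | @cons a b c h p ih =>
    have hlevel := level_le_of_adj h
    rw [Walk.length_cons]
    calc (mulCayley S).dist a.1 c.1
        ≤ (mulCayley S).dist a.1 b.1 + (mulCayley S).dist b.1 c.1 :=
          (mulCayley_connected hS).dist_triangle
      _ ≤ 2 ^ a.2 + p.length * 2 ^ (b.2 + p.length) := add_le_add (cayley_dist_le_of_adj h) ih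
      _ ≤ 2 ^ (a.2 + (p.length + 1)) + p.length * 2 ^ (a.2 + (p.length + 1)) :=
          add_le_add (Nat.pow_le_pow_right two_pos (by omega))
            (Nat.mul_le_mul_left _ (Nat.pow_le_pow_right two_pos (by omega)))
      _ = (p.length + 1) * 2 ^ (a.2 + (p.length + 1)) := by ring

lemma finite_cayley_ball (hS : Subgroup.closure S = ⊤) (hfin : S.Finite) (n : ℕ) :
    {g : G | (mulCayley S).dist 1 g ≤ n}.Finite := by
  induction n with
  | zero =>
    refine (Set.finite_singleton (1 : G)).subset fun g hg => ?_
    exact ((mulCayley_connected hS).dist_eq_zero_iff.1 (Nat.le_zero.1 hg)).symm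
  | succ n ih =>
    refine (ih.union (ih.image2 (· * ·) (hfin.union hfin.inv))).subset fun g hg => ?_
    by_cases hn : (mulCayley S).dist 1 g ≤ n
    · exact .inl hn
    have hdist : (mulCayley S).dist 1 g = n + 1 := le_antisymm hg (by omega)
    obtain ⟨α, hα, hα0, hα1⟩ := exists_isGeodesicSeq (mulCayley_connected hS) 1 g
    rw [hdist] at hα hα1
    have hinit := hα 0 n (by omega) (by omega)
    have hlast := hα n (n + 1) (by omega) le_rfl
    rw [hα0] at hinit
    rw [hα1] at hlast
    have hadj : (mulCayley S).Adj (α n) g := dist_eq_one_iff_adj.1 (by omega)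
    refine .inr ⟨α n, by simp only [Set.mem_ofPred_eq]; omega, (α n)⁻¹ * g, ?_, by simp⟩
    exact ((mulCayley_adj ..).1 hadj).2.imp id fun h => by simpa using h

lemma finite_cusped_ball (hS : Subgroup.closure S = ⊤) (hfin : S.Finite) (n : ℕ) :
    {g : G | (cuspedGraph H S).dist (1, 0) (g, 0) ≤ n}.Finite := by
  refine (finite_cayley_ball hS hfin (n * 2 ^ n)).subset fun g hg => ?_
  have hle := cayley_dist_le (H := H) hS (1, 0) (g, 0)
  rw [zero_add] at hle
  exact hle.trans (Nat.mul_le_mul hg (Nat.pow_le_pow_right two_pos hg))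

/-- A path that leaves a horoball passes through its level `0`. -/
lemma exists_exit (hS : Subgroup.closure S = ⊤) {ξ η : G × ℕ}
    (h : (ξ.1 : G ⧸ H) ≠ (η.1 : G ⧸ H)) : ∃ x : G, (x : G ⧸ H) = (ξ.1 : G ⧸ H) ∧
      (cuspedGraph H S).dist ξ (x, 0) + (cuspedGraph H S).dist (x, 0) η ≤
        (cuspedGraph H S).dist ξ η := by
  obtain ⟨p, hp⟩ := (cuspedGraph_connected H hS).exists_walk_length_eq_dist ξ η
  rw [← hp]
  clear hp
  induction p with
  | nil => exact absurd rfl h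
  | @cons a b c hab p ih =>
    rw [Walk.length_cons]
    by_cases hb : (a.1 : G ⧸ H) = (b.1 : G ⧸ H)
    · obtain ⟨x, hx, hle⟩ := ih (hb ▸ h)
      have := (cuspedGraph_connected H hS).dist_triangle (u := a) (v := b) (w := (x, 0))
      have := dist_eq_one_iff_adj.2 hab
      exact ⟨x, hx.trans hb.symm, by omega⟩
    · have ha : a.2 = 0 := by
        rcases hab with ⟨ha, -⟩ | ⟨hcol, -⟩ | ⟨-, -, hcoset, -⟩
        · exact ha
        · exact absurd (congrArg _ hcol) hb
        · exact absurd hcoset hb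
      refine ⟨a.1, rfl, ?_⟩
      rw [← ha, Prod.mk.eta, SimpleGraph.dist_self, zero_add]
      exact dist_le (Walk.cons hab p)

/-- The distance of two left cosets in the cusped graph. -/
def cosetDist (H : Subgroup G) (S : Set G) (q q' : G ⧸ H) : ℕ :=
  sInf {n | ∃ x y : G, (x : G ⧸ H) = q ∧ (y : G ⧸ H) = q' ∧
    (cuspedGraph H S).dist (x, 0) (y, 0) = n}

lemma exists_cosetDist (q q' : G ⧸ H) : ∃ x y : G, (x : G ⧸ H) = q ∧ (y : G ⧸ H) = q' ∧
    (cuspedGraph H S).dist (x, 0) (y, 0) = cosetDist H S q q' :=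
  Nat.sInf_mem (s := {n | ∃ x y : G, (x : G ⧸ H) = q ∧ (y : G ⧸ H) = q' ∧
    (cuspedGraph H S).dist (x, 0) (y, 0) = n}) ⟨_, q.out, q'.out, by simp, by simp, rfl⟩

lemma cosetDist_le (x y : G) :
    cosetDist H S (x : G ⧸ H) (y : G ⧸ H) ≤ (cuspedGraph H S).dist (x, 0) (y, 0) :=
  Nat.sInf_le ⟨x, y, rfl, rfl, rfl⟩

lemma cosetDist_self (q : G ⧸ H) : cosetDist H S q q = 0 := by
  obtain ⟨x, rfl⟩ := QuotientGroup.mk_surjective q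
  simpa using cosetDist_le (H := H) (S := S) x x

lemma cosetDist_comm (q q' : G ⧸ H) : cosetDist H S q q' = cosetDist H S q' q := by
  have le_swap (q q' : G ⧸ H) : cosetDist H S q q' ≤ cosetDist H S q' q := by
    obtain ⟨x, y, rfl, rfl, h⟩ := exists_cosetDist (S := S) q' q
    rw [← h, SimpleGraph.dist_comm]
    exact cosetDist_le y x
  exact (le_swap q q').antisymm (le_swap q' q)

lemma cosetDist_smul (g : G) (q q' : G ⧸ H) :
    cosetDist H S (g • q) (g • q') = cosetDist H S q q' := by
  have smul_le (g : G) (q q' : G ⧸ H) : cosetDist H S (g • q) (g • q') ≤ cosetDist H S q q' := by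
    obtain ⟨x, y, rfl, rfl, h⟩ := exists_cosetDist (S := S) q q'
    rw [← h, ← cusped_dist_mul_left g x y]
    exact cosetDist_le (g * x) (g * y)
  refine (smul_le g q q').antisymm ?_
  simpa using smul_le g⁻¹ (g • q) (g • q')

lemma add_cosetDist_le (hS : Subgroup.closure S = ⊤) {ξ η : G × ℕ}
    (h : (ξ.1 : G ⧸ H) ≠ (η.1 : G ⧸ H)) :
    ξ.2 + cosetDist H S ξ.1 η.1 + η.2 ≤ (cuspedGraph H S).dist ξ η := by
  obtain ⟨x, hx, hξ⟩ := exists_exit (S := S) hS h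
  obtain ⟨y, hy, hη⟩ := exists_exit (S := S) hS (ξ := η) (η := (x, 0))
    (fun e => h (hx.symm.trans e.symm))
  have hcoset := cosetDist_le (H := H) (S := S) x y
  rw [hx, hy] at hcoset
  have hξlevel := level_le_add_dist (H := H) hS (x, 0) ξ
  have hηlevel := level_le_add_dist (H := H) hS (y, 0) η
  have := (cuspedGraph H S).dist_comm (u := (x, 0)) (v := ξ)
  have := (cuspedGraph H S).dist_comm (u := (y, 0)) (v := η)
  have := (cuspedGraph H S).dist_comm (u := (x, 0)) (v := η)
  have := (cuspedGraph H S).dist_comm (u := (x, 0)) (v := (y, 0))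
  simp only at hξlevel hηlevel
  omega

lemma dist_high_le (hS : Subgroup.closure S = ⊤) {x y : G} (hxy : (x : G ⧸ H) = (y : G ⧸ H))
    {t : ℕ} (h : (mulCayley S).dist x y ≤ t) : (cuspedGraph H S).dist (x, t) (y, 0) ≤ t + 1 := by
  have := cusped_dist_horizontal hxy (h.trans Nat.lt_two_pow_self.le)
  have hdown := cusped_dist_vertical (H := H) hS y 0 t
  rw [zero_add] at hdown
  have := (cuspedGraph_connected H hS).dist_triangle (u := (x, t)) (v := (y, t)) (w := (y, 0))
  have := (cuspedGraph H S).dist_comm (u := (y, 0)) (v := (y, t))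
  omega

lemma eventually_dist_high_le (hS : Subgroup.closure S = ⊤) (x y : G) : ∀ᶠ t in Filter.atTop,
    (cuspedGraph H S).dist (x, t) (y, t) ≤ 2 * t + cosetDist H S x y + 2 := by
  obtain ⟨x', y', hx, hy, h⟩ := exists_cosetDist (S := S) (x : G ⧸ H) (y : G ⧸ H)
  filter_upwards [Filter.eventually_ge_atTop ((mulCayley S).dist x x'),
    Filter.eventually_ge_atTop ((mulCayley S).dist y y')] with t htx hty
  have := dist_high_le hS hx.symm htx
  have := dist_high_le hS hy.symm hty
  have hX := cuspedGraph_connected H hS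
  have := hX.dist_triangle (u := (x, t)) (v := (x', 0)) (w := (y, t))
  have := hX.dist_triangle (u := (x', 0)) (v := (y', 0)) (w := (y, t))
  have := (cuspedGraph H S).dist_comm (u := (y', 0)) (v := (y, t))
  omega

/-- Up to a bounded error, `cosetDist H S x y + 2 * t` is the distance of `(x, t)` and `(y, t)` for
large `t`, so the four-point condition passes to the limit. -/
lemma cosetDist_fourPoint (hS : Subgroup.closure S = ⊤) {δ : ℕ}
    (hδ : FourPoint (cuspedGraph H S).dist δ) {w x y z : G ⧸ H} (hxz : x ≠ z) (hwy : w ≠ y) :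
    cosetDist H S x z + cosetDist H S w y ≤
      max (cosetDist H S x y + cosetDist H S w z) (cosetDist H S y z + cosetDist H S w x) +
        (δ + 4) := by
  obtain ⟨w, rfl⟩ := QuotientGroup.mk_surjective w
  obtain ⟨x, rfl⟩ := QuotientGroup.mk_surjective x
  obtain ⟨y, rfl⟩ := QuotientGroup.mk_surjective y
  obtain ⟨z, rfl⟩ := QuotientGroup.mk_surjective z
  obtain ⟨t, hxyt, hwzt, hyzt, hwxt⟩ := ((eventually_dist_high_le (H := H) hS x y).and
    ((eventually_dist_high_le (H := H) hS w z).and ((eventually_dist_high_le (H := H) hS y z).and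
      (eventually_dist_high_le (H := H) hS w x)))).exists
  have hxzt := add_cosetDist_le (S := S) hS (ξ := (x, t)) (η := (z, t)) hxz
  have hwyt := add_cosetDist_le (S := S) hS (ξ := (w, t)) (η := (y, t)) hwy
  have := hδ (w, t) (x, t) (y, t) (z, t)
  simp only at hxzt hwyt
  omega

lemma exists_between_cosetDist (hS : Subgroup.closure S = ⊤) {q q' : G ⧸ H} {m : ℕ} (hm : 1 ≤ m)
    (hlt : m < cosetDist H S q q') : ∃ p, p ≠ q ∧ p ≠ q' ∧ cosetDist H S q p ≤ m ∧
      cosetDist H S p q' + m ≤ cosetDist H S q q' := by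
  obtain ⟨x, y, rfl, rfl, h⟩ := exists_cosetDist (S := S) q q'
  obtain ⟨α, hα, hα0, hα1⟩ := exists_isGeodesicSeq (cuspedGraph_connected H hS) (x, 0) (y, 0)
  rw [h] at hα hα1
  obtain ⟨ζ, hζ⟩ : ∃ ζ, ζ = α m := ⟨_, rfl⟩
  have hinit := hα 0 m (by omega) hlt.le
  have hfinal := hα m _ hlt.le le_rfl
  rw [hα0, ← hζ] at hinit
  rw [hα1, ← hζ] at hfinal
  have hleft (hne : (ζ.1 : G ⧸ H) ≠ x) : cosetDist H S (x : G ⧸ H) (ζ.1 : G ⧸ H) ≤ m := by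
    have := add_cosetDist_le (S := S) hS (ξ := (x, 0)) (η := ζ) hne.symm
    simp only at this
    omega
  have hright (hne : (ζ.1 : G ⧸ H) ≠ y) :
      cosetDist H S (ζ.1 : G ⧸ H) (y : G ⧸ H) + m ≤ cosetDist H S x y := by
    have := add_cosetDist_le (S := S) hS (ξ := ζ) (η := (y, 0)) hne
    simp only at this
    omega
  have hxy : (x : G ⧸ H) ≠ (y : G ⧸ H) := fun he => by
    rw [he, cosetDist_self] at hlt
    omega
  have hζx : (ζ.1 : G ⧸ H) ≠ (x : G ⧸ H) := fun he => by
    have := hright (he ▸ hxy)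
    rw [he] at this
    omega
  have hζy : (ζ.1 : G ⧸ H) ≠ (y : G ⧸ H) := fun he => by
    have := hleft hζx
    rw [he] at this
    omega
  exact ⟨ζ.1, hζx, hζy, hleft hζx, hright hζy⟩

/-- A coset `z` close to two distinct cosets contains an element close to a fixed element of one of
them: otherwise `(z, t)` would lie far from the geodesic from `(x, t)` to `(y, t)`. -/
lemma exists_dist_le_of_cosetDist_le (hS : Subgroup.closure S = ⊤) {δ : ℕ}
    (hδ : FourPoint (cuspedGraph H S).dist δ) {x y z : G} {n : ℕ}
    (hxy : (x : G ⧸ H) ≠ (y : G ⧸ H)) (hzx : (z : G ⧸ H) ≠ (x : G ⧸ H))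
    (hx : cosetDist H S x z ≤ n) (hy : cosetDist H S y z ≤ n) :
    ∃ z' : G, (z' : G ⧸ H) = z ∧ (cuspedGraph H S).dist (x, 0) (z', 0) ≤
      (cuspedGraph H S).dist (x, 0) (y, 0) + n + 2 + δ := by
  obtain ⟨t, hxzt, hyzt⟩ := ((eventually_dist_high_le (H := H) hS x z).and
    (eventually_dist_high_le (H := H) hS y z)).exists
  have hxyt := add_cosetDist_le (S := S) hS (ξ := (x, t)) (η := (y, t)) hxy
  have hxup := cusped_dist_vertical (H := H) hS x 0 t
  have hyup := cusped_dist_vertical (H := H) hS y 0 t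
  obtain ⟨z', hz', hexit⟩ := exists_exit (S := S) hS (ξ := (z, t)) (η := (x, 0)) hzx
  have hlevel := level_le_add_dist (H := H) hS (z', 0) (z, t)
  have := (cuspedGraph_connected H hS).dist_triangle (u := (x, 0)) (v := (y, 0)) (w := (y, t))
  have := hδ (x, t) (x, 0) (y, t) (z, t)
  have := (cuspedGraph H S).dist_comm (u := (z', 0)) (v := (z, t))
  have := (cuspedGraph H S).dist_comm (u := (x, 0)) (v := (z, t))
  have := (cuspedGraph H S).dist_comm (u := (x, 0)) (v := (x, t))
  have := (cuspedGraph H S).dist_comm (u := (x, 0)) (v := (z', 0))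
  simp only [zero_add] at hxyt hxup hyup hlevel
  exact ⟨z', hz', by omega⟩

lemma finite_setOf_cosetDist_le (hS : Subgroup.closure S = ⊤) (hfin : S.Finite) {δ : ℕ}
    (hδ : FourPoint (cuspedGraph H S).dist δ) {q q' : G ⧸ H} (n : ℕ) (hne : q ≠ q') :
    {p | cosetDist H S q p ≤ n ∧ cosetDist H S q' p ≤ n}.Finite := by
  obtain ⟨x, rfl⟩ := QuotientGroup.mk_surjective q
  obtain ⟨y, rfl⟩ := QuotientGroup.mk_surjective q'
  have hball := (finite_cusped_ball (H := H) hS hfin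
    ((cuspedGraph H S).dist (x, 0) (y, 0) + n + 2 + δ)).image fun g => ((x * g : G) : G ⧸ H)
  refine (hball.insert (x : G ⧸ H)).subset ?_
  rintro p ⟨hxp, hyp⟩
  obtain ⟨z, rfl⟩ := QuotientGroup.mk_surjective p
  by_cases hzx : (z : G ⧸ H) = (x : G ⧸ H)
  · exact .inl hzx
  obtain ⟨z', hz', hle⟩ := exists_dist_le_of_cosetDist_le hS hδ hne hzx hxp hyp
  refine .inr ⟨x⁻¹ * z', ?_, by simpa using hz'⟩
  rwa [← cusped_dist_mul_left x⁻¹ x z', inv_mul_cancel] at hle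

/-- An element that stabilizes two cosets almost fixes the geodesic between them. -/
lemma dist_mul_le_of_smul_eq (hS : Subgroup.closure S = ⊤) {δ : ℕ}
    (hδ : FourPoint (cuspedGraph H S).dist δ) {x y g : G}
    (hxy : (x : G ⧸ H) ≠ (y : G ⧸ H))
    (hmin : (cuspedGraph H S).dist (x, 0) (y, 0) = cosetDist H S x y)
    (hgx : g • (x : G ⧸ H) = x) (hgy : g • (y : G ⧸ H) = y) :
    (cuspedGraph H S).dist (x, 0) (g * x, 0) ≤ δ + 1 := by
  have hX := cuspedGraph_connected H hS
  obtain ⟨t, ht⟩ : ∃ t, t = (mulCayley S).dist x (g * x) + (mulCayley S).dist y (g * y) :=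
    ⟨_, rfl⟩
  have hxyt := add_cosetDist_le (S := S) hS (ξ := (x, t)) (η := (y, t)) hxy
  have hxup := cusped_dist_vertical (H := H) hS x 0 t
  have hyup := cusped_dist_vertical (H := H) hS y 0 t
  have := dist_high_le (H := H) hS (x := x) (y := g * x) (t := t) hgx.symm (by omega)
  have := dist_high_le (H := H) hS (x := y) (y := g * y) (t := t) hgy.symm (by omega)
  have := hX.dist_triangle (u := (x, 0)) (v := (y, 0)) (w := (y, t))
  have := hX.dist_triangle (u := (g * x, 0)) (v := (g * y, 0)) (w := (y, t))
  have := cusped_dist_mul_left (H := H) (S := S) g x y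
  have := hδ (x, t) (x, 0) (y, t) (g * x, 0)
  have := (cuspedGraph H S).dist_comm (u := (x, 0)) (v := (x, t))
  have := (cuspedGraph H S).dist_comm (u := (g * x, 0)) (v := (x, t))
  have := (cuspedGraph H S).dist_comm (u := (g * y, 0)) (v := (y, t))
  have := (cuspedGraph H S).dist_comm (u := (g * x, 0)) (v := (y, t))
  simp only [zero_add] at hxyt hxup hyup
  omega

lemma finite_stabilizer_of_ne (hS : Subgroup.closure S = ⊤) (hfin : S.Finite) {δ : ℕ}
    (hδ : FourPoint (cuspedGraph H S).dist δ) {q q' : G ⧸ H} (hne : q ≠ q') :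
    {g : G | g • q = q ∧ g • q' = q'}.Finite := by
  obtain ⟨x, y, rfl, rfl, hmin⟩ := exists_cosetDist (S := S) q q'
  refine ((finite_cusped_ball (H := H) hS hfin (δ + 1)).image fun g => x * g * x⁻¹).subset ?_
  rintro g ⟨hgx, hgy⟩
  have hle := dist_mul_le_of_smul_eq hS hδ hne hmin hgx hgy
  refine ⟨x⁻¹ * (g * x), ?_, by simp [mul_assoc]⟩
  rwa [← cusped_dist_mul_left x⁻¹ x (g * x), inv_mul_cancel] at hle

lemma exists_finite_cosetDist_le (hS : Subgroup.closure S = ⊤) (hfin : S.Finite) (n : ℕ) :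
    ∃ T : Set ((G ⧸ H) × (G ⧸ H)), T.Finite ∧
      ∀ q q', cosetDist H S q q' ≤ n → ∃ g : G, (g • q, g • q') ∈ T := by
  refine ⟨(fun g : G => (((1 : G) : G ⧸ H), (g : G ⧸ H))) ''
    {g : G | (cuspedGraph H S).dist (1, 0) (g, 0) ≤ n},
    (finite_cusped_ball hS hfin n).image _, fun q q' hle => ?_⟩
  obtain ⟨x, y, rfl, rfl, hmin⟩ := exists_cosetDist (S := S) q q'
  refine ⟨x⁻¹, x⁻¹ * y, ?_, ?_⟩
  · rwa [← hmin, ← cusped_dist_mul_left x⁻¹ x y, inv_mul_cancel] at hle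
  · change _ = (((x⁻¹ * x : G) : G ⧸ H), ((x⁻¹ * y : G) : G ⧸ H))
    rw [inv_mul_cancel]

theorem isProperHyperbolic_cosetDist (hS : Subgroup.closure S = ⊤) (hfin : S.Finite) {δ : ℕ}
    (hδ : FourPoint (cuspedGraph H S).dist δ) :
    IsProperHyperbolic G (cosetDist H S) (δ + 4) where
  self := cosetDist_self
  comm := cosetDist_comm
  smul := cosetDist_smul
  fourPoint _ _ _ _ := cosetDist_fourPoint hS hδ
  exists_between _ _ _ := exists_between_cosetDist hS
  finite_inter _ _ := finite_setOf_cosetDist_le hS hfin hδ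
  finite_stabilizer _ _ := finite_stabilizer_of_ne hS hfin hδ
  cofinite := exists_finite_cosetDist_le hS hfin

end CosetDistance

/-! ### Contractions in the exterior algebra -/

section Exterior

open ExteriorAlgebra

variable {R M V : Type*} [CommRing R] [AddCommGroup M] [Module R M]

/-- The contraction of the exterior algebra by a linear functional `d`. If `M` is free on the
vertices of a simplicial complex and `d` sends every vertex to `1`, then this is the boundary map
of oriented simplicial chains. -/
def contract (d : Module.Dual R M) : ExteriorAlgebra R M →ₗ[R] ExteriorAlgebra R M :=
  CliffordAlgebra.contractLeft d

lemma contract_ι_mul (d : Module.Dual R M) (a : M) (x : ExteriorAlgebra R M) :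
    contract d (ι R a * x) = d a • x - ι R a * contract d x :=
  CliffordAlgebra.contractLeft_ι_mul d a x

lemma contract_one (d : Module.Dual R M) : contract d 1 = 0 :=
  CliffordAlgebra.contractLeft_one _ d

lemma contract_algebraMap (d : Module.Dual R M) (r : R) : contract d (algebraMap R _ r) = 0 :=
  CliffordAlgebra.contractLeft_algebraMap _ d r

lemma contract_ι (d : Module.Dual R M) (a : M) : contract d (ι R a) = algebraMap R _ (d a) :=
  CliffordAlgebra.contractLeft_ι (0 : QuadraticForm R M) d a

lemma contract_contract (d : Module.Dual R M) (x : ExteriorAlgebra R M) :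
    contract d (contract d x) = 0 :=
  CliffordAlgebra.contractLeft_contractLeft d x

lemma contract_comm (d d' : Module.Dual R M) (x : ExteriorAlgebra R M) :
    contract d (contract d' x) = -contract d' (contract d x) :=
  CliffordAlgebra.contractLeft_comm d d' x

lemma contract_map (d : Module.Dual R M) (f : M →ₗ[R] M) (x : ExteriorAlgebra R M) :
    contract d (ExteriorAlgebra.map f x) = ExteriorAlgebra.map f (contract (d ∘ₗ f) x) := by
  induction x using CliffordAlgebra.left_induction with
  | algebraMap r => rw [AlgHom.commutes, contract_algebraMap, contract_algebraMap, map_zero]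
  | add x y hx hy => simp only [map_add, hx, hy]
  | ι_mul x m hx =>
    change contract d (ExteriorAlgebra.map f (ι R m * x)) =
      ExteriorAlgebra.map f (contract (d ∘ₗ f) (ι R m * x))
    rw [map_mul, map_apply_ι, contract_ι_mul, contract_ι_mul, hx, map_sub, map_mul, map_smul,
      map_apply_ι, LinearMap.comp_apply]

variable (b : Module.Basis V R M)

/-- The exterior product of the basis vectors in a list: the oriented simplex that is spanned by
the list. -/
def wedge (l : List V) : ExteriorAlgebra R M := (l.map fun v => ι R (b v)).prod

lemma wedge_nil : wedge b [] = 1 := rfl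

lemma wedge_cons (v : V) (l : List V) : wedge b (v :: l) = ι R (b v) * wedge b l := by
  rw [wedge, List.map_cons, List.prod_cons, wedge]

lemma wedge_singleton (v : V) : wedge b [v] = ι R (b v) := by
  rw [wedge_cons, wedge_nil, mul_one]

lemma contract_wedge_mem (d : Module.Dual R M) (l : List V) :
    contract d (wedge b l) ∈
      Submodule.span R (wedge b '' {l' | l' ⊆ l ∧ l'.length + 1 = l.length}) := by
  induction l with
  | nil => rw [wedge_nil, contract_one]; exact zero_mem _
  | cons v l ih =>
    have hface : Submodule.span R (wedge b '' {l' | l' ⊆ l ∧ l'.length + 1 = l.length}) ≤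
        (Submodule.span R (wedge b '' {l' | l' ⊆ v :: l ∧
          l'.length + 1 = (v :: l).length})).comap (LinearMap.mulLeft R (ι R (b v))) := by
      rw [Submodule.span_le]
      rintro _ ⟨l', ⟨hsub, hlen⟩, rfl⟩
      refine Submodule.subset_span
        ⟨v :: l', ⟨List.cons_subset_cons v hsub, by simp [hlen]⟩, ?_⟩
      rw [wedge_cons, LinearMap.mulLeft_apply]
    rw [wedge_cons, contract_ι_mul]
    exact sub_mem (Submodule.smul_mem _ _ (Submodule.subset_span ⟨l, by simp, rfl⟩)) (hface ih)

lemma contract_coord_wedge_of_notMem {u : V} {l : List V} (hu : u ∉ l) :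
    contract (b.coord u) (wedge b l) = 0 := by
  induction l with
  | nil => rw [wedge_nil, contract_one]
  | cons v l ih =>
    rw [List.mem_cons, not_or] at hu
    rw [wedge_cons, contract_ι_mul, ih hu.2]
    simp [Ne.symm hu.1]

lemma wedge_map_update [DecidableEq V] (u u' : V) (l : List V) :
    wedge b (l.map (Function.update id u u')) =
      wedge b l + ι R (b u' - b u) * contract (b.coord u) (wedge b l) := by
  induction l with
  | nil => simp [wedge_nil, contract_one]
  | cons v l ih =>
    have hupdate : b (Function.update id u u' v) = b v + b.coord u (b v) • (b u' - b u) := by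
      by_cases h : v = u
      · subst h; simp
      · simp [h]
    rw [List.map_cons, wedge_cons, wedge_cons, contract_ι_mul, ih, hupdate]
    generalize b u' - b u = x
    have hswap : ι R (b v) * ι R x = -(ι R x * ι R (b v)) := eq_neg_of_add_eq_zero_left
      (ι_add_mul_swap _ _)
    simp only [map_add, map_smul, add_mul, mul_add, mul_sub, smul_mul_assoc, mul_smul_comm,
      ← mul_assoc, hswap, ι_sq_zero, neg_mul, zero_mul, smul_zero]
    abel

lemma exists_wedge_eq_smul_of_perm {l l' : List V} (h : l.Perm l') :
    ∃ ε : Rˣ, wedge b l = ε • wedge b l' := by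
  induction h with
  | nil => exact ⟨1, (one_smul _ _).symm⟩
  | cons v _ ih =>
    obtain ⟨ε, hε⟩ := ih
    exact ⟨ε, by rw [wedge_cons, wedge_cons, hε, mul_smul_comm]⟩
  | swap v w l =>
    refine ⟨-1, ?_⟩
    rw [wedge_cons, wedge_cons, wedge_cons, wedge_cons, ← mul_assoc, ← mul_assoc,
      eq_neg_of_add_eq_zero_left (ι_add_mul_swap (R := R) (b w) (b v)), neg_mul, Units.neg_smul,
      one_smul]
  | trans _ _ ih ih' =>
    obtain ⟨ε, hε⟩ := ih
    obtain ⟨ε', hε'⟩ := ih'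
    exact ⟨ε * ε', by rw [hε, hε', mul_smul]⟩

lemma wedge_eq_ιMulti (l : List V) : wedge b l = ιMulti R l.length fun i => b (l.get i) := by
  rw [ιMulti_apply, wedge]
  nth_rewrite 1 [← List.ofFn_get l]
  rw [List.map_ofFn]
  rfl

lemma wedge_of_not_nodup {l : List V} (h : ¬ l.Nodup) : wedge b l = 0 := by
  rw [List.nodup_iff_injective_get] at h
  rw [wedge_eq_ιMulti]
  exact AlternatingMap.map_eq_zero_of_not_injective _ _ fun hinj => h (.of_comp hinj)

lemma wedge_sort [LinearOrder V] (s : Finset V) : wedge b s.sort = b.ExteriorAlgebra s := by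
  rw [ExteriorAlgebra.basis_apply, wedge, ← s.listMap_orderEmbOfFin_finRange rfl, List.map_map,
    ← List.ofFn_eq_map]
  exact (ιMulti_apply _).symm

lemma linearIndependent_wedge {κ : Type*} {l : κ → List V} (hl : ∀ i, (l i).Nodup)
    (hinj : ∀ i j, (l i).Perm (l j) → i = j) : LinearIndependent R fun i => wedge b (l i) := by
  classical
  let := linearOrderOfSTO (WellOrderingRel (α := V))
  have hbasis (i : κ) : ∃ ε : Rˣ, wedge b (l i) = ε • b.ExteriorAlgebra (l i).toFinset := by
    rw [← wedge_sort]
    refine exists_wedge_eq_smul_of_perm b (List.perm_of_nodup_nodup_toFinset_eq (hl i)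
      (Finset.sort_nodup _ _) (Finset.sort_toFinset _ _).symm)
  choose ε hε using hbasis
  rw [funext hε]
  exact (b.ExteriorAlgebra.linearIndependent.comp (fun i => (l i).toFinset) fun i j hij =>
    hinj i j (List.perm_of_nodup_nodup_toFinset_eq (hl i) (hl j) hij)).units_smul ε

end Exterior

/-! ### Acyclicity of the Rips complex -/

section RipsChains

open ExteriorAlgebra

/-- A set of vertices whose mutual distances are at most `N`. The finite sets with this property
are the simplices of the Rips complex of scale `N`. -/
def IsRips {V : Type*} (D : V → V → ℕ) (N : ℕ) (s : Set V) : Prop :=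
  ∀ v ∈ s, ∀ w ∈ s, D v w ≤ N

variable {R M V : Type*} [CommRing R] [AddCommGroup M] [Module R M] {D : V → V → ℕ} {N k : ℕ}

lemma IsRips.mono {s t : Set V} (ht : IsRips D N t) (hst : s ⊆ t) : IsRips D N s :=
  fun v hv w hw => ht v (hst hv) w (hst hw)

lemma IsRips.insert (hself : ∀ v, D v v = 0) (hcomm : ∀ v w, D v w = D w v) {s : Set V}
    (hs : IsRips D N s) {o : V} (ho : ∀ v ∈ s, D v o ≤ N) : IsRips D N (insert o s) := by
  rintro v (rfl | hv) w (rfl | hw)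
  · exact (hself _).trans_le (Nat.zero_le _)
  · exact (hcomm _ w).trans_le (ho w hw)
  · exact ho v hv
  · exact hs v hv w hw

/-- The vertex sequences, possibly with repetitions, of the simplices of the Rips complex that have
`k` vertices, all of them in `F`. -/
def ripsLists (D : V → V → ℕ) (N k : ℕ) (F : Set V) : Set (List V) :=
  {l | l.length = k ∧ {v | v ∈ l} ⊆ F ∧ IsRips D N {v | v ∈ l}}

/-- The chains of the Rips complex on `k` vertices, supported on a set `F` of vertices. They are
indexed by the number of vertices, that is, by the dimension plus one. -/
def ripsChains (b : Module.Basis V R M) (D : V → V → ℕ) (N k : ℕ) (F : Set V) :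
    Submodule R (ExteriorAlgebra R M) :=
  Submodule.span R (wedge b '' ripsLists D N k F)

variable {b : Module.Basis V R M}

lemma wedge_mem_ripsChains {F : Set V} {l : List V} (hl : l ∈ ripsLists D N k F) :
    wedge b l ∈ ripsChains b D N k F :=
  Submodule.subset_span ⟨l, hl, rfl⟩

lemma map_mem_of_mem_ripsChains {F : Set V} {E : Type*} [AddCommGroup E] [Module R E]
    {f : ExteriorAlgebra R M →ₗ[R] E} {p : Submodule R E}
    (hf : ∀ l ∈ ripsLists D N k F, f (wedge b l) ∈ p) {x : ExteriorAlgebra R M}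
    (hx : x ∈ ripsChains b D N k F) : f x ∈ p := by
  have hle : ripsChains b D N k F ≤ p.comap f := by
    refine Submodule.span_le.2 ?_
    rintro _ ⟨l, hl, rfl⟩
    exact hf l hl
  exact hle hx

lemma ripsChains_mono {F F' : Set V} (h : F ⊆ F') :
    ripsChains b D N k F ≤ ripsChains b D N k F' :=
  Submodule.span_mono (Set.image_mono fun _ hl => ⟨hl.1, hl.2.1.trans h, hl.2.2⟩)

lemma contract_mem_ripsChains (d : Module.Dual R M) {F : Set V} {x : ExteriorAlgebra R M}
    (hx : x ∈ ripsChains b D N (k + 1) F) : contract d x ∈ ripsChains b D N k F := by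
  refine map_mem_of_mem_ripsChains (fun l ⟨hlen, hF, hl⟩ => ?_) hx
  refine Submodule.span_mono (Set.image_mono ?_) (contract_wedge_mem b d l)
  rintro l' ⟨hsub, hlen'⟩
  exact ⟨by omega, fun v hv => hF (hsub hv), hl.mono fun v hv => hsub hv⟩

lemma exists_finset_mem_ripsChains {x : ExteriorAlgebra R M}
    (hx : x ∈ ripsChains b D N k Set.univ) :
    ∃ F : Finset V, x ∈ ripsChains b D N k (F : Set V) := by
  classical
  induction hx using Submodule.span_induction with
  | mem x hx =>
    obtain ⟨l, ⟨hlen, -, hl⟩, rfl⟩ := hx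
    exact ⟨l.toFinset, wedge_mem_ripsChains ⟨hlen, by simp, hl⟩⟩
  | zero => exact ⟨∅, zero_mem _⟩
  | add x y _ _ hx hy =>
    obtain ⟨F, hF⟩ := hx
    obtain ⟨F', hF'⟩ := hy
    refine ⟨F ∪ F', add_mem (ripsChains_mono ?_ hF) (ripsChains_mono ?_ hF')⟩ <;> simp
  | smul r x _ hx =>
    obtain ⟨F, hF⟩ := hx
    exact ⟨F, Submodule.smul_mem _ _ hF⟩

section Push

variable (hself : ∀ v, D v v = 0) (hcomm : ∀ v w, D v w = D w v)
include hself hcomm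

lemma cons_mem_ripsLists {F : Set V} {o : V} (ho : ∀ v ∈ F, D v o ≤ N) {l : List V}
    (hl : l ∈ ripsLists D N k F) : o :: l ∈ ripsLists D N (k + 1) Set.univ := by
  refine ⟨by simp [hl.1], Set.subset_univ _, ?_⟩
  exact (hl.2.2.insert hself hcomm fun v hv => ho v (hl.2.1 hv)).mono
    fun v hv => List.mem_cons.1 hv

lemma ι_mul_mem_ripsChains {F : Set V} {o : V} (ho : ∀ v ∈ F, D v o ≤ N)
    {x : ExteriorAlgebra R M} (hx : x ∈ ripsChains b D N k F) :
    ι R (b o) * x ∈ ripsChains b D N (k + 1) Set.univ := by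
  refine map_mem_of_mem_ripsChains (f := LinearMap.mulLeft R (ι R (b o))) (fun l hl => ?_) hx
  rw [LinearMap.mulLeft_apply, ← wedge_cons]
  exact wedge_mem_ripsChains (cons_mem_ripsLists hself hcomm ho hl)

variable [DecidableEq V] {F : Finset V} {u u' : V} (hpush : ∀ w ∈ F, D w u ≤ N → D w u' ≤ N)
include hpush

lemma map_update_mem_ripsLists {l : List V} (hl : l ∈ ripsLists D N k (F : Set V)) :
    l.map (Function.update id u u') ∈ ripsLists D N k (insert u' (F.erase u) : Finset V) := by
  obtain ⟨hlen, hF, hl⟩ := hl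
  refine ⟨by rw [List.length_map, hlen], fun v hv => ?_, ?_⟩
  · obtain ⟨w, hw, rfl⟩ := List.mem_map.1 hv
    by_cases hwu : w = u
    · simp [hwu]
    · simpa [Function.update_of_ne hwu, hwu] using Or.inr (hF hw)
  by_cases hu : u ∈ l
  · refine (hl.insert hself hcomm (o := u') fun v hv =>
      hpush v (hF hv) (hl v hv u hu)).mono fun v hv => ?_
    obtain ⟨w, hw, rfl⟩ := List.mem_map.1 hv
    by_cases hwu : w = u
    · simp [hwu]
    · simpa [Function.update_of_ne hwu] using Or.inr hw
  · rwa [List.map_congr_left (g := id), List.map_id]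
    intro v hv
    exact Function.update_of_ne (fun h : v = u => hu (h ▸ hv)) _ _

lemma push_mem_ripsChains {x : ExteriorAlgebra R M} (hx : x ∈ ripsChains b D N k (F : Set V)) :
    x + ι R (b u' - b u) * contract (b.coord u) x ∈
      ripsChains b D N k (insert u' (F.erase u) : Finset V) := by
  refine map_mem_of_mem_ripsChains (f := LinearMap.id +
    LinearMap.mulLeft R (ι R (b u' - b u)) ∘ₗ contract (b.coord u)) (fun l hl => ?_) hx
  have hmem := wedge_mem_ripsChains (b := b) (map_update_mem_ripsLists hself hcomm hpush hl)
  rwa [wedge_map_update] at hmem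

omit [DecidableEq V] in
/-- The chain that is swept out when the vertex `u` is pushed to `u'`. -/
lemma ι_mul_ι_mul_contract_mem_ripsChains {x : ExteriorAlgebra R M}
    (hx : x ∈ ripsChains b D N k (F : Set V)) :
    ι R (b u') * (ι R (b u) * contract (b.coord u) x) ∈
      ripsChains b D N (k + 1) Set.univ := by
  refine map_mem_of_mem_ripsChains (f := LinearMap.mulLeft R (ι R (b u')) ∘ₗ
    LinearMap.mulLeft R (ι R (b u)) ∘ₗ contract (b.coord u)) (fun l ⟨hlen, hF, hl⟩ => ?_) hx
  by_cases hu : u ∈ l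
  swap
  · simp [contract_coord_wedge_of_notMem b hu]
  rw [LinearMap.comp_apply, LinearMap.comp_apply, ← Submodule.mem_comap, ← Submodule.mem_comap]
  refine Submodule.span_le.2 ?_ (contract_wedge_mem b (b.coord u) l)
  rintro _ ⟨l', ⟨hsub, hlen'⟩, rfl⟩
  have hcons : u :: l' ⊆ l := List.cons_subset.2 ⟨hu, hsub⟩
  have hmem : u :: l' ∈ ripsLists D N k {v | v ∈ l} :=
    ⟨by rw [List.length_cons]; omega, fun v hv => hcons hv, hl.mono fun v hv => hcons hv⟩
  have hclose : ∀ v ∈ {v | v ∈ l}, D v u' ≤ N := fun v hv => hpush v (hF hv) (hl v hv u hu)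
  simpa only [SetLike.mem_coe, Submodule.mem_comap, LinearMap.mulLeft_apply, wedge_cons] using
    wedge_mem_ripsChains (b := b) (cons_mem_ripsLists hself hcomm hclose hmem)

end Push

lemma contract_ι_mul_ι_mul_contract {aug : Module.Dual R M} (haug : ∀ v, aug (b v) = 1) (u u' : V)
    {x : ExteriorAlgebra R M} (hx : contract aug x = 0) :
    contract aug (ι R (b u') * (ι R (b u) * contract (b.coord u) x)) =
      -(ι R (b u' - b u) * contract (b.coord u) x) := by
  rw [contract_ι_mul, contract_ι_mul, contract_comm aug, hx, haug, haug, map_sub, sub_mul]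
  simp

/-- If a set `F` of vertices is not contained in a small ball around `o`, then its vertex farthest
from `o` can be pushed towards `o`. By the four point condition, the new vertex is close to all
vertices of `F` to which the old one is close. -/
lemma IsProperHyperbolic.exists_push [DecidableEq V] {G : Type*} [Group G] [MulAction G V] {c : ℕ}
    (hD : IsProperHyperbolic G D c) (hN : 2 * c + 1 ≤ N) {o : V} {F : Finset V}
    (hF : ∃ v ∈ F, N < D v o) :
    ∃ u u', (∀ w ∈ F, D w u ≤ N → D w u' ≤ N) ∧
      ∑ v ∈ insert u' (F.erase u), D v o < ∑ v ∈ F, D v o := by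
  obtain ⟨v, hv, hvN⟩ := hF
  obtain ⟨u, huF, humax⟩ := F.exists_max_image (fun v => D v o) ⟨v, hv⟩
  have huN : N < D u o := hvN.trans_le (humax v hv)
  have huo : u ≠ o := by
    rintro rfl
    exact absurd (hD.self u) (by omega)
  obtain ⟨u', -, -, huu', hu'o⟩ := hD.exists_between u o (c + 1) (by omega) (by omega)
  refine ⟨u, u', fun w hw hwu => ?_, ?_⟩
  · by_cases hwu' : w = u'
    · rw [hwu', hD.self]
      exact Nat.zero_le _
    have := hD.fourPoint u w o u' hwu' huo
    have := humax w hw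
    have := hD.comm o u'
    have := hD.comm u w
    omega
  · have hinsert : ∑ v ∈ insert u' (F.erase u), D v o ≤ D u' o + ∑ v ∈ F.erase u, D v o := by
      by_cases hmem : u' ∈ F.erase u
      · rw [Finset.insert_eq_of_mem hmem]
        exact Nat.le_add_left _ _
      · rw [Finset.sum_insert hmem]
    have := Finset.add_sum_erase F (fun v => D v o) huF
    omega

theorem IsProperHyperbolic.exists_contract_eq {G : Type*} [Group G] [MulAction G V] {c : ℕ}
    (hD : IsProperHyperbolic G D c) (hN : 2 * c + 1 ≤ N) {aug : Module.Dual R M}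
    (haug : ∀ v, aug (b v) = 1) (o : V) {x : ExteriorAlgebra R M}
    (hx : x ∈ ripsChains b D N k Set.univ) (hx0 : contract aug x = 0) :
    ∃ y ∈ ripsChains b D N (k + 1) Set.univ, contract aug y = x := by
  classical
  obtain ⟨F, hF⟩ := exists_finset_mem_ripsChains hx
  clear hx
  induction hn : ∑ v ∈ F, D v o using Nat.strong_induction_on generalizing F x with
  | _ n ih =>
  by_cases hclose : ∀ v ∈ F, D v o ≤ N
  · refine ⟨ι R (b o) * x, ι_mul_mem_ripsChains hD.self hD.comm hclose hF, ?_⟩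
    rw [contract_ι_mul, hx0, haug, mul_zero, sub_zero, one_smul]
  push Not at hclose
  obtain ⟨u, u', hpush, hlt⟩ := hD.exists_push hN hclose
  have hswept := contract_ι_mul_ι_mul_contract haug u u' hx0
  have hpushed : contract aug (x + ι R (b u' - b u) * contract (b.coord u) x) = 0 := by
    rw [← neg_eq_iff_eq_neg] at hswept
    rw [map_add, hx0, ← hswept, map_neg, contract_contract, neg_zero, add_zero]
  obtain ⟨y, hy, hxy⟩ :=
    ih _ (hn ▸ hlt) hpushed _ (push_mem_ripsChains hD.self hD.comm hpush hF) rfl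
  refine ⟨y + ι R (b u') * (ι R (b u) * contract (b.coord u) x),
    add_mem hy (ι_mul_ι_mul_contract_mem_ripsChains hD.self hD.comm hpush hF), ?_⟩
  rw [map_add, hxy, hswept, add_neg_cancel_right]

end RipsChains

/-! ### The chain modules of the Rips complex -/

section Simplices

open scoped Pointwise

variable {G V : Type*} [Group G] [MulAction G V] {D : V → V → ℕ} {c : ℕ}

/-- The simplices of the Rips complex of scale `N` that have `k` vertices. -/
def ripsSimplices (D : V → V → ℕ) (N k : ℕ) : Set (Finset V) :=
  {s | s.card = k ∧ IsRips D N (s : Set V)}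

lemma toFinset_mem_ripsSimplices [DecidableEq V] {N k : ℕ} {F : Set V} {l : List V}
    (hl : l ∈ ripsLists D N k F) (hnodup : l.Nodup) : l.toFinset ∈ ripsSimplices D N k := by
  refine ⟨by rw [List.toFinset_card_of_nodup hnodup, hl.1], ?_⟩
  rw [List.coe_toFinset]
  exact hl.2.2

lemma toList_mem_ripsLists {N k : ℕ} {s : Finset V} (hs : s ∈ ripsSimplices D N k) :
    s.toList ∈ ripsLists D N k Set.univ :=
  ⟨by rw [Finset.length_toList, hs.1], Set.subset_univ _, hs.2.mono fun _ => Finset.mem_toList.1⟩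

namespace IsProperHyperbolic

variable [DecidableEq V]

lemma exists_finite_simplices (hD : IsProperHyperbolic G D c) (N : ℕ) :
    ∃ T : Set (Finset V), T.Finite ∧ ∀ k, 2 ≤ k → ∀ s ∈ ripsSimplices D N k,
      ∃ g : G, g • s ∈ T := by
  obtain ⟨P, hP, hcof⟩ := hD.cofinite N
  refine ⟨⋃ p ∈ P ∩ {p | p.1 ≠ p.2}, {t | (t : Set V) ⊆ {v | D p.1 v ≤ N ∧ D p.2 v ≤ N}}, ?_, ?_⟩
  · refine (hP.inter_of_left _).biUnion fun p hp => ?_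
    have hfin := hD.finite_inter p.1 p.2 N hp.2
    refine hfin.toFinset.powerset.finite_toSet.subset fun t ht => ?_
    rw [Finset.mem_coe, Finset.mem_powerset]
    exact fun v hv => hfin.mem_toFinset.2 (ht hv)
  · intro k hk s hs
    obtain ⟨v, hv, w, hw, hvw⟩ := Finset.one_lt_card.1 (hk.trans_eq hs.1.symm)
    obtain ⟨g, hg⟩ := hcof v w (hs.2 v hv w hw)
    refine ⟨g, Set.mem_biUnion (x := (g • v, g • w)) ⟨hg, fun h => hvw (smul_left_cancel g h)⟩ ?_⟩
    intro x hx
    obtain ⟨x, hx', rfl⟩ := Finset.mem_smul_finset.1 hx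
    exact ⟨(hD.smul g v x).trans_le (hs.2 v hv x hx'),
      (hD.smul g w x).trans_le (hs.2 w hw x hx')⟩

lemma finite_stabilizer_finset (hD : IsProperHyperbolic G D c) {s : Finset V} (hs : 2 ≤ s.card) :
    (MulAction.stabilizer G s : Set G).Finite := by
  obtain ⟨v, hv, w, hw, hvw⟩ := Finset.one_lt_card.1 hs
  have hmem {g : G} (hg : g ∈ MulAction.stabilizer G s) {x : V} (hx : x ∈ s) : g • x ∈ s := by
    rw [← MulAction.mem_stabilizer_iff.1 hg]
    exact Finset.smul_mem_smul_finset hx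
  refine Set.Finite.of_finite_fibers (fun g => (g • v, g • w))
    ((s ×ˢ s).finite_toSet.subset ?_) ?_
  · rintro _ ⟨g, hg, rfl⟩
    simp [hmem hg hv, hmem hg hw]
  · rintro _ ⟨g, -, rfl⟩
    refine ((hD.finite_stabilizer v w hvw).image (g * ·)).subset ?_
    rintro h ⟨-, hh⟩
    obtain ⟨hhv, hhw⟩ := Prod.mk.inj hh
    exact ⟨g⁻¹ * h, ⟨by rw [mul_smul, hhv, inv_smul_smul], by rw [mul_smul, hhw, inv_smul_smul]⟩,
      mul_inv_cancel_left g h⟩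

lemma eq_one_of_smul_finset_eq (hD : IsProperHyperbolic G D c)
    (hG : ∀ g : G, IsOfFinOrder g → g = 1) {s : Finset V} (hs : 2 ≤ s.card) {g : G}
    (hg : g • s = s) : g = 1 := by
  have := (hD.finite_stabilizer_finset hs).to_subtype
  exact hG g (Submonoid.isOfFinOrder_coe.2
    (isOfFinOrder_of_finite (⟨g, hg⟩ : MulAction.stabilizer G s)))

lemma exists_orbit_representatives (hD : IsProperHyperbolic G D c) (N : ℕ) {k : ℕ} (hk : 2 ≤ k) :
    ∃ T ⊆ ripsSimplices D N k, T.Finite ∧ (∀ s ∈ T, ∀ t ∈ T, ∀ g : G, g • s = t → s = t) ∧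
      ∀ s ∈ ripsSimplices D N k, ∃ t ∈ T, ∃ g : G, g • t = s := by
  let orbit : Finset V → MulAction.orbitRel.Quotient G (Finset V) := Quotient.mk''
  have horbit {s t : Finset V} : orbit s = orbit t ↔ ∃ g : G, g • t = s :=
    Quotient.eq''.trans MulAction.orbitRel_apply
  obtain ⟨T₀, hfin, hT₀⟩ := hD.exists_finite_simplices N
  obtain ⟨T, hTsub, hT⟩ := Set.exists_subset_bijOn (ripsSimplices D N k) orbit
  refine ⟨T, hTsub, hT.finite_iff_finite.2 ((hfin.image orbit).subset ?_), ?_, ?_⟩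
  · rintro _ ⟨s, hs, rfl⟩
    obtain ⟨g, hg⟩ := hT₀ k hk s hs
    exact ⟨g • s, hg, horbit.2 ⟨g, rfl⟩⟩
  · exact fun s hs t ht g hg => (hT.injOn ht hs (horbit.2 ⟨g, hg⟩)).symm
  · intro s hs
    obtain ⟨t, ht, hts⟩ := hT.surjOn ⟨s, hs, rfl⟩
    exact ⟨t, ht, horbit.1 hts.symm⟩

end IsProperHyperbolic

end Simplices

section ChainModules

open ExteriorAlgebra

variable {R G M V : Type*} [CommRing R] [Group G] [AddCommGroup M] [Module R M]

lemma linearIndependent_asModule {W κ : Type*} [AddCommGroup W] [Module R W]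
    {σ : Representation R G W} {e : κ → W}
    (he : LinearIndependent R fun p : G × κ => σ p.1 (e p.2)) :
    LinearIndependent (MonoidAlgebra R G) fun i => σ.asModuleEquiv.symm (e i) := by
  classical
  rw [linearIndependent_iff'] at he ⊢
  intro F a ha i hi
  have hsmul (T : Finset G) (i : κ) (hT : (a i).coeff.support ⊆ T) :
      σ.asModuleEquiv (a i • σ.asModuleEquiv.symm (e i)) =
        ∑ g ∈ T, (a i).coeff g • σ g (e i) := by
    rw [Representation.asModuleEquiv_map_smul, Representation.asAlgebraHom_def,
      MonoidAlgebra.lift_apply, Finsupp.sum_of_support_subset _ hT _ (by simp)]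
    simp
  let T := F.biUnion fun i => (a i).coeff.support
  have hzero : ∑ p ∈ T ×ˢ F, (a p.2).coeff p.1 • σ p.1 (e p.2) = 0 := by
    rw [Finset.sum_product_right, ← map_zero σ.asModuleEquiv, ← ha, map_sum]
    exact Finset.sum_congr rfl fun i hi =>
      (hsmul T i (Finset.subset_biUnion_of_mem (fun i => (a i).coeff.support) hi)).symm
  ext g
  by_contra hg
  exact hg (he _ _ hzero (g, i) (Finset.mk_mem_product
    (Finset.mem_biUnion.2 ⟨i, hi, Finsupp.mem_support_iff.2 hg⟩) hi))

/-- The representation on the exterior algebra that is induced by a representation. -/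
def extRep (ρ : Representation R G M) : Representation R G (ExteriorAlgebra R M) where
  toFun g := (ExteriorAlgebra.map (ρ g)).toLinearMap
  map_one' := by
    rw [map_one, Module.End.one_eq_id, ExteriorAlgebra.map_id]
    rfl
  map_mul' g h := by
    rw [map_mul, Module.End.mul_eq_comp, ← ExteriorAlgebra.map_comp_map]
    rfl

lemma extRep_apply (ρ : Representation R G M) (g : G) (x : ExteriorAlgebra R M) :
    extRep ρ g x = ExteriorAlgebra.map (ρ g) x := rfl

variable [MulAction G V] {D : V → V → ℕ} {c : ℕ} {ρ : Representation R G M}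
  {b : Module.Basis V R M}

lemma extRep_wedge (hρ : ∀ g v, ρ g (b v) = b (g • v)) (g : G) (l : List V) :
    extRep ρ g (wedge b l) = wedge b (l.map (g • ·)) := by
  simp only [extRep_apply, wedge, map_list_prod, List.map_map, Function.comp_def, map_apply_ι, hρ]

lemma extRep_mem_ripsChains (hD : IsProperHyperbolic G D c) (hρ : ∀ g v, ρ g (b v) = b (g • v))
    {N k : ℕ} (g : G) {x : ExteriorAlgebra R M} (hx : x ∈ ripsChains b D N k Set.univ) :
    extRep ρ g x ∈ ripsChains b D N k Set.univ := by
  refine map_mem_of_mem_ripsChains (fun l ⟨hlen, _, hl⟩ => ?_) hx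
  rw [extRep_wedge hρ]
  refine wedge_mem_ripsChains ⟨by rw [List.length_map, hlen], Set.subset_univ _, ?_⟩
  intro v hv w hw
  obtain ⟨v, hv', rfl⟩ := List.mem_map.1 hv
  obtain ⟨w, hw', rfl⟩ := List.mem_map.1 hw
  exact (hD.smul g v w).trans_le (hl v hv' w hw')

/-- The chains of the Rips complex on `k` vertices, as a module over the group ring. -/
def ripsModule (hD : IsProperHyperbolic G D c) (hρ : ∀ g v, ρ g (b v) = b (g • v)) (N k : ℕ) :
    Submodule (MonoidAlgebra R G) (extRep ρ).asModule :=
  (extRep ρ).mapSubmodule ⟨ripsChains b D N k Set.univ,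
    (extRep ρ).mem_invtSubmodule.2 fun g _ hx => extRep_mem_ripsChains hD hρ g hx⟩

lemma mem_ripsModule {hD : IsProperHyperbolic G D c} {hρ : ∀ g v, ρ g (b v) = b (g • v)}
    {N k : ℕ} {x : (extRep ρ).asModule} :
    x ∈ ripsModule hD hρ N k ↔ (extRep ρ).asModuleEquiv x ∈ ripsChains b D N k Set.univ := by
  constructor
  · rintro ⟨y, hy, rfl⟩
    exact hy
  · exact fun hx => ⟨_, hx, rfl⟩

variable (ρ b) in
/-- A simplex, oriented by an arbitrary enumeration of its vertices, as a chain. -/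
def simplexChain (s : Finset V) : (extRep ρ).asModule :=
  (extRep ρ).asModuleEquiv.symm (wedge b s.toList)

section Pointwise

open scoped Pointwise

variable [DecidableEq V]

lemma toFinset_map_smul_toList (g : G) (s : Finset V) :
    (s.toList.map (g • ·)).toFinset = g • s := by
  ext v
  simp [Finset.mem_smul_finset]

lemma linearIndependent_simplexChain (hD : IsProperHyperbolic G D c)
    (hG : ∀ g : G, IsOfFinOrder g → g = 1) (hρ : ∀ g v, ρ g (b v) = b (g • v))
    {T : Set (Finset V)} (hcard : ∀ s ∈ T, 2 ≤ s.card)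
    (hT : ∀ s ∈ T, ∀ t ∈ T, ∀ g : G, g • s = t → s = t) :
    LinearIndependent (MonoidAlgebra R G) fun s : T => simplexChain ρ b (s : Finset V) := by
  refine linearIndependent_asModule (e := fun s : T => wedge b (s : Finset V).toList) ?_
  simp only [extRep_wedge hρ]
  refine linearIndependent_wedge b
    (fun p => (Finset.nodup_toList _).map (MulAction.injective p.1)) ?_
  rintro ⟨g, s, hs⟩ ⟨h, t, ht⟩ hperm
  have heq : g • s = h • t := by
    rw [← toFinset_map_smul_toList, ← toFinset_map_smul_toList]
    exact List.toFinset_eq_of_perm _ _ hperm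
  have hfix : (h⁻¹ * g) • s = t := by rw [mul_smul, heq, inv_smul_smul]
  obtain rfl := hT s hs t ht _ hfix
  obtain rfl := inv_mul_eq_one.1 (hD.eq_one_of_smul_finset_eq hG (hcard s hs) hfix)
  rfl

lemma simplexChain_mem_span {T : Set (Finset V)} (hρ : ∀ g v, ρ g (b v) = b (g • v)) {t : Finset V}
    (ht : t ∈ T) {g : G} {l : List V} (hl : l.Nodup) (hgt : g • t = l.toFinset) :
    (extRep ρ).asModuleEquiv.symm (wedge b l) ∈
      Submodule.span (MonoidAlgebra R G) (Set.range fun s : T => simplexChain ρ b s) := by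
  obtain ⟨ε, hε⟩ := exists_wedge_eq_smul_of_perm b (List.perm_of_nodup_nodup_toFinset_eq hl
    ((Finset.nodup_toList _).map (MulAction.injective g))
    (hgt.symm.trans (toFinset_map_smul_toList g t).symm))
  have hsmul : (extRep ρ).asModuleEquiv.symm (wedge b l) =
      MonoidAlgebra.single g (ε : R) • simplexChain ρ b t := by
    rw [Representation.single_smul, hε, ← extRep_wedge hρ]
    rfl
  rw [hsmul]
  exact Submodule.smul_mem _ _ (Submodule.subset_span ⟨⟨t, ht⟩, rfl⟩)

lemma ripsModule_eq_span (hD : IsProperHyperbolic G D c) (hρ : ∀ g v, ρ g (b v) = b (g • v))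
    {N k : ℕ} {T : Set (Finset V)} (hTsub : T ⊆ ripsSimplices D N k)
    (hT : ∀ s ∈ ripsSimplices D N k, ∃ t ∈ T, ∃ g : G, g • t = s) :
    ripsModule hD hρ N k = Submodule.span (MonoidAlgebra R G)
      (Set.range fun s : T => simplexChain ρ b (s : Finset V)) := by
  refine le_antisymm (fun x hx => ?_) (Submodule.span_le.2 ?_)
  · refine map_mem_of_mem_ripsChains (f := (extRep ρ).asModuleEquiv.symm.toLinearMap)
      (p := (Submodule.span (MonoidAlgebra R G)
        (Set.range fun s : T => simplexChain ρ b (s : Finset V))).restrictScalars R)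
      (fun l hl => ?_) (mem_ripsModule.1 hx)
    by_cases hnodup : l.Nodup
    · obtain ⟨t, ht, g, hgt⟩ := hT _ (toFinset_mem_ripsSimplices hl hnodup)
      exact simplexChain_mem_span hρ ht hnodup hgt
    · rw [wedge_of_not_nodup b hnodup, map_zero]
      exact zero_mem _
  · rintro _ ⟨s, rfl⟩
    exact mem_ripsModule.2 (wedge_mem_ripsChains (toList_mem_ripsLists (hTsub s.2)))

end Pointwise

theorem free_ripsModule (hD : IsProperHyperbolic G D c) (hG : ∀ g : G, IsOfFinOrder g → g = 1)
    (hρ : ∀ g v, ρ g (b v) = b (g • v)) (N : ℕ) {k : ℕ} (hk : 2 ≤ k) :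
    Module.Free (MonoidAlgebra R G) (ripsModule hD hρ N k) ∧
      Module.Finite (MonoidAlgebra R G) (ripsModule hD hρ N k) := by
  classical
  obtain ⟨T, hTsub, hfin, hinj, hsurj⟩ := hD.exists_orbit_representatives N hk
  have hind : LinearIndependent (MonoidAlgebra R G) fun s : T => simplexChain ρ b (s : Finset V) :=
    linearIndependent_simplexChain hD hG hρ (fun s hs => hk.trans_eq (hTsub hs).1.symm) hinj
  rw [ripsModule_eq_span hD hρ hTsub hsurj]
  have := hfin.to_subtype
  exact ⟨.of_basis (.span hind), .span_of_finite _ (Set.finite_range _)⟩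

open scoped Pointwise in
lemma exists_subsingleton_ripsModule (hD : IsProperHyperbolic G D c)
    (hρ : ∀ g v, ρ g (b v) = b (g • v)) (N : ℕ) :
    ∃ n, ∀ k, n < k → Subsingleton (ripsModule hD hρ N k) := by
  classical
  obtain ⟨T, hfin, hT⟩ := hD.exists_finite_simplices N
  obtain ⟨m, hm⟩ := (hfin.image Finset.card).bddAbove
  refine ⟨m + 2, fun k hk => ?_⟩
  rw [ripsModule_eq_span hD hρ subset_rfl fun s hs => ⟨s, hs, 1, one_smul G s⟩,
    Submodule.subsingleton_iff_eq_bot, Submodule.span_eq_bot]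
  rintro _ ⟨⟨s, hs⟩, rfl⟩
  obtain ⟨g, hg⟩ := hT k (by omega) s hs
  have hcard := hm ⟨_, hg, rfl⟩
  rw [Finset.card_smul_finset, hs.1] at hcard
  omega

end ChainModules

/-! ### The resolution -/

section Resolution

open ExteriorAlgebra

lemma ripsChains_one {R M V : Type*} [CommRing R] [AddCommGroup M] [Module R M]
    {b : Module.Basis V R M} {D : V → V → ℕ} (hself : ∀ v, D v v = 0) {N : ℕ} :
    ripsChains b D N 1 Set.univ = LinearMap.range (ι R) := by
  rw [ripsChains, LinearMap.range_eq_map, ← b.span_eq, Submodule.map_span]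
  congr 1
  refine subset_antisymm ?_ ?_
  · rintro _ ⟨l, hl, rfl⟩
    obtain ⟨v, rfl⟩ := List.length_eq_one_iff.1 hl.1
    exact ⟨b v, ⟨v, rfl⟩, (wedge_singleton b v).symm⟩
  · rintro _ ⟨_, ⟨v, rfl⟩, rfl⟩
    exact ⟨[v], ⟨rfl, Set.subset_univ _, by simp [IsRips, hself]⟩, wedge_singleton b v⟩

variable {G : Type u} [Group G] {H : Subgroup G}

/-- The basis of `ℤ[G/H]` that consists of the cosets. -/
def cosetBasis (H : Subgroup G) : Module.Basis (G ⧸ H) ℤ (MonoidAlgebra ℤ (G ⧸ H)) :=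
  Module.Basis.ofRepr (MonoidAlgebra.coeffLinearEquiv ℤ)

lemma cosetBasis_apply (v : G ⧸ H) : cosetBasis H v = MonoidAlgebra.single v 1 := rfl

lemma ofMulAction_cosetBasis (g : G) (v : G ⧸ H) :
    Representation.ofMulAction ℤ G (G ⧸ H) g (cosetBasis H v) = cosetBasis H (g • v) := by
  rw [cosetBasis_apply, cosetBasis_apply, Representation.ofMulAction_single]

lemma coeffSum_cosetBasis (v : G ⧸ H) : coeffSum H (cosetBasis H v) = 1 := by
  simp [coeffSum, cosetBasis_apply]

lemma coeffSum_comp_ofMulAction (g : G) :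
    coeffSum H ∘ₗ Representation.ofMulAction ℤ G (G ⧸ H) g = coeffSum H := by
  refine (cosetBasis H).ext fun v => ?_
  rw [LinearMap.comp_apply, ofMulAction_cosetBasis, coeffSum_cosetBasis, coeffSum_cosetBasis]

/-- The exterior algebra of `ℤ[G/H]`, as a `ℤG`-module. -/
abbrev CosetExterior (H : Subgroup G) : Type u :=
  (extRep (Representation.ofMulAction ℤ G (G ⧸ H))).asModule

/-- The boundary map of the Rips complex: the contraction by the sum of the coefficients, which
deletes the vertices of a simplex one at a time, with alternating signs. -/
def ripsBoundary (H : Subgroup G) : CosetExterior H →ₗ[MonoidAlgebra ℤ G] CosetExterior H :=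
  Representation.IntertwiningMap.equivLinearMapAsModule _ _
    { toLinearMap := contract (coeffSum H)
      isIntertwining' := fun g => LinearMap.ext fun x => by
        rw [LinearMap.comp_apply, LinearMap.comp_apply, extRep_apply, extRep_apply, contract_map,
          coeffSum_comp_ofMulAction] }

lemma ripsBoundary_apply (x : CosetExterior H) :
    (extRep _).asModuleEquiv (ripsBoundary H x) =
      contract (coeffSum H) ((extRep _).asModuleEquiv x) := rfl

lemma ripsBoundary_ripsBoundary (x : CosetExterior H) : ripsBoundary H (ripsBoundary H x) = 0 :=
  contract_contract _ _

/-- The inclusion of `ℤ[G/H]` into its exterior algebra. -/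
def ripsInclusion (H : Subgroup G) : CosetModule H →ₗ[MonoidAlgebra ℤ G] CosetExterior H :=
  Representation.IntertwiningMap.equivLinearMapAsModule _ _
    { toLinearMap := ι ℤ
      isIntertwining' := fun g => LinearMap.ext fun x => by
        rw [LinearMap.comp_apply, LinearMap.comp_apply, extRep_apply, map_apply_ι] }

lemma ripsInclusion_apply (x : CosetModule H) :
    (extRep _).asModuleEquiv (ripsInclusion H x) =
      ι ℤ ((Representation.ofMulAction ℤ G (G ⧸ H)).asModuleEquiv x) := rfl

lemma ripsInclusion_injective (H : Subgroup G) : Function.Injective (ripsInclusion H) :=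
  ι_leftInverse.injective

lemma ripsBoundary_ripsInclusion_eq_zero_iff (x : CosetModule H) :
    ripsBoundary H (ripsInclusion H x) = 0 ↔ x ∈ Delta H := by
  rw [← (extRep (Representation.ofMulAction ℤ G (G ⧸ H))).asModuleEquiv.map_eq_zero_iff,
    ripsBoundary_apply, ripsInclusion_apply, contract_ι,
    map_eq_zero_iff _ (algebraMap_leftInverse (R := ℤ) (MonoidAlgebra ℤ (G ⧸ H))).injective,
    LinearMap.mem_ker]
  rfl

variable {D : G ⧸ H → G ⧸ H → ℕ} {c : ℕ}

/-- The chain modules of the Rips complex on the set of cosets, indexed by the number of vertices.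
Its scale is large enough for the complex to be acyclic. -/
abbrev cosetRips (hD : IsProperHyperbolic G D c) (k : ℕ) :
    Submodule (MonoidAlgebra ℤ G) (CosetExterior H) :=
  ripsModule hD (ofMulAction_cosetBasis (H := H)) (2 * c + 1) k

lemma ripsBoundary_mem_cosetRips (hD : IsProperHyperbolic G D c) {k : ℕ} {x : CosetExterior H}
    (hx : x ∈ cosetRips hD (k + 1)) : ripsBoundary H x ∈ cosetRips hD k :=
  mem_ripsModule.2 (contract_mem_ripsChains _ (mem_ripsModule.1 hx))

lemma exists_ripsBoundary_eq (hD : IsProperHyperbolic G D c) {k : ℕ} {x : CosetExterior H}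
    (hx : x ∈ cosetRips hD k) (hx0 : ripsBoundary H x = 0) :
    ∃ y ∈ cosetRips hD (k + 1), ripsBoundary H y = x := by
  obtain ⟨y, hy, hxy⟩ := hD.exists_contract_eq le_rfl coeffSum_cosetBasis ((1 : G) : G ⧸ H)
    (mem_ripsModule.1 hx) hx0
  exact ⟨y, mem_ripsModule.2 hy, hxy⟩

lemma cosetRips_one (hD : IsProperHyperbolic G D c) :
    cosetRips hD 1 = LinearMap.range (ripsInclusion H) := by
  ext x
  rw [mem_ripsModule, ripsChains_one hD.self]
  rfl

/-- The boundary map from the chains on two vertices, with values in the span `ℤ[G/H]` of the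
vertices. -/
def ripsAugmentation (hD : IsProperHyperbolic G D c) :
    cosetRips hD 2 →ₗ[MonoidAlgebra ℤ G] CosetModule H :=
  (LinearEquiv.ofInjective (ripsInclusion H) (ripsInclusion_injective H)).symm.toLinearMap ∘ₗ
    (ripsBoundary H).restrict fun _ hx => by
      rw [← cosetRips_one hD]
      exact ripsBoundary_mem_cosetRips hD hx

lemma ripsInclusion_ripsAugmentation (hD : IsProperHyperbolic G D c) (x : cosetRips hD 2) :
    ripsInclusion H (ripsAugmentation hD x) = ripsBoundary H x :=
  congrArg Subtype.val ((LinearEquiv.ofInjective _ (ripsInclusion_injective H)).apply_symm_apply _)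

lemma ripsAugmentation_eq_zero_iff (hD : IsProperHyperbolic G D c) (x : cosetRips hD 2) :
    ripsAugmentation hD x = 0 ↔ ripsBoundary H x = 0 := by
  rw [← ripsInclusion_ripsAugmentation hD, map_eq_zero_iff _ (ripsInclusion_injective H)]

lemma range_ripsAugmentation (hD : IsProperHyperbolic G D c) :
    LinearMap.range (ripsAugmentation hD) = Delta H := by
  ext x
  rw [← ripsBoundary_ripsInclusion_eq_zero_iff]
  constructor
  · rintro ⟨y, rfl⟩
    rw [ripsInclusion_ripsAugmentation, ripsBoundary_ripsBoundary]
  · intro hx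
    obtain ⟨y, hy, hxy⟩ := exists_ripsBoundary_eq hD
      ((cosetRips_one hD).ge (LinearMap.mem_range_self _ x)) hx
    exact ⟨⟨y, hy⟩, ripsInclusion_injective H ((ripsInclusion_ripsAugmentation hD _).trans hxy)⟩

/-- The restriction of the boundary map to the chains on `k + 1` vertices. -/
def cosetRipsBoundary (hD : IsProperHyperbolic G D c) (k : ℕ) :
    cosetRips hD (k + 1) →ₗ[MonoidAlgebra ℤ G] cosetRips hD k :=
  (ripsBoundary H).restrict fun _ hx => ripsBoundary_mem_cosetRips hD hx

lemma mem_range_cosetRipsBoundary (hD : IsProperHyperbolic G D c) {k : ℕ} {x : cosetRips hD k} :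
    x ∈ Set.range (cosetRipsBoundary hD k) ↔ ripsBoundary H x = 0 := by
  constructor
  · rintro ⟨y, rfl⟩
    exact ripsBoundary_ripsBoundary _
  · intro hx
    obtain ⟨y, hy, hxy⟩ := exists_ripsBoundary_eq hD x.2 hx
    exact ⟨⟨y, hy⟩, Subtype.ext hxy⟩

theorem hasFiniteFreeResolution_delta (hG : ∀ g : G, IsOfFinOrder g → g = 1)
    (hD : IsProperHyperbolic G D c) :
    HasFiniteFreeResolution (MonoidAlgebra ℤ G) (Delta H) := by
  obtain ⟨n, hn⟩ := exists_subsingleton_ripsModule hD (ofMulAction_cosetBasis (H := H)) (2 * c + 1)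
  refine ⟨n, fun i => ModuleCat.of _ (cosetRips hD (i + 2)),
    fun i => cosetRipsBoundary hD (i + 2),
    (ripsAugmentation hD).codRestrict (Delta H) fun x =>
      (range_ripsAugmentation hD).le (LinearMap.mem_range_self _ x),
    fun i => free_ripsModule hD hG _ _ (by omega), fun i hi => hn (i + 2) (by omega), ?_,
    fun x => ?_, fun i x => ?_⟩
  · rintro ⟨x, hx⟩
    obtain ⟨y, rfl⟩ := (range_ripsAugmentation hD).ge hx
    exact ⟨y, rfl⟩
  · rw [mem_range_cosetRipsBoundary, ← ripsAugmentation_eq_zero_iff, ← Subtype.coe_inj]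
    rfl
  · rw [mem_range_cosetRipsBoundary, ← Subtype.coe_inj]
    rfl

end Resolution

/-! ### Projective dimension -/

section Cohomology

open CategoryTheory

variable {R : Type u} [Ring R] {M : Type u} [AddCommGroup M] [Module R M]

lemma HasFiniteFreeResolution.isTypeFP (h : HasFiniteFreeResolution R M) : IsTypeFP R M := by
  obtain ⟨n, F, d, ε, hF, hexact⟩ := h
  refine ⟨n, F, d, ε, fun i => ⟨?_, (hF i).2⟩, hexact⟩
  have := (hF i).1
  exact Module.Projective.of_free

lemma hasProjectiveDimensionLT_of_surjective {P : ModuleCat.{u} R} {n : ℕ} (ε : P →ₗ[R] M)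
    (hε : Function.Surjective ε) [Module.Projective R P]
    (hker : HasProjectiveDimensionLT (ModuleCat.of R (LinearMap.ker ε)) n) :
    HasProjectiveDimensionLT (ModuleCat.of R M) (n + 1) := by
  let S : ShortComplex (ModuleCat.{u} R) :=
    .mk (ModuleCat.ofHom (LinearMap.ker ε).subtype) (ModuleCat.ofHom ε) (by ext x; exact x.2)
  have hS : S.ShortExact :=
    { exact := (ShortComplex.ShortExact.moduleCat_exact_iff_function_exact S).2
        (LinearMap.exact_subtype_ker_map ε)
      mono_f := (ModuleCat.mono_iff_injective _).2 Subtype.val_injective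
      epi_g := (ModuleCat.epi_iff_surjective _).2 hε }
  exact hS.hasProjectiveDimensionLT_X₃ n hker
    (hasProjectiveDimensionLT_of_ge P 1 (n + 1) (by omega))

lemma hasProjectiveDimensionLT_of_exact {n : ℕ} {P : ℕ → ModuleCat.{u} R}
    {d : ∀ i, P (i + 1) →ₗ[R] P i} {ε : P 0 →ₗ[R] M} (hP : ∀ i, Module.Projective R (P i))
    (hn : ∀ i, n ≤ i → Subsingleton (P i)) (hε : Function.Surjective ε)
    (hdε : Function.Exact (d 0) ε) (hd : ∀ i, Function.Exact (d (i + 1)) (d i)) :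
    HasProjectiveDimensionLT (ModuleCat.of R M) n := by
  induction n generalizing M P with
  | zero =>
    have := hn 0 le_rfl
    have : Subsingleton (ModuleCat.of R M) := hε.subsingleton
    exact (ModuleCat.isZero_of_subsingleton _).hasProjectiveDimensionLT_zero
  | succ n ih =>
    have := hP 0
    refine hasProjectiveDimensionLT_of_surjective ε hε (ih (P := fun i => P (i + 1))
      (d := fun i => d (i + 1)) (ε := (d 0).codRestrict (LinearMap.ker ε) hdε.apply_apply_eq_zero)
      (fun i => hP _) (fun i hi => hn _ (by omega)) ?_ ?_ fun i => hd _)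
    · rintro ⟨x, hx⟩
      obtain ⟨y, rfl⟩ := (hdε x).1 hx
      exact ⟨y, rfl⟩
    · intro x
      rw [← hd 0 x, ← Subtype.coe_inj]
      rfl

lemma IsTypeFP.exists_hasProjectiveDimensionLT (h : IsTypeFP R M) :
    ∃ n, HasProjectiveDimensionLT (ModuleCat.of R M) n := by
  obtain ⟨n, P, d, ε, hP, hn, hε, hdε, hd⟩ := h
  exact ⟨n + 1, hasProjectiveDimensionLT_of_exact (fun i => (hP i).1) hn hε hdε hd⟩

lemma relCohomologicalDimension_lt_top {G : Type u} [Group G] {H : Subgroup G} {n : ℕ}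
    (h : HasProjectiveDimensionLT (ModuleCat.of (MonoidAlgebra ℤ G) (Delta H)) n) :
    relCohomologicalDimension H < ⊤ := by
  suffices hle : relCohomologicalDimension H ≤ (n : WithBot ℕ∞) from
    hle.trans_lt (WithBot.coe_lt_coe.2 (WithTop.coe_lt_top n))
  refine sSup_le ?_
  rintro _ ⟨i, rfl, M, hM⟩
  cases i with
  | zero => exact (not_nontrivial PUnit hM).elim
  | succ i =>
    by_contra hlt
    have hi : n ≤ i := by
      by_contra hi
      exact hlt (by exact_mod_cast Nat.succ_le_of_lt (not_le.1 hi))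
    have : Subsingleton (RelCohomology H M (i + 1)) := HasProjectiveDimensionLT.subsingleton
      (ModuleCat.of (MonoidAlgebra ℤ G) (Delta H)) n i hi M
    exact not_nontrivial _ hM

end Cohomology

end RelHyp

end

theorem mainTheorem1 (G : Type u) [Group G] (hG : ∀ g : G, IsOfFinOrder g → g = 1)
    (H : Subgroup G) (hGH : RelHyp.IsHyperbolicRelativeTo G H) :
    RelHyp.HasFiniteFreeResolution (MonoidAlgebra ℤ G) (RelHyp.Delta H) ∧
    RelHyp.IsTypeFP (MonoidAlgebra ℤ G) (RelHyp.Delta H) ∧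
    RelHyp.relCohomologicalDimension H < ⊤ := by
  obtain ⟨S, hfin, hS, hH, hyp, bcp⟩ := hGH
  obtain ⟨K, hK⟩ := RelHyp.exists_fourPoint_coneDist hS hyp
  obtain ⟨κ, hκ⟩ := RelHyp.exists_proj_bound hS hH bcp hK
  obtain ⟨δ, hδ⟩ := RelHyp.IsFineHyperbolic.exists_cusped_fourPoint ⟨hS, hK, hκ⟩
  have hD := RelHyp.isProperHyperbolic_cosetDist hS hfin hδ
  have hres := RelHyp.hasFiniteFreeResolution_delta hG hD
  obtain ⟨n, hn⟩ := hres.isTypeFP.exists_hasProjectiveDimensionLT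
  exact ⟨hres, hres.isTypeFP, RelHyp.relCohomologicalDimension_lt_top hn⟩
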